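/- Let $G$ be a discrete subgroup of $SL_2(\mathbb R)$ acting on the upper half-plane $\mathbb H$ by Möbius transformations (so its image in $PSL_2(\mathbb R)$ is a Fuchsian group; torsion is allowed), and suppose that the hyperbolic orbifold $S=G\backslash\mathbb H$ has finite area. Let $\gamma$ be a simple closed geodesic of length $l=l(\gamma)$ on $S$, with $G$ normalized so that the imaginary axis $\mathcal I$ covers $\gamma$: the stabilizer of $\mathcal I$ in $G$ acts on $\mathbb H$ as the group generated by $z\mapsto \zeta z$, $\zeta=e^{l}$, $l>0$, and every $G$-translate of $\mathcal I$ is equal to $\mathcal I$ or disjoint from it. For $\rho>0$ let $\mathbf C_\rho(\mathcal I)=\{z:\operatorname{dist}(z,\mathcal I)<\rho\}$. Let $r,\varepsilon>0$ be such that either (a) $S$ has no cone points and $r+\varepsilon<R_{l}=\log\coth(l/4)$, or (b) (for orbifolds in general) the collar of width $r+\varepsilon$ is embedded, i.e. $h(\mathbf C_{r+\varepsilon}(\mathcal I))\cap \mathbf C_{r+\varepsilon}(\mathcal I)=\emptyset$ for every $h\in G$ that does not act as a power of $z\mapsto\zeta z$. Let $\tilde\lambda_A=\{z\in\mathbb H:\operatorname{dist}(z,\mathcal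 I)=r,\ \operatorname{Re}z>0\}$, which covers the boundary curve $\lambda_{A_r}$ of the half-collar $A_r$ to the right of $\gamma$, and let $\mathbf s=\{z\in\tilde\lambda_A: 1\le |z|\le \zeta\}$. For real $x\neq y$ write $(x,y,t)\in T_1\mathbb H$ for the tangent vector at time $t$ of the unit speed geodesic oriented from $x$ to $y$ which is at the Euclidean midpoint of its semicircle at time $0$. If this geodesic meets $\tilde\lambda_A$ and the first point at which it does so lies in $\mathbf s$, let $t_{xy}$ be the time of this first meeting. Let $\mathcal E\subset T_1S=G\backslash T_1\mathbb H$ be the set of vectors whose forward orbit under the geodesic flow is dense in $T_1S$. Let $\mathcal J^1_\varepsilon(\lambda_{A_r})$ (respectively $\mathcal J^3_\varepsilon(\lambda_{A_r})$) be the image in $T_1S$ of the set of all $(x,y,t)$ with $0<y<x$ (respectively $y<0<x$) for which $t_{xy}$ is defined, the vector $(x,y,t_{xy})$ projects into $\mathcal E$, and $t_{xy}\le t\le t_{xy}+\varepsilon$. Thus $\mathcal J^3$ comes from the vectors over $\lambda_{A_r}$ that go on to cross $\gamma$, and $\mathcal J^1$ from those that enter the collar on one side of these. Let $\mu$ be the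 Liouville measure on $T_1S$ whose lift to $T_1\mathbb H=\mathbb H\times S^1$ is $\frac{1}{2\pi\,\mathrm{area}(S)}\,dA\,d\varphi$. Then $$\mu\bigl(\mathcal J^1_\varepsilon(\lambda_{A_r})\cup\mathcal J^3_\varepsilon(\lambda_{A_r})\bigr)=\frac{\varepsilon\,(1+\cosh r)\,l(\gamma)}{2\pi\,\mathrm{area}(S)}.$$ -/

import Mathlib

open MeasureTheory UpperHalfPlane
open scoped MatrixGroups

noncomputable section

namespace HypCollar

/-! ### The unit tangent bundle of the hyperbolic plane -/

/-- The unit tangent bundle `T₁ℍ = ℍ × S¹`: the pair `(z, u)` is the tangent vector `(Im z) u` at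
`z`, which has hyperbolic length one and Euclidean direction `u`. -/
@[ext] structure UnitTangent where
  /-- the foot point -/
  base : ℍ
  /-- the Euclidean direction -/
  dir : Circle

instance : TopologicalSpace UnitTangent :=
  TopologicalSpace.induced (fun v => (v.base, v.dir)) inferInstance

instance : MeasurableSpace UnitTangent := borel UnitTangent

instance : BorelSpace UnitTangent := ⟨rfl⟩

/-- The factor of automorphy `c z + d`. -/
def factor (g : SL(2, ℝ)) (z : ℍ) : ℂ := (g 1 0 : ℂ) * z + (g 1 1 : ℂ)

theorem factor_ne_zero (g : SL(2, ℝ)) (z : ℍ) : factor g z ≠ 0 :=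
  denom_ne_zero (g : GL (Fin 2) ℝ) z

theorem coe_smul_eq (g : SL(2, ℝ)) (z : ℍ) :
    ((g • z : ℍ) : ℂ) = ((g 0 0 : ℂ) * z + (g 0 1 : ℂ)) / factor g z := by
  simpa [factor] using coe_specialLinearGroup_apply g z

theorem factor_mul (g h : SL(2, ℝ)) (z : ℍ) :
    factor (g * h) z = factor g (h • z) * factor h z := by
  have h0 := factor_ne_zero h z
  have e : factor g (h • z) =
      (g 1 0 : ℂ) * (((h 0 0 : ℂ) * z + (h 0 1 : ℂ)) / factor h z) + (g 1 1 : ℂ) := by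
    rw [← coe_smul_eq]; rfl
  rw [e, add_mul, mul_assoc, div_mul_cancel₀ _ h0]
  simp only [factor, Matrix.SpecialLinearGroup.coe_mul, Matrix.mul_apply, Fin.sum_univ_two]
  push_cast
  ring

/-- `SL₂(ℝ)` acts on `T₁ℍ` through the differentials of its Möbius transformations: the derivative
of `z ↦ (a z + b) / (c z + d)` is `(c z + d)⁻²`, which is a positive multiple of
`conj (c z + d) / (c z + d)`. -/
instance : SMul SL(2, ℝ) UnitTangent where
  smul g v := ⟨g • v.base,
    Circle.ofConjDivSelf (factor g v.base) (factor_ne_zero g v.base) * v.dir⟩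

theorem base_smul (g : SL(2, ℝ)) (v : UnitTangent) : (g • v).base = g • v.base := rfl

theorem coe_dir_smul (g : SL(2, ℝ)) (v : UnitTangent) :
    ((g • v).dir : ℂ) =
      (starRingEnd ℂ) (factor g v.base) / factor g v.base * (v.dir : ℂ) := rfl

instance : MulAction SL(2, ℝ) UnitTangent where
  one_smul v := by
    refine UnitTangent.ext (by simp [base_smul]) (Circle.ext ?_)
    simp [coe_dir_smul, factor]
  mul_smul g h v := by
    refine UnitTangent.ext (by simp [base_smul, mul_smul]) (Circle.ext ?_)
    simp only [coe_dir_smul, base_smul, factor_mul, map_mul]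
    rw [mul_div_mul_comm, mul_assoc]

/-! ### The geodesic flow -/

/-- Auxiliary denominator in the formula for the geodesic flow. -/
def flowDenom (t : ℝ) (u : Circle) : ℂ :=
  (Real.cosh (t / 2) : ℂ) + Complex.I * u * (Real.sinh (t / 2) : ℂ)

theorem flowDenom_ne_zero (t : ℝ) (u : Circle) : flowDenom t u ≠ 0 := by
  intro h
  have h1 : (Real.cosh (t / 2) : ℂ) = -(Complex.I * u * (Real.sinh (t / 2) : ℂ)) :=
    eq_neg_of_add_eq_zero_left h
  have h2 : |Real.cosh (t / 2)| = |Real.sinh (t / 2)| := by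
    have := congrArg (fun z : ℂ => ‖z‖) h1
    simpa only [norm_neg, norm_mul, Complex.norm_I, Circle.norm_coe, one_mul, Complex.norm_real,
      Real.norm_eq_abs] using this
  have h3 := (sq_eq_sq_iff_abs_eq_abs _ _).2 h2
  have h4 := Real.cosh_sq (t / 2)
  linarith

theorem flow_im_pos (t : ℝ) (z : ℍ) (u : Circle) :
    0 < (((Real.cosh (t / 2) : ℂ) * z + Complex.I * u * (Real.sinh (t / 2) : ℂ) *
      (starRingEnd ℂ) (z : ℂ)) / flowDenom t u).im := by
  have hD := flowDenom_ne_zero t u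
  have hu : (u : ℂ).re * (u : ℂ).re + (u : ℂ).im * (u : ℂ).im = 1 := by
    rw [← Complex.normSq_apply]; exact Circle.normSq_coe u
  have hc := Real.cosh_sq (t / 2)
  have key : (((Real.cosh (t / 2) : ℂ) * z + Complex.I * u * (Real.sinh (t / 2) : ℂ) *
      (starRingEnd ℂ) (z : ℂ)) / flowDenom t u).im = z.im / Complex.normSq (flowDenom t u) := by
    have hN := Complex.normSq_pos.2 hD
    rw [Complex.div_im, ← sub_div]
    congr 1
    simp only [flowDenom, Complex.add_re, Complex.add_im, Complex.mul_re, Complex.mul_im,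
      Complex.ofReal_re, Complex.ofReal_im, Complex.I_re, Complex.I_im, Complex.conj_re,
      Complex.conj_im, UpperHalfPlane.coe_re, UpperHalfPlane.coe_im]
    linear_combination z.im * hc - z.im * Real.sinh (t / 2) ^ 2 * hu
  rw [key]
  exact div_pos z.im_pos (Complex.normSq_pos.2 hD)

/-- The geodesic flow `G_t` on `T₁ℍ`. It is the flow that moves the vertical vector at `i` along
the unit speed geodesic `t ↦ i eᵗ` (`flow_vertical`) and that commutes with the isometric action
of `SL₂(ℝ)` (`flow_smul`). -/
def flow (t : ℝ) (v : UnitTangent) : UnitTangent where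
  base := ⟨((Real.cosh (t / 2) : ℂ) * v.base + Complex.I * v.dir * (Real.sinh (t / 2) : ℂ) *
      (starRingEnd ℂ) (v.base : ℂ)) / flowDenom t v.dir, flow_im_pos t v.base v.dir⟩
  dir := Circle.ofConjDivSelf (flowDenom t v.dir) (flowDenom_ne_zero t v.dir) * v.dir

theorem coe_base_flow (t : ℝ) (v : UnitTangent) : ((flow t v).base : ℂ) =
    ((Real.cosh (t / 2) : ℂ) * v.base + Complex.I * v.dir * (Real.sinh (t / 2) : ℂ) *
      (starRingEnd ℂ) (v.base : ℂ)) / flowDenom t v.dir := rfl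

theorem coe_dir_flow (t : ℝ) (v : UnitTangent) : ((flow t v).dir : ℂ) =
    (starRingEnd ℂ) (flowDenom t v.dir) / flowDenom t v.dir * (v.dir : ℂ) := rfl

theorem flow_vertical (t : ℝ) (u : Circle) (hu : (u : ℂ) = Complex.I) :
    ((flow t ⟨UpperHalfPlane.I, u⟩).base : ℂ) = Real.exp t * Complex.I ∧
      (flow t ⟨UpperHalfPlane.I, u⟩).dir = u := by
  have hD : flowDenom t u = (Real.exp (-(t / 2)) : ℂ) := by
    rw [← Real.cosh_sub_sinh, flowDenom, hu]
    push_cast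
    linear_combination (Complex.sinh (t / 2) : ℂ) * Complex.I_mul_I
  have hE : (Real.exp (-(t / 2)) : ℂ) ≠ 0 := by exact_mod_cast (Real.exp_pos _).ne'
  constructor
  · rw [coe_base_flow, hD, hu, div_eq_iff hE]
    have : (Real.exp t * Complex.I * Real.exp (-(t / 2)) : ℂ) =
        (Real.exp (t / 2) : ℂ) * Complex.I := by
      rw [mul_right_comm, ← Complex.ofReal_mul, ← Real.exp_add]
      congr 3
      ring
    rw [this, ← Real.cosh_add_sinh]
    simp only [UpperHalfPlane.coe_I, Complex.conj_I]
    push_cast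
    linear_combination (-Complex.sinh (t / 2) * Complex.I : ℂ) * Complex.I_mul_I
  · refine Circle.ext ?_
    rw [coe_dir_flow, hD, Complex.conj_ofReal, div_self hE, one_mul]

theorem flowDenom_smul (t : ℝ) (g : SL(2, ℝ)) (v : UnitTangent) :
    flowDenom t (g • v).dir * factor g v.base =
      factor g (flow t v).base * flowDenom t v.dir := by
  have hJ := factor_ne_zero g v.base
  have hW := flowDenom_ne_zero t v.dir
  have e : factor g (flow t v).base * flowDenom t v.dir =
      (g 1 0 : ℂ) * ((Real.cosh (t / 2) : ℂ) * v.base +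
        Complex.I * v.dir * (Real.sinh (t / 2) : ℂ) * (starRingEnd ℂ) (v.base : ℂ)) +
      (g 1 1 : ℂ) * flowDenom t v.dir := by
    rw [factor, coe_base_flow, add_mul, mul_assoc, div_mul_cancel₀ _ hW]
  have e2 : flowDenom t (g • v).dir * factor g v.base =
      (Real.cosh (t / 2) : ℂ) * factor g v.base +
        Complex.I * v.dir * (Real.sinh (t / 2) : ℂ) * (starRingEnd ℂ) (factor g v.base) := by
    rw [flowDenom, coe_dir_smul]
    field_simp
  rw [e, e2]
  simp only [factor, flowDenom, map_add, map_mul, Complex.conj_ofReal]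
  ring

/-- The geodesic flow commutes with the action of the isometries. -/
theorem flow_smul (t : ℝ) (g : SL(2, ℝ)) (v : UnitTangent) :
    flow t (g • v) = g • flow t v := by
  have hJ := factor_ne_zero g v.base
  have hJc : (starRingEnd ℂ) (factor g v.base) ≠ 0 := (map_ne_zero _).2 hJ
  have hW := flowDenom_ne_zero t v.dir
  have hJt := factor_ne_zero g (flow t v).base
  have hWg := flowDenom_ne_zero t (g • v).dir
  have key := flowDenom_smul t g v
  have keyc := congrArg (starRingEnd ℂ) key
  simp only [map_mul] at keyc
  refine UnitTangent.ext (UpperHalfPlane.ext ?_) (Circle.ext ?_)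
  · have h1 : (starRingEnd ℂ) ((g • v.base : ℍ) : ℂ) =
        ((g 0 0 : ℂ) * (starRingEnd ℂ) (v.base : ℂ) + (g 0 1 : ℂ)) /
          (starRingEnd ℂ) (factor g v.base) := by
      rw [coe_smul_eq]
      simp
    have h2 : ((g 0 0 : ℂ) * ((flow t v).base : ℂ) + (g 0 1 : ℂ)) * flowDenom t v.dir =
        (g 0 0 : ℂ) * ((Real.cosh (t / 2) : ℂ) * v.base +
          Complex.I * v.dir * (Real.sinh (t / 2) : ℂ) * (starRingEnd ℂ) (v.base : ℂ)) +
        (g 0 1 : ℂ) * flowDenom t v.dir := by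
      rw [coe_base_flow, add_mul, mul_assoc, div_mul_cancel₀ _ hW]
    rw [base_smul, coe_smul_eq, coe_base_flow, div_eq_div_iff hWg hJt]
    refine mul_right_cancel₀ (mul_ne_zero hJ hW) ?_
    rw [base_smul, h1, coe_smul_eq, coe_dir_smul]
    have h3 : ((Real.cosh (t / 2) : ℂ) *
        (((g 0 0 : ℂ) * v.base + (g 0 1 : ℂ)) / factor g v.base) +
        Complex.I * ((starRingEnd ℂ) (factor g v.base) / factor g v.base * (v.dir : ℂ)) *
        (Real.sinh (t / 2) : ℂ) *
        (((g 0 0 : ℂ) * (starRingEnd ℂ) (v.base : ℂ) + (g 0 1 : ℂ)) /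
          (starRingEnd ℂ) (factor g v.base))) * factor g v.base =
        ((g 0 0 : ℂ) * ((flow t v).base : ℂ) + (g 0 1 : ℂ)) * flowDenom t v.dir := by
      rw [h2, flowDenom]
      field_simp
      ring
    linear_combination (factor g (flow t v).base * flowDenom t v.dir) * h3 -
      ((g 0 0 : ℂ) * ((flow t v).base : ℂ) + (g 0 1 : ℂ)) * flowDenom t v.dir * key
  · rw [coe_dir_smul, coe_dir_flow, coe_dir_flow, coe_dir_smul]
    have hx : (starRingEnd ℂ) (flowDenom t (g • v).dir) / flowDenom t (g • v).dir *
        ((starRingEnd ℂ) (factor g v.base) / factor g v.base) =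
        (starRingEnd ℂ) (factor g (flow t v).base) / factor g (flow t v).base *
        ((starRingEnd ℂ) (flowDenom t v.dir) / flowDenom t v.dir) := by
      rw [div_mul_div_comm, div_mul_div_comm, key, keyc]
    rw [← mul_assoc, hx, mul_assoc]

/-- The Liouville measure `dA dφ` on `T₁ℍ = ℍ × S¹`, where `dA = dx dy / y²` is the hyperbolic area
and `φ ∈ (0, 2π]` is the angle of the direction. -/
def liouvilleUpper : Measure UnitTangent :=
  Measure.map (fun p : ℍ × ℝ => (⟨p.1, Circle.exp p.2⟩ : UnitTangent))
    ((volume : Measure ℍ).prod (volume.restrict (Set.Ioc 0 (2 * Real.pi))))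

/-! ### Endpoint coordinates -/

/-- The unit vector at the Euclidean midpoint (the top) of the semicircular geodesic with endpoints
`x ≠ y`, pointing along the geodesic oriented from `x` to `y`. -/
def topVector (x y : ℝ) (h : x ≠ y) : UnitTangent where
  base := ⟨⟨(x + y) / 2, |x - y| / 2⟩, half_pos (abs_pos.2 (sub_ne_zero.2 h))⟩
  dir := if x < y then 1 else Circle.exp Real.pi

/-- The unit tangent vector with coordinates `(x, y, t)`: the tangent vector at time `t` of the unit
speed geodesic oriented from `x` to `y` that is at the midpoint of its semicircle at time `0`. -/
def coordVector (x y : ℝ) (h : x ≠ y) (t : ℝ) : UnitTangent := flow t (topVector x y h)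

/-! ### The quotient orbifold -/

section Quotient

variable (G : Subgroup SL(2, ℝ))

/-- For a group acting on `X` by transformations preserving `m`, the measure on the orbit space
which is induced by `m`, i.e. whose lift to `X` is `m`: the least measure that gives the image of
`F` mass at least `m F`, compatibly with subsets, for every measurable `F` on which the projection
to the orbit space is injective. If a measurable `D` meets every orbit exactly once, this is
`U ↦ m (D ∩ π⁻¹ U)`. -/
def quotientMeasure (X : Type*) [MeasurableSpace X] [MulAction G X] (m : Measure X) :
    Measure (MulAction.orbitRel.Quotient G X) :=
  ⨆ F : {F : Set X // MeasurableSet F ∧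
      Set.InjOn (fun p => (⟦p⟧ : MulAction.orbitRel.Quotient G X)) F},
    Measure.map (fun p => (⟦p⟧ : MulAction.orbitRel.Quotient G X)) (m.restrict F.1)

/-- The hyperbolic area of the orbifold `S = G \ ℍ`. -/
def surfaceArea : ENNReal := quotientMeasure G ℍ volume Set.univ

/-- The unit tangent bundle `T₁S = G \ T₁ℍ`, with the quotient topology. -/
abbrev UnitTangentQuotient : Type := MulAction.orbitRel.Quotient G UnitTangent

/-- The projection `T₁ℍ → T₁S`. -/
def proj (v : UnitTangent) : UnitTangentQuotient G := ⟦v⟧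

/-- The geodesic flow on `T₁S`. -/
def surfaceFlow (t : ℝ) : UnitTangentQuotient G → UnitTangentQuotient G :=
  Quotient.map (flow t) (by
    rintro _ w ⟨g, rfl⟩
    exact ⟨g, (flow_smul t g w).symm⟩)

/-- The Liouville measure on `T₁S`, whose lift to `T₁ℍ` is `dA dφ / (2π area(S))`. -/
def liouville : Measure (UnitTangentQuotient G) :=
  (ENNReal.ofReal (2 * Real.pi) * surfaceArea G)⁻¹ • quotientMeasure G UnitTangent liouvilleUpper

/-- The set of vectors of `T₁S` whose forward orbit under the geodesic flow is dense in `T₁S`. -/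
def denseOrbitSet : Set (UnitTangentQuotient G) :=
  {w | Dense {w' | ∃ t : ℝ, 0 < t ∧ w' = surfaceFlow G t w}}

end Quotient

/-! ### The closed geodesic and its collar -/

/-- The imaginary half-axis, a geodesic of `ℍ`. -/
def imAxis : Set ℍ := {z | z.re = 0}

/-- `h` acts on `ℍ` as an integral power of `z ↦ e^l z`. -/
def ActsAsPower (l : ℝ) (h : SL(2, ℝ)) : Prop :=
  ∃ n : ℤ, ∀ z : ℍ, ((h • z : ℍ) : ℂ) = (Real.exp l : ℂ) ^ n * (z : ℂ)

/-- The imaginary axis covers a simple closed geodesic of length `l` on `G \ ℍ`: its stabilizer in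
`G` acts as the group generated by `z ↦ e^l z`, and every translate of the axis by `G` is equal to
the axis or disjoint from it. -/
structure CoversSimpleClosedGeodesic (G : Subgroup SL(2, ℝ)) (l : ℝ) : Prop where
  length_pos : 0 < l
  generator : ∃ g ∈ G, ∀ z : ℍ, ((g • z : ℍ) : ℂ) = (Real.exp l : ℂ) * (z : ℂ)
  stabilizer : ∀ h ∈ G, (∀ z ∈ imAxis, h • z ∈ imAxis) → ActsAsPower l h
  simple : ∀ h ∈ G, (∀ z ∈ imAxis, h • z ∈ imAxis) ∨ (∀ z ∈ imAxis, h • z ∉ imAxis)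

/-- The open neighborhood of radius `ρ` of the imaginary axis. -/
def axisNhd (ρ : ℝ) : Set ℍ := {z | Metric.infDist z imAxis < ρ}

/-- The `ρ`-neighborhood of the closed geodesic is an embedded cylinder: an element of `G` that does
not act as a power of `z ↦ e^l z` maps the `ρ`-neighborhood of the axis off itself. -/
def CollarEmbedded (G : Subgroup SL(2, ℝ)) (l ρ : ℝ) : Prop :=
  ∀ h ∈ G, ActsAsPower l h ∨ ∀ z ∈ axisNhd ρ, h • z ∉ axisNhd ρ

/-- `G \ ℍ` has no cone points: an element of `G` with a fixed point in `ℍ` acts trivially. -/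
def NoConePoints (G : Subgroup SL(2, ℝ)) : Prop :=
  ∀ h ∈ G, ∀ z : ℍ, h • z = z → ∀ w : ℍ, h • w = w

/-- The boundary line, in the right half-plane, of the `r`-neighborhood of the imaginary axis. It
covers the boundary curve of the half-collar that lies to the right of the axis. -/
def boundaryLine (r : ℝ) : Set ℍ := {z | Metric.infDist z imAxis = r ∧ 0 < z.re}

/-- The segment of the boundary line between its points of modulus `1` and `e^l`; it is mapped onto
the boundary curve of the half-collar. -/
def boundarySegment (l r : ℝ) : Set ℍ :=
  {z | z ∈ boundaryLine r ∧ 1 ≤ ‖(z : ℂ)‖ ∧ ‖(z : ℂ)‖ ≤ Real.exp l}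

/-- The geodesic oriented from `x` to `y` meets the boundary line for the first time at time `t`, and
it does so at a point of the segment. -/
def FirstHit (l r x y : ℝ) (h : x ≠ y) (t : ℝ) : Prop :=
  (coordVector x y h t).base ∈ boundarySegment l r ∧
    ∀ t' < t, (coordVector x y h t').base ∉ boundaryLine r

/-- The thickened section of `T₁S` over the boundary curve of the half-collar that is determined by
a condition `R` on the endpoints `x`, `y`: take all `(x, y, t₀)` with `R x y` such that the geodesic
from `x` to `y` first meets the boundary line at time `t₀`, in the segment, and such that the vector
`(x, y, t₀)` has a dense forward orbit in `T₁S`; then project all `(x, y, t)` with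
`t₀ ≤ t ≤ t₀ + ε` to `T₁S`. -/
def thickenedSection (G : Subgroup SL(2, ℝ)) (l r ε : ℝ) (R : ℝ → ℝ → Prop) :
    Set (UnitTangentQuotient G) :=
  {w | ∃ (x y : ℝ) (h : x ≠ y) (t₀ t : ℝ), R x y ∧ FirstHit l r x y h t₀ ∧
    proj G (coordVector x y h t₀) ∈ denseOrbitSet G ∧
    t₀ ≤ t ∧ t ≤ t₀ + ε ∧ w = proj G (coordVector x y h t)}

/-- Condition on endpoints: the geodesic enters the collar on one side of those that cross the
axis. -/
def SideCondition (x y : ℝ) : Prop := 0 < y ∧ y < x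

/-- Condition on endpoints: the geodesic crosses the axis from the right to the left. -/
def CrossCondition (x y : ℝ) : Prop := y < 0 ∧ 0 < x

end HypCollar

end

/-!
Both thickened sections consist of geodesics that run from right to left, `y < x`. Such a geodesic is
determined by its highest point `w`, and in the coordinates `(w, t)`, `t` being the time since `w`
was passed, the Liouville measure is the product of the hyperbolic area and `dt`
(`liouvilleUpper_eq_lintegral_flow`, `liouvilleUpper_leftSet`). At time `t` the ratio of the
coordinates of the foot point is `k cosh t - sinh t`, where `k = re w / im w`, and the geodesic meets
the boundary line of the `r`-collar when this ratio equals `sinh r`. For `k > -1`, i.e. `x > 0`, this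
happens if and only if `k ≤ cosh r`, the first time `hitTime r k` depends on `k` only, and the
modulus of the point of entrance is `im w` times a function of `k` (`firstHit_iff`). With
`w = exp σ * (k + i)` the hyperbolic area is `dk dσ` (`volume_eq_prod`). For each `k` in
`(-1, cosh r]`, the condition on the modulus restricts `σ` to an interval of length `l`, and then `t`
ranges over an interval of length `ε`, so these vectors have measure `(1 + cosh r) l ε`. The
two conditions on the endpoints are `k > 1` and `-1 < k < 1`; the value `k = 1` does not matter.

Passing to the quotient does not change this measure. The vectors in question lie over the
`(r + ε)`-collar, which is embedded: in the case without cone points, by the collar theorem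
(`collarEmbedded_of_noConePoints`), where a translate of the axis that comes too close would produce
an elliptic element. Hence only powers of `z ↦ e^l z` can identify two of them, and these multiply
the modulus of the point of entrance by a power of `e^l` (`injOn_leftSet_entranceSet`). The
measure on the quotient is computed on a fundamental set (`quotientMeasure_eq_map`).

The restriction to vectors with dense forward orbits does not change the measure either, because
almost all vectors have this property (`exists_flow_invariant_dense`). This is shown by Hopf's
argument. The geodesic flow preserves the Liouville measure of the quotient, which is finite, so
by Poincaré's theorem almost every vector that visits an open set returns to it in the past and in
the future (`ae_recurrent`). Geodesics with a common endpoint are asymptotic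
(`tendsto_vecDist_forward`, `tendsto_vecDist_backward`), so that recurrence in the future depends on
the forward endpoint only and recurrence in the past on the backward endpoint only, up to a small
change of the open set. By Fubini's theorem, applied to pairs of endpoints, almost every
geodesic visits a given open set (`ae_visitsForward`).
-/

noncomputable section

namespace HypCollar

open Filter Topology Set
open scoped ENNReal

/-! ### The unit tangent bundle as a measure space -/

theorem continuous_base : Continuous UnitTangent.base :=
  (continuous_fst (X := ℍ) (Y := Circle)).comp (f := fun v : UnitTangent => (v.base, v.dir))
    continuous_induced_dom

theorem continuous_dir : Continuous UnitTangent.dir :=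
  (continuous_snd (X := ℍ) (Y := Circle)).comp (f := fun v : UnitTangent => (v.base, v.dir))
    continuous_induced_dom

/-- The trivialization `T₁ℍ ≃ₜ ℍ × S¹`. -/
def trivialization : UnitTangent ≃ₜ ℍ × Circle where
  toFun v := (v.base, v.dir)
  invFun p := ⟨p.1, p.2⟩
  left_inv _ := rfl
  right_inv _ := rfl
  continuous_toFun := continuous_induced_dom
  continuous_invFun := continuous_induced_rng.2 continuous_id

theorem continuous_mk_iff {X : Type*} [TopologicalSpace X] {f : X → UnitTangent} :
    Continuous f ↔ Continuous (fun x => (f x).base) ∧ Continuous (fun x => (f x).dir) := by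
  rw [← trivialization.comp_continuous_iff]
  exact continuous_prodMk

instance : SecondCountableTopology UnitTangent :=
  trivialization.isInducing.secondCountableTopology

instance : T2Space UnitTangent := trivialization.isEmbedding.t2Space

theorem continuous_ofConjDivSelf {X : Type*} [TopologicalSpace X] {f : X → ℂ} (hf : Continuous f)
    (h0 : ∀ x, f x ≠ 0) : Continuous fun x => Circle.ofConjDivSelf (f x) (h0 x) := by
  refine continuous_induced_rng.2 ?_
  exact (Complex.continuous_conj.comp hf).div hf h0

theorem continuous_smul_unitTangent (g : SL(2, ℝ)) :
    Continuous fun v : UnitTangent => g • v := by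
  refine continuous_mk_iff.2 ⟨(continuous_const_smul g).comp continuous_base, ?_⟩
  refine Continuous.mul (continuous_ofConjDivSelf ?_ _) continuous_dir
  exact (continuous_const.mul (UpperHalfPlane.continuous_coe.comp continuous_base)).add
    continuous_const

theorem continuous_flow : Continuous fun p : ℝ × UnitTangent => flow p.1 p.2 := by
  have hb : Continuous fun p : ℝ × UnitTangent => (p.2.base : ℂ) :=
    UpperHalfPlane.continuous_coe.comp (continuous_base.comp continuous_snd)
  have hd : Continuous fun p : ℝ × UnitTangent => (p.2.dir : ℂ) :=
    continuous_induced_dom.comp (continuous_dir.comp continuous_snd)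
  have hc : Continuous fun p : ℝ × UnitTangent => (Real.cosh (p.1 / 2) : ℂ) := by fun_prop
  have hs : Continuous fun p : ℝ × UnitTangent => (Real.sinh (p.1 / 2) : ℂ) := by fun_prop
  have hD : Continuous fun p : ℝ × UnitTangent => flowDenom p.1 p.2.dir :=
    hc.add ((continuous_const.mul hd).mul hs)
  have hN : Continuous fun p : ℝ × UnitTangent => (Real.cosh (p.1 / 2) : ℂ) * p.2.base +
      Complex.I * p.2.dir * (Real.sinh (p.1 / 2) : ℂ) * (starRingEnd ℂ) (p.2.base : ℂ) :=
    (hc.mul hb).add (((continuous_const.mul hd).mul hs).mul (Complex.continuous_conj.comp hb))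
  refine continuous_mk_iff.2 ⟨?_, ?_⟩
  · exact (hN.div hD fun p => flowDenom_ne_zero _ _).upperHalfPlaneMk fun p =>
      flow_im_pos p.1 p.2.base p.2.dir
  · exact (continuous_ofConjDivSelf hD fun p => flowDenom_ne_zero p.1 p.2.dir).mul
      (continuous_dir.comp continuous_snd)

theorem continuous_flow_const (t : ℝ) : Continuous (flow t) :=
  Continuous.comp (g := fun p : ℝ × UnitTangent => flow p.1 p.2) (f := fun v => (t, v))
    continuous_flow (Continuous.prodMk_right t)

theorem flowDenom_add (s t : ℝ) (v : UnitTangent) :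
    flowDenom (s + t) v.dir = flowDenom s (flow t v).dir * flowDenom t v.dir := by
  have hW := flowDenom_ne_zero t v.dir
  have hu : (v.dir : ℂ) * (starRingEnd ℂ) (v.dir : ℂ) = 1 := by
    rw [Complex.mul_conj, Circle.normSq_coe]; simp
  have e : flowDenom s (flow t v).dir * flowDenom t v.dir =
      (Real.cosh (s / 2) : ℂ) * flowDenom t v.dir +
      Complex.I * v.dir * (Real.sinh (s / 2) : ℂ) * (starRingEnd ℂ) (flowDenom t v.dir) := by
    rw [flowDenom, coe_dir_flow]
    field_simp
  rw [e]
  simp only [flowDenom, map_add, map_mul, Complex.conj_ofReal, Complex.conj_I, add_div,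
    Real.cosh_add, Real.sinh_add]
  push_cast
  linear_combination (-(Complex.sinh (s / 2) * Complex.sinh (t / 2))) * hu
    + (Complex.sinh (s / 2) * Complex.sinh (t / 2)) * (v.dir : ℂ) *
      (starRingEnd ℂ) (v.dir : ℂ) * Complex.I_sq

/-- The geodesic flow is a one-parameter group. -/
theorem flow_add (s t : ℝ) (v : UnitTangent) : flow (s + t) v = flow s (flow t v) := by
  have hW := flowDenom_ne_zero t v.dir
  have hWs := flowDenom_ne_zero s (flow t v).dir
  have key := flowDenom_add s t v
  have hu : (v.dir : ℂ) * (starRingEnd ℂ) (v.dir : ℂ) = 1 := by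
    rw [Complex.mul_conj, Circle.normSq_coe]; simp
  have hWc : (starRingEnd ℂ) (flowDenom t v.dir) ≠ 0 := (map_ne_zero _).2 hW
  refine UnitTangent.ext (UpperHalfPlane.ext ?_) (Circle.ext ?_)
  · rw [coe_base_flow, coe_base_flow, key, div_eq_div_iff (mul_ne_zero hWs hW) hWs]
    have h2 : ((Real.cosh (s / 2) : ℂ) * ((flow t v).base : ℂ) + Complex.I * (flow t v).dir *
        (Real.sinh (s / 2) : ℂ) * (starRingEnd ℂ) ((flow t v).base : ℂ)) * flowDenom t v.dir =
        (Real.cosh ((s + t) / 2) : ℂ) * v.base + Complex.I * v.dir *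
        (Real.sinh ((s + t) / 2) : ℂ) * (starRingEnd ℂ) (v.base : ℂ) := by
      have h3 : ((Real.cosh (s / 2) : ℂ) * ((flow t v).base : ℂ) + Complex.I * (flow t v).dir *
        (Real.sinh (s / 2) : ℂ) * (starRingEnd ℂ) ((flow t v).base : ℂ)) * flowDenom t v.dir =
        (Real.cosh (s / 2) : ℂ) * ((Real.cosh (t / 2) : ℂ) * v.base + Complex.I * v.dir *
          (Real.sinh (t / 2) : ℂ) * (starRingEnd ℂ) (v.base : ℂ)) + Complex.I * v.dir *
          (Real.sinh (s / 2) : ℂ) * (starRingEnd ℂ) ((Real.cosh (t / 2) : ℂ) * v.base +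
          Complex.I * v.dir * (Real.sinh (t / 2) : ℂ) * (starRingEnd ℂ) (v.base : ℂ)) := by
        rw [coe_base_flow, coe_dir_flow, map_div₀]
        field_simp
      rw [h3]
      simp only [map_add, map_mul, Complex.conj_ofReal, Complex.conj_I, add_div,
        Real.cosh_add, Real.sinh_add, Complex.conj_conj]
      push_cast
      linear_combination (Complex.sinh (s / 2) * Complex.sinh (t / 2)) * (v.base : ℂ) * hu -
        (Complex.sinh (s / 2) * Complex.sinh (t / 2)) * (v.base : ℂ) * (v.dir : ℂ) *
        (starRingEnd ℂ) (v.dir : ℂ) * Complex.I_sq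
    linear_combination -flowDenom s (flow t v).dir * h2
  · rw [coe_dir_flow, coe_dir_flow, coe_dir_flow, key, map_mul]
    field_simp

theorem flow_zero (v : UnitTangent) : flow 0 v = v := by
  refine UnitTangent.ext (UpperHalfPlane.ext ?_) (Circle.ext ?_)
  · simp [coe_base_flow, flowDenom]
  · simp [coe_dir_flow, flowDenom]

theorem flow_neg_flow (t : ℝ) (v : UnitTangent) : flow (-t) (flow t v) = v := by
  rw [← flow_add, neg_add_cancel, flow_zero]

theorem flow_flow_neg (t : ℝ) (v : UnitTangent) : flow t (flow (-t) v) = v := by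
  rw [← flow_add, add_neg_cancel, flow_zero]

instance : MeasurableSpace Circle := borel Circle

instance : BorelSpace Circle := ⟨rfl⟩

/-- Arc length on the unit circle. -/
def arcLength : Measure Circle :=
  Measure.map Circle.exp (volume.restrict (Set.Ioc 0 (2 * Real.pi)))

theorem arcLength_eq (a : ℝ) :
    arcLength = Measure.map Circle.exp (volume.restrict (Set.Ioc a (a + 2 * Real.pi))) := by
  have : Fact (0 < 2 * Real.pi) := ⟨Real.two_pi_pos⟩
  have h : (Circle.exp : ℝ → Circle) = (AddCircle.toCircle (T := 2 * Real.pi)) ∘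
      (fun x : ℝ => (x : AddCircle (2 * Real.pi))) := by
    ext x
    simp [AddCircle.toCircle_apply_mk]
  have hm : Measurable (AddCircle.toCircle (T := 2 * Real.pi)) :=
    AddCircle.continuous_toCircle.measurable
  have key : ∀ a, Measure.map Circle.exp (volume.restrict (Set.Ioc a (a + 2 * Real.pi))) =
      Measure.map (AddCircle.toCircle (T := 2 * Real.pi)) volume := by
    intro a
    rw [h, ← Measure.map_map hm (AddCircle.measurePreserving_mk (2 * Real.pi) a).measurable,
      (AddCircle.measurePreserving_mk (2 * Real.pi) a).map_eq]
  rw [key, arcLength, ← key 0, zero_add]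

instance : IsFiniteMeasure arcLength := by
  unfold arcLength; infer_instance

theorem arcLength_univ : arcLength Set.univ = ENNReal.ofReal (2 * Real.pi) := by
  rw [arcLength, Measure.map_apply Circle.exp.continuous.measurable MeasurableSet.univ]
  simp

theorem measurePreserving_arcLength_mul (u : Circle) :
    MeasurePreserving (fun w => u * w) arcLength arcLength := by
  refine ⟨(continuous_const_mul u).measurable, ?_⟩
  obtain ⟨a, rfl⟩ : ∃ a, Circle.exp a = u := ⟨_, Circle.exp_arg u⟩
  have h1 : (fun w => Circle.exp a * w) ∘ Circle.exp = Circle.exp ∘ (fun x => a + x) := by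
    ext x; simp [Circle.exp_add]
  rw [arcLength, Measure.map_map (continuous_const_mul _).measurable
    Circle.exp.continuous.measurable, h1,
    ← Measure.map_map Circle.exp.continuous.measurable (measurable_const_add a)]
  have h2 : Measure.map (fun x => a + x) (volume.restrict (Set.Ioc 0 (2 * Real.pi))) =
      volume.restrict (Set.Ioc a (a + 2 * Real.pi)) := by
    have := (measurePreserving_add_left (volume : Measure ℝ) a).restrict_preimage
      (s := Set.Ioc a (a + 2 * Real.pi)) measurableSet_Ioc
    rw [← this.map_eq]
    congr 2
    ext x; simp
  rw [h2, ← arcLength_eq, arcLength]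

theorem liouvilleUpper_eq :
    liouvilleUpper = Measure.map trivialization.symm ((volume : Measure ℍ).prod arcLength) := by
  have h : (volume : Measure ℍ).prod arcLength = Measure.map (Prod.map id Circle.exp)
      ((volume : Measure ℍ).prod (volume.restrict (Set.Ioc 0 (2 * Real.pi)))) := by
    rw [arcLength, ← Measure.map_prod_map _ _ measurable_id Circle.exp.continuous.measurable,
      Measure.map_id]
  rw [h, Measure.map_map trivialization.symm.continuous.measurable
    (measurable_id.prodMap Circle.exp.continuous.measurable)]
  rfl

/-- Disintegration of the Liouville measure over the directions. -/
theorem liouvilleUpper_apply {s : Set UnitTangent} (hs : MeasurableSet s) :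
    liouvilleUpper s = ∫⁻ u : Circle, volume {z : ℍ | (⟨z, u⟩ : UnitTangent) ∈ s} ∂arcLength := by
  rw [liouvilleUpper_eq, Measure.map_apply trivialization.symm.continuous.measurable hs,
    Measure.prod_apply_symm (trivialization.symm.continuous.measurable hs)]
  rfl

instance : SMulInvariantMeasure SL(2, ℝ) ℍ volume := by
  refine ⟨fun c s hs => ?_⟩
  exact measure_preimage_smul_of_nullMeasurableSet (G := GL (Fin 2) ℝ) hs.nullMeasurableSet c

theorem measurePreserving_smul_unitTangent (g : SL(2, ℝ)) :
    MeasurePreserving (fun v : UnitTangent => g • v) liouvilleUpper liouvilleUpper := by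
  have h1 : MeasurePreserving (fun p : ℍ × Circle =>
      (g • p.1, Circle.ofConjDivSelf (factor g p.1) (factor_ne_zero g p.1) * p.2))
      ((volume : Measure ℍ).prod arcLength) ((volume : Measure ℍ).prod arcLength) := by
    refine MeasurePreserving.skew_product (g := fun (z : ℍ) (w : Circle) =>
      Circle.ofConjDivSelf (factor g z) (factor_ne_zero g z) * w)
      (measurePreserving_smul g (volume : Measure ℍ)) ?_ ?_
    · refine Continuous.measurable ?_
      refine Continuous.mul (continuous_ofConjDivSelf ?_ _) continuous_snd
      exact (continuous_const.mul (UpperHalfPlane.continuous_coe.comp continuous_fst)).add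
        continuous_const
    · exact ae_of_all _ fun z => (measurePreserving_arcLength_mul _).map_eq
  have h2 : MeasurePreserving trivialization.symm ((volume : Measure ℍ).prod arcLength)
      liouvilleUpper := ⟨trivialization.symm.continuous.measurable, liouvilleUpper_eq.symm⟩
  have h3 : MeasurePreserving trivialization liouvilleUpper
      ((volume : Measure ℍ).prod arcLength) := by
    refine ⟨trivialization.continuous.measurable, ?_⟩
    rw [liouvilleUpper_eq, Measure.map_map trivialization.continuous.measurable
      trivialization.symm.continuous.measurable]
    simp
  exact (h2.comp h1).comp h3

instance : SMulInvariantMeasure SL(2, ℝ) UnitTangent liouvilleUpper :=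
  ⟨fun g _ hs => (measurePreserving_smul_unitTangent g).measure_preimage hs.nullMeasurableSet⟩

theorem liouvilleUpper_preimage_base {s : Set ℍ} (hs : MeasurableSet s) :
    liouvilleUpper (UnitTangent.base ⁻¹' s) = volume s * ENNReal.ofReal (2 * Real.pi) := by
  rw [liouvilleUpper_apply (continuous_base.measurable hs)]
  simp only [Set.mem_preimage, Set.ofPred_mem_eq, lintegral_const, arcLength_univ]

/-! ### Geodesics through their highest points -/

theorem cosh_eq_half (t : ℝ) : Real.cosh t = Real.cosh (t / 2) ^ 2 + Real.sinh (t / 2) ^ 2 := by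
  rw [← Real.cosh_two_mul, mul_div_cancel₀ _ two_ne_zero]

theorem sinh_eq_half (t : ℝ) : Real.sinh t = 2 * Real.sinh (t / 2) * Real.cosh (t / 2) := by
  rw [← Real.sinh_two_mul, mul_div_cancel₀ _ two_ne_zero]

theorem coe_exp_pi : (Circle.exp Real.pi : ℂ) = ((-1 : ℝ) : ℂ) := by
  simp [Circle.coe_exp]

section Horizontal

variable {e : ℝ} (he : e ^ 2 = 1) {u : Circle} (hu : (u : ℂ) = e) (t : ℝ) (w : ℍ)

include he hu

theorem flowDenom_horizontal_mul :
    (starRingEnd ℂ) (flowDenom t u) * flowDenom t u = (Real.cosh t : ℂ) := by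
  have he' : (e : ℂ) ^ 2 = 1 := by exact_mod_cast he
  rw [cosh_eq_half t, flowDenom, hu]
  simp only [map_add, map_mul, Complex.conj_ofReal, Complex.conj_I]
  push_cast
  linear_combination (-(e : ℂ) ^ 2 * Complex.sinh (t / 2) ^ 2) * Complex.I_sq +
    Complex.sinh (t / 2) ^ 2 * he'

/-- The position of a unit speed geodesic whose highest point `w` is passed at time `0`. -/
theorem base_flow_horizontal :
    ((flow t ⟨w, u⟩).base : ℂ) = ⟨w.re + e * w.im * Real.tanh t, w.im / Real.cosh t⟩ := by
  have h := flowDenom_horizontal_mul he hu t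
  have he' : (e : ℂ) ^ 2 = 1 := by exact_mod_cast he
  have hD := flowDenom_ne_zero t u
  have hc : (Real.cosh t : ℂ) ≠ 0 := by exact_mod_cast (Real.cosh_pos t).ne'
  have h1 : (⟨w.re + e * w.im * Real.tanh t, w.im / Real.cosh t⟩ : ℂ) =
      (w.re * Real.cosh t + e * w.im * Real.sinh t + w.im * Complex.I) / Real.cosh t := by
    rw [Complex.mk_eq_add_mul_I, Real.tanh_eq_sinh_div_cosh]
    push_cast at hc ⊢
    field_simp
  rw [h1, coe_base_flow]
  refine (div_eq_div_iff hD hc).2 ?_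
  have h2 : ((Real.cosh (t / 2) : ℂ) * w + Complex.I * u * (Real.sinh (t / 2) : ℂ) *
      (starRingEnd ℂ) (w : ℂ)) * (starRingEnd ℂ) (flowDenom t u) =
      w.re * Real.cosh t + e * w.im * Real.sinh t + w.im * Complex.I := by
    have hw : (w : ℂ) = w.re + w.im * Complex.I := (Complex.re_add_im (w : ℂ)).symm
    have hcs : (Complex.cosh (t / 2)) ^ 2 = Complex.sinh (t / 2) ^ 2 + 1 := Complex.cosh_sq _
    rw [cosh_eq_half t, sinh_eq_half t, flowDenom, hu, hw]
    simp only [map_add, map_mul, Complex.conj_ofReal, Complex.conj_I]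
    push_cast
    linear_combination (w.im * Complex.I) * hcs + (w.re * Complex.sinh (t / 2) ^ 2
      - w.im * Complex.I * Complex.sinh (t / 2) ^ 2) * he' +
      (-(e : ℂ) ^ 2 * w.re * Complex.sinh (t / 2) ^ 2 + w.im * Complex.I * (e : ℂ) ^ 2 *
       Complex.sinh (t / 2) ^ 2 - 2 * e * w.im * Complex.sinh (t / 2) * Complex.cosh (t / 2)) *
       Complex.I_sq
  linear_combination flowDenom t u * h2 - ((Real.cosh (t / 2) : ℂ) * w + Complex.I * u *
    (Real.sinh (t / 2) : ℂ) * (starRingEnd ℂ) (w : ℂ)) * h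

theorem re_base_flow_horizontal :
    (flow t ⟨w, u⟩).base.re = w.re + e * w.im * Real.tanh t :=
  congrArg Complex.re (base_flow_horizontal he hu t w)

theorem im_base_flow_horizontal : (flow t ⟨w, u⟩).base.im = w.im / Real.cosh t :=
  congrArg Complex.im (base_flow_horizontal he hu t w)

theorem dir_flow_horizontal :
    ((flow t ⟨w, u⟩).dir : ℂ) = ⟨e / Real.cosh t, -(Real.sinh t / Real.cosh t)⟩ := by
  have h := flowDenom_horizontal_mul he hu t
  have he' : (e : ℂ) ^ 2 = 1 := by exact_mod_cast he
  have hD := flowDenom_ne_zero t u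
  have hc : (Real.cosh t : ℂ) ≠ 0 := by exact_mod_cast (Real.cosh_pos t).ne'
  have h1 : (⟨e / Real.cosh t, -(Real.sinh t / Real.cosh t)⟩ : ℂ) =
      (e - Real.sinh t * Complex.I) / Real.cosh t := by
    rw [Complex.mk_eq_add_mul_I]
    push_cast at hc ⊢
    field_simp
    ring
  rw [h1, coe_dir_flow]
  show (starRingEnd ℂ) (flowDenom t u) / flowDenom t u * (u : ℂ) = _
  rw [div_mul_eq_mul_div]
  refine (div_eq_div_iff hD hc).2 ?_
  have h2 : (starRingEnd ℂ) (flowDenom t u) * u * (starRingEnd ℂ) (flowDenom t u) =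
      e - Real.sinh t * Complex.I := by
    have hcs : (Complex.cosh (t / 2)) ^ 2 = Complex.sinh (t / 2) ^ 2 + 1 := Complex.cosh_sq _
    rw [sinh_eq_half t, flowDenom, hu]
    simp only [map_add, map_mul, Complex.conj_ofReal, Complex.conj_I]
    push_cast
    linear_combination (e : ℂ) * hcs - (2 * Complex.I * Complex.sinh (t / 2) *
      Complex.cosh (t / 2)) * he' + e ^ 3 * Complex.sinh (t / 2) ^ 2 * Complex.I_sq
       - e * Complex.sinh (t / 2) ^ 2 * he'
  linear_combination flowDenom t u * h2 - (starRingEnd ℂ) (flowDenom t u) * u * h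

end Horizontal

/-- The affine map `x + i y ↦ x + c y + i d y` of `ℍ` multiplies the hyperbolic area by `d⁻¹`: its
determinant is `d`, and the density `y⁻²` is multiplied by `d⁻²`. -/
theorem volume_preimage_shear (c d : ℝ) (hd : 0 < d) {S : Set ℍ} (hS : MeasurableSet S) :
    volume {w : ℍ | (⟨⟨w.re + c * w.im, w.im * d⟩, mul_pos w.im_pos hd⟩ : ℍ) ∈ S} =
      ENNReal.ofReal d * volume S := by
  set A : ℍ → ℍ := fun w => ⟨⟨w.re + c * w.im, w.im * d⟩, mul_pos w.im_pos hd⟩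
  have hAc : Continuous A := by
    refine Continuous.upperHalfPlaneMk (f := fun w : ℍ => (⟨w.re + c * w.im, w.im * d⟩ : ℂ)) ?_ _
    have h1 : (fun w : ℍ => (⟨w.re + c * w.im, w.im * d⟩ : ℂ)) =
      fun w : ℍ => ((w.re + c * w.im : ℝ) : ℂ) + ((w.im * d : ℝ) : ℂ) * Complex.I := by
      ext w; exact Complex.mk_eq_add_mul_I _ _
    rw [h1]
    have := UpperHalfPlane.continuous_re
    have := UpperHalfPlane.continuous_im
    fun_prop
  let L : ℂ →L[ℝ] ℂ := Complex.reCLM.smulRight (1 : ℂ) +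
    Complex.imCLM.smulRight (⟨c, d⟩ : ℂ)
  have hL : ∀ w : ℂ, L w = ⟨w.re + c * w.im, w.im * d⟩ := by
    intro w
    apply Complex.ext <;> simp [L, mul_comm]
  have hdet : L.det = d := by
    rw [ContinuousLinearMap.det, ← LinearMap.det_toMatrix Complex.basisOneI, Matrix.det_fin_two]
    simp [LinearMap.toMatrix_apply, hL]
  have himg : ((↑) : ℍ → ℂ) '' S = L '' (((↑) : ℍ → ℂ) '' (A ⁻¹' S)) := by
    ext z
    constructor
    · rintro ⟨s, hs, rfl⟩
      refine ⟨_, ⟨⟨⟨s.re - c * (s.im / d), s.im / d⟩, div_pos s.im_pos hd⟩, ?_, rfl⟩, ?_⟩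
      · show A _ ∈ S
        convert hs
        refine UpperHalfPlane.ext (Complex.ext ?_ ?_)
        · show s.re - c * (s.im / d) + c * (s.im / d) = s.re
          ring
        · show s.im / d * d = s.im
          field_simp
      · rw [hL]
        refine Complex.ext ?_ ?_
        · show s.re - c * (s.im / d) + c * (s.im / d) = s.re
          ring
        · show s.im / d * d = s.im
          field_simp
    · rintro ⟨_, ⟨w, hw, rfl⟩, rfl⟩
      exact ⟨A w, hw, (hL w).symm⟩
  have hinj : InjOn L (((↑) : ℍ → ℂ) '' (A ⁻¹' S)) := by
    intro z _ w _ h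
    rw [hL, hL, Complex.mk.injEq] at h
    have h2 : z.im = w.im := mul_right_cancel₀ hd.ne' h.2
    refine Complex.ext ?_ h2
    have := h.1
    rw [h2] at this
    exact add_right_cancel this
  have main := lintegral_image_eq_lintegral_abs_det_fderiv_mul (volume : Measure ℂ)
    (measurableEmbedding_coe.measurableSet_image.2 (hAc.measurable hS))
    (fun x _ => L.hasFDerivWithinAt) hinj (fun z : ℂ => (((1 / ‖z.im‖₊) ^ 2 : NNReal) : ℝ≥0∞))
  rw [← himg, ← volume_eq_lintegral, hdet] at main
  have h3 : ∀ z : ℂ, ENNReal.ofReal |d| * (((1 / ‖(L z).im‖₊) ^ 2 : NNReal) : ℝ≥0∞) =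
      ENNReal.ofReal d⁻¹ * (((1 / ‖z.im‖₊) ^ 2 : NNReal) : ℝ≥0∞) := by
    intro z
    rw [hL]
    simp only [ENNReal.ofReal]
    rw [← ENNReal.coe_mul, ← ENNReal.coe_mul]
    congr 1
    apply NNReal.eq
    simp only [NNReal.coe_mul, NNReal.coe_pow, NNReal.coe_div, NNReal.coe_one, coe_nnnorm,
      norm_mul, Real.norm_eq_abs, Real.coe_toNNReal', abs_of_pos hd, max_eq_left hd.le,
      max_eq_left (inv_pos.2 hd).le]
    field_simp
  simp_rw [h3] at main
  rw [lintegral_const_mul' _ _ ENNReal.ofReal_ne_top, ← volume_eq_lintegral] at main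
  rw [main, ← mul_assoc, ← ENNReal.ofReal_mul hd.le, mul_inv_cancel₀ hd.ne', ENNReal.ofReal_one,
    one_mul]
  rfl

theorem hasDerivAt_arctan_sinh (t : ℝ) :
    HasDerivAt (fun t => Real.arctan (Real.sinh t)) (Real.cosh t)⁻¹ t := by
  have h := (Real.hasDerivAt_sinh t).arctan
  convert h using 1
  rw [add_comm, ← Real.cosh_sq]
  have := (Real.cosh_pos t).ne'
  field_simp

theorem range_arctan_sinh :
    range (fun t => Real.arctan (Real.sinh t)) = Ioo (-(Real.pi / 2)) (Real.pi / 2) := by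
  rw [← Real.range_arctan]
  exact Real.sinh_surjective.range_comp Real.arctan

/-- The substitution `φ = a ± arctan (sinh t)`, which relates the direction of a geodesic to the time
since it passed its highest point. -/
theorem lintegral_arctan_sinh (b : ℝ) (hb : b ^ 2 = 1) (a : ℝ) (F : ℝ → ℝ≥0∞) :
    ∫⁻ φ in Ioo (a - Real.pi / 2) (a + Real.pi / 2), F φ =
      ∫⁻ t, ENNReal.ofReal (Real.cosh t)⁻¹ * F (a + b * Real.arctan (Real.sinh t)) := by
  have hb0 : b ≠ 0 := by rintro rfl; norm_num at hb
  have habs : |b| = 1 := by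
    rw [← sq_eq_sq₀ (abs_nonneg b) zero_le_one, sq_abs, hb, one_pow]
  have hd : ∀ t ∈ (univ : Set ℝ), HasDerivWithinAt
      (fun t => a + b * Real.arctan (Real.sinh t)) (b * (Real.cosh t)⁻¹) univ t := fun t _ =>
    (((hasDerivAt_arctan_sinh t).const_mul b).const_add a).hasDerivWithinAt
  have hinj : InjOn (fun t => a + b * Real.arctan (Real.sinh t)) univ := by
    intro s _ t _ h
    exact Real.sinh_injective (Real.arctan_injective (mul_left_cancel₀ hb0 (add_left_cancel h)))
  have := lintegral_image_eq_lintegral_abs_deriv_mul MeasurableSet.univ hd hinj F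
  have himg : (fun t => a + b * Real.arctan (Real.sinh t)) '' univ =
      Ioo (a - Real.pi / 2) (a + Real.pi / 2) := by
    have h1 : (fun t => a + b * Real.arctan (Real.sinh t)) '' univ =
      (fun x => a + b * x) '' (Ioo (-(Real.pi / 2)) (Real.pi / 2)) := by
      rw [← range_arctan_sinh, image_univ, ← range_comp]; rfl
    rw [h1]
    rcases mul_self_eq_one_iff.1 ((sq b).symm.trans hb) with rfl | rfl
    · simp [sub_eq_add_neg, add_comm]
    · ext x
      constructor
      · rintro ⟨y, ⟨h1, h2⟩, rfl⟩
        constructor <;> dsimp only <;> linarith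
      · rintro ⟨h1, h2⟩
        exact ⟨a - x, ⟨by linarith, by linarith⟩, by ring⟩
  rw [himg, setLIntegral_univ] at this
  rw [this]
  congr 1
  ext t
  rw [abs_mul, habs, one_mul, abs_of_pos (inv_pos.2 (Real.cosh_pos t))]

theorem sqrt_one_add_sinh_sq (t : ℝ) : √(1 + Real.sinh t ^ 2) = Real.cosh t := by
  rw [add_comm, ← Real.cosh_sq, Real.sqrt_sq (Real.cosh_pos t).le]

theorem dir_flow_right (t : ℝ) (w : ℍ) :
    (flow t ⟨w, 1⟩).dir = Circle.exp (0 + -1 * Real.arctan (Real.sinh t)) := by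
  refine Circle.ext ?_
  rw [dir_flow_horizontal (e := 1) (by norm_num) (by simp), Circle.coe_exp, Complex.exp_mul_I,
    ← Complex.ofReal_cos, ← Complex.ofReal_sin, ← Complex.mk_eq_add_mul_I]
  congr 1
  · rw [zero_add, neg_one_mul, Real.cos_neg, Real.cos_arctan, sqrt_one_add_sinh_sq]
  · rw [zero_add, neg_one_mul, Real.sin_neg, Real.sin_arctan, sqrt_one_add_sinh_sq]

theorem dir_flow_left (t : ℝ) (w : ℍ) :
    (flow t ⟨w, Circle.exp Real.pi⟩).dir =
      Circle.exp (Real.pi + 1 * Real.arctan (Real.sinh t)) := by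
  refine Circle.ext ?_
  rw [dir_flow_horizontal (e := -1) (by norm_num) coe_exp_pi, Circle.coe_exp, Complex.exp_mul_I,
    ← Complex.ofReal_cos, ← Complex.ofReal_sin, ← Complex.mk_eq_add_mul_I]
  congr 1
  · rw [one_mul, add_comm, Real.cos_add_pi, Real.cos_arctan, sqrt_one_add_sinh_sq, neg_div]
  · rw [one_mul, add_comm, Real.sin_add_pi, Real.sin_arctan, sqrt_one_add_sinh_sq]

/-- Flowing for a time `t` from the horizontal vectors leads to vectors of a constant direction `v`, and
the map of foot points divides the area by `(cosh t)⁻¹`. -/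
theorem volume_flow_horizontal {e : ℝ} (he : e ^ 2 = 1) {u : Circle} (hu : (u : ℂ) = e) (t : ℝ)
    (v : Circle) (hv : ∀ w, (flow t ⟨w, u⟩).dir = v) {s : Set UnitTangent}
    (hs : MeasurableSet s) :
    volume {w : ℍ | flow t ⟨w, u⟩ ∈ s} =
      ENNReal.ofReal (Real.cosh t)⁻¹ * volume {z : ℍ | (⟨z, v⟩ : UnitTangent) ∈ s} := by
  have hS : MeasurableSet {z : ℍ | (⟨z, v⟩ : UnitTangent) ∈ s} :=
    (continuous_mk_iff.2 ⟨continuous_id, continuous_const⟩ :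
      Continuous fun z : ℍ => (⟨z, v⟩ : UnitTangent)).measurable hs
  rw [← volume_preimage_shear (e * Real.tanh t) _ (inv_pos.2 (Real.cosh_pos t)) hS]
  congr 1
  ext w
  have : flow t ⟨w, u⟩ = ⟨⟨⟨w.re + e * Real.tanh t * w.im, w.im * (Real.cosh t)⁻¹⟩,
      mul_pos w.im_pos (inv_pos.2 (Real.cosh_pos t))⟩, v⟩ := by
    refine UnitTangent.ext (UpperHalfPlane.ext ?_) (hv w)
    rw [base_flow_horizontal he hu, mul_right_comm, div_eq_mul_inv]
  show flow t ⟨w, u⟩ ∈ s ↔ _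
  rw [this]
  rfl

/-- The Liouville measure in geodesic coordinates: almost every unit vector is reached by flowing
for a time `t` from a horizontal vector at the highest point `w` of its geodesic, and in the
coordinates `(w, t)` the Liouville measure is the product of the area and of `dt`. -/
theorem liouvilleUpper_eq_lintegral_flow {s : Set UnitTangent} (hs : MeasurableSet s) :
    liouvilleUpper s = (∫⁻ t, volume {w : ℍ | flow t ⟨w, 1⟩ ∈ s}) +
      ∫⁻ t, volume {w : ℍ | flow t ⟨w, Circle.exp Real.pi⟩ ∈ s} := by
  have hm : Measurable fun u : Circle => volume {z : ℍ | (⟨z, u⟩ : UnitTangent) ∈ s} :=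
    measurable_measure_prodMk_right (trivialization.symm.continuous.measurable hs)
  have hpi := Real.pi_pos
  -- the directions to the right of the vertical, then those to the left of it
  rw [liouvilleUpper_apply hs, arcLength_eq (-(Real.pi / 2)),
    lintegral_map hm Circle.exp.continuous.measurable,
    show -(Real.pi / 2) + 2 * Real.pi = Real.pi + Real.pi / 2 by ring,
    ← Ioc_union_Ioc_eq_Ioc (b := Real.pi / 2) (by linarith) (by linarith),
    lintegral_union measurableSet_Ioc (Set.disjoint_left.2 fun x h1 h2 => h1.2.not_gt h2.1),
    ← setLIntegral_congr Ioo_ae_eq_Ioc, ← setLIntegral_congr Ioo_ae_eq_Ioc,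
    show Real.pi / 2 = 0 + Real.pi / 2 by ring]
  congr 1
  · rw [show -(0 + Real.pi / 2) = 0 - Real.pi / 2 by ring, lintegral_arctan_sinh (-1) (by norm_num)]
    congr 1
    ext t
    rw [volume_flow_horizontal (e := 1) (by norm_num) (by simp) t _ (dir_flow_right t) hs]
  · rw [show 0 + Real.pi / 2 = Real.pi - Real.pi / 2 by ring,
      show Real.pi + (Real.pi - Real.pi / 2) = Real.pi + Real.pi / 2 by ring,
      lintegral_arctan_sinh 1 (by norm_num)]
    congr 1
    ext t
    rw [volume_flow_horizontal (e := -1) (by norm_num) coe_exp_pi t _ (dir_flow_left t) hs]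

/-- Liouville's theorem for the geodesic flow. -/
theorem measurePreserving_flow (τ : ℝ) :
    MeasurePreserving (flow τ) liouvilleUpper liouvilleUpper := by
  refine ⟨(continuous_flow_const τ).measurable, Measure.ext fun s hs => ?_⟩
  have h := (continuous_flow_const τ).measurable hs
  rw [Measure.map_apply (continuous_flow_const τ).measurable hs,
    liouvilleUpper_eq_lintegral_flow h, liouvilleUpper_eq_lintegral_flow hs]
  simp only [Set.mem_preimage, ← flow_add]
  rw [lintegral_add_left_eq_self (fun t => volume {w : ℍ | flow t ⟨w, 1⟩ ∈ s}),
    lintegral_add_left_eq_self (fun t => volume {w : ℍ | flow t ⟨w, Circle.exp Real.pi⟩ ∈ s})]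

/-! ### Measures on orbit spaces -/

section Comparison

variable {Γ X : Type*} [Group Γ] [Countable Γ] [MulAction Γ X] [MeasurableSpace X]
  [MeasurableConstSMul Γ X] {m : Measure X} [SMulInvariantMeasure Γ X m]

/-- A set which contains at most one point of each orbit can be cut into countably many pieces and
moved injectively, by group elements, into any set that meets almost all of the same orbits. -/
theorem measure_le_of_orbit_injective {F D : Set X} (hF : MeasurableSet F) (hD : MeasurableSet D)
    (hinj : ∀ x ∈ F, ∀ g : Γ, g • x ∈ F → g • x = x)
    (hcov : ∀ᵐ x ∂m, x ∈ F → ∃ g : Γ, g • x ∈ D) : m F ≤ m D := by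
  obtain ⟨g, hg⟩ := exists_surjective_nat Γ
  set P : ℕ → Set X := fun n => F ∩ (g n • ·) ⁻¹' D
  have hPm : ∀ n, MeasurableSet (P n) := fun n => hF.inter (measurable_const_smul (g n) hD)
  have hdm : ∀ n, MeasurableSet (disjointed P n) := fun n => MeasurableSet.disjointed hPm n
  have hsub : ∀ n, disjointed P n ⊆ P n := fun n => disjointed_subset P n
  set Q : ℕ → Set X := fun n => ((g n)⁻¹ • ·) ⁻¹' disjointed P n
  have hQm : ∀ n, MeasurableSet (Q n) := fun n => measurable_const_smul (g n)⁻¹ (hdm n)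
  have hQD : ∀ n, Q n ⊆ D := by
    intro n y hy
    have := (hsub n hy).2
    simpa using this
  have hdisj : Pairwise (Function.onFun Disjoint Q) := by
    intro i j hij
    refine Set.disjoint_left.2 fun y hi hj => ?_
    have h1 : (g i)⁻¹ • y ∈ disjointed P i := hi
    have h2 : (g j)⁻¹ • y ∈ disjointed P j := hj
    have h3 := hinj _ (hsub i h1).1 ((g j)⁻¹ * g i) (by
      rw [mul_smul, smul_inv_smul]; exact (hsub j h2).1)
    rw [mul_smul, smul_inv_smul] at h3
    rw [h3] at h2
    exact Set.disjoint_left.1 (disjoint_disjointed P hij) h1 h2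
  calc m F ≤ m (⋃ n, P n) := by
        refine measure_mono_ae ?_
        filter_upwards [hcov] with x hx hxF
        obtain ⟨h, hh⟩ := hx hxF
        obtain ⟨n, rfl⟩ := hg h
        exact mem_iUnion.2 ⟨n, hxF, hh⟩
    _ = ∑' n, m (disjointed P n) := by
        rw [← iUnion_disjointed, measure_iUnion (disjoint_disjointed P) hdm]
    _ = ∑' n, m (Q n) := by
        congr 1
        ext n
        exact (measure_preimage_smul_of_nullMeasurableSet (hdm n).nullMeasurableSet (g n)⁻¹).symm
    _ = m (⋃ n, Q n) := (measure_iUnion hdisj hQm).symm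
    _ ≤ m D := measure_mono (iUnion_subset hQD)

end Comparison

section Quotient

variable (G : Subgroup SL(2, ℝ)) {X : Type*} [MeasurableSpace X] [MulAction G X]

/-- The projection to the orbit space. -/
abbrev orbitMk (x : X) : MulAction.orbitRel.Quotient G X := ⟦x⟧

variable {G}

omit [MeasurableSpace X] in
theorem orbitMk_eq_iff {x y : X} : orbitMk G x = orbitMk G y ↔ ∃ g : G, g • y = x := by
  rw [Quotient.eq, MulAction.orbitRel_apply]
  rfl

omit [MeasurableSpace X] in
theorem orbitMk_smul (g : G) (x : X) : orbitMk G (g • x) = orbitMk G x :=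
  orbitMk_eq_iff.2 ⟨g, rfl⟩

theorem measurable_orbitMk : Measurable (orbitMk G : X → _) :=
  measurable_quotient_mk''

omit [MeasurableSpace X] in
theorem injOn_orbitMk_iff {F : Set X} :
    InjOn (orbitMk G) F ↔ ∀ x ∈ F, ∀ g : G, g • x ∈ F → g • x = x := by
  constructor
  · intro h x hx g hgx
    exact h hgx hx (orbitMk_smul g x)
  · intro h x hx y hy hxy
    obtain ⟨g, rfl⟩ := orbitMk_eq_iff.1 hxy
    exact h y hy g hx

variable {m : Measure X}

theorem map_restrict_le_quotientMeasure {F : Set X} (hF : MeasurableSet F)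
    (hinj : InjOn (orbitMk G) F) :
    Measure.map (orbitMk G) (m.restrict F) ≤ quotientMeasure G X m :=
  le_iSup (fun F : {F : Set X // MeasurableSet F ∧ Set.InjOn (orbitMk G) F} =>
    Measure.map (orbitMk G) (m.restrict F.1)) ⟨F, hF, hinj⟩

theorem measure_inter_le_quotientMeasure {F : Set X} (hF : MeasurableSet F)
    (hinj : InjOn (orbitMk G) F) (W : Set (MulAction.orbitRel.Quotient G X)) :
    m (orbitMk G ⁻¹' W ∩ F) ≤ quotientMeasure G X m W := by
  calc m (orbitMk G ⁻¹' W ∩ F) ≤ m.restrict F (orbitMk G ⁻¹' W) := Measure.le_restrict_apply _ _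
    _ ≤ Measure.map (orbitMk G) (m.restrict F) W :=
        Measure.le_map_apply measurable_orbitMk.aemeasurable W
    _ ≤ _ := map_restrict_le_quotientMeasure hF hinj W

variable [Countable G] [MeasurableConstSMul G X] [SMulInvariantMeasure G X m]

/-- The induced measure on the orbit space can be computed on a measurable fundamental set. -/
theorem quotientMeasure_eq_map {D : Set X} (hD : MeasurableSet D) (hinj : InjOn (orbitMk G) D)
    (hcov : ∀ᵐ x ∂m, ∃ g : G, g • x ∈ D) :
    quotientMeasure G X m = Measure.map (orbitMk G) (m.restrict D) := by
  refine le_antisymm (iSup_le ?_) (map_restrict_le_quotientMeasure hD hinj)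
  rintro ⟨F, hF, hFi⟩
  refine Measure.le_iff.2 fun W hW => ?_
  have hA := measurable_orbitMk (G := G) (X := X) hW
  show Measure.map (orbitMk G) (m.restrict F) W ≤ _
  rw [Measure.map_apply measurable_orbitMk hW, Measure.map_apply measurable_orbitMk hW,
    Measure.restrict_apply hA, Measure.restrict_apply hA]
  refine measure_le_of_orbit_injective (Γ := G) (hA.inter hF) (hA.inter hD) ?_ ?_
  · intro x hx g hg
    exact injOn_orbitMk_iff.1 hFi x hx.2 g hg.2
  · filter_upwards [hcov] with x hx hxA
    obtain ⟨g, hg⟩ := hx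
    refine ⟨g, ?_, hg⟩
    show orbitMk G (g • x) ∈ W
    rw [orbitMk_smul]
    exact hxA.1

theorem measurableSet_image_orbitMk {K : Set X} (hK : MeasurableSet K) :
    MeasurableSet (orbitMk G '' K) := by
  show MeasurableSet (orbitMk G ⁻¹' (orbitMk G '' K))
  have : orbitMk G ⁻¹' (orbitMk G '' K) = ⋃ g : G, (g • ·) ⁻¹' K := by
    ext x
    simp only [mem_preimage, mem_image, mem_iUnion]
    constructor
    · rintro ⟨y, hy, hxy⟩
      obtain ⟨g, rfl⟩ := orbitMk_eq_iff.1 hxy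
      exact ⟨g, hy⟩
    · rintro ⟨g, hg⟩
      exact ⟨_, hg, orbitMk_smul g x⟩
  rw [this]
  exact MeasurableSet.iUnion fun g => measurable_const_smul g hK

theorem quotientMeasure_image_le {D : Set X} (hD : MeasurableSet D) (hinj : InjOn (orbitMk G) D)
    (hcov : ∀ᵐ x ∂m, ∃ g : G, g • x ∈ D) {K : Set X} (hK : MeasurableSet K) :
    quotientMeasure G X m (orbitMk G '' K) ≤ m K := by
  have hW := measurableSet_image_orbitMk (G := G) hK
  have hA := measurable_orbitMk (G := G) (X := X) hW
  rw [quotientMeasure_eq_map hD hinj hcov, Measure.map_apply measurable_orbitMk hW,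
    Measure.restrict_apply hA]
  refine measure_le_of_orbit_injective (Γ := G) (hA.inter hD) hK ?_ ?_
  · intro x hx g hg
    exact injOn_orbitMk_iff.1 hinj x hx.2 g hg.2
  · refine ae_of_all _ fun x hx => ?_
    obtain ⟨y, hy, hxy⟩ := hx.1
    obtain ⟨g, rfl⟩ := orbitMk_eq_iff.1 hxy
    exact ⟨g, hy⟩

/-- A property of almost all orbits holds at almost every point. -/
theorem ae_of_ae_quotientMeasure {D : Set X} (hD : MeasurableSet D)
    (hinj : InjOn (orbitMk G) D) (hcov : ∀ᵐ x ∂m, ∃ g : G, g • x ∈ D)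
    {P : MulAction.orbitRel.Quotient G X → Prop} (h : ∀ᵐ q ∂(quotientMeasure G X m), P q) :
    ∀ᵐ x ∂m, P (orbitMk G x) := by
  rw [quotientMeasure_eq_map hD hinj hcov] at h
  have h1 := ae_of_ae_map measurable_orbitMk.aemeasurable h
  rw [ae_restrict_iff' hD] at h1
  have h2 : ∀ᵐ x ∂m, ∀ g : G, g • x ∈ D → P (orbitMk G (g • x)) := by
    refine ae_all_iff.2 fun g => ?_
    exact (measurePreserving_smul g m).quasiMeasurePreserving.ae h1
  filter_upwards [h2, hcov] with x hx ⟨g, hg⟩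
  have := hx g hg
  rwa [orbitMk_smul] at this

end Quotient

/-! ### A fundamental set for a discrete group -/

theorem smul_eq_self_iff {h : SL(2, ℝ)} {z : ℍ} :
    h • z = z ↔ 2 * h 1 0 * z.re = h 0 0 - h 1 1 ∧
      h 1 0 * (z.re ^ 2 + z.im ^ 2) = - h 0 1 := by
  have hz := z.im_ne_zero
  rw [UpperHalfPlane.ext_iff, coe_smul_eq, div_eq_iff (factor_ne_zero h z), factor,
    Complex.ext_iff]
  simp only [Complex.add_re, Complex.add_im, Complex.mul_re, Complex.mul_im, Complex.ofReal_re,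
    Complex.ofReal_im, coe_re, coe_im]
  constructor
  · rintro ⟨h1, h2⟩
    have h3 : 2 * h 1 0 * z.re = h 0 0 - h 1 1 := by
      refine mul_right_cancel₀ hz ?_
      linear_combination -h2
    refine ⟨h3, ?_⟩
    linear_combination h1 + z.re * h3
  · rintro ⟨h1, h2⟩
    constructor
    · linear_combination h2 - z.re * h1
    · linear_combination -z.im * h1

/-- A Möbius transformation other than the identity fixes at most one point of `ℍ`. -/
theorem smul_eq_self_of_two_fixed {h : SL(2, ℝ)} {z w : ℍ} (hz : h • z = z) (hw : h • w = w)
    (hzw : z ≠ w) (v : ℍ) : h • v = v := by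
  rw [smul_eq_self_iff] at hz hw ⊢
  have hc : h 1 0 = 0 := by
    by_contra hc
    apply hzw
    have hre : z.re = w.re := mul_left_cancel₀ (mul_ne_zero two_ne_zero hc) (hz.1.trans hw.1.symm)
    have h2 := mul_left_cancel₀ hc (hz.2.trans hw.2.symm)
    rw [hre] at h2
    have him : z.im = w.im := by
      have h3 : z.im ^ 2 = w.im ^ 2 := by linarith
      exact (sq_eq_sq₀ z.im_pos.le w.im_pos.le).1 h3
    exact UpperHalfPlane.ext (Complex.ext hre him)
  rw [hc] at hz ⊢
  constructor <;> linarith [hz.1, hz.2]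

/-- Hyperbolic area and Lebesgue measure have the same null sets. -/
theorem ae_upperHalfPlane_iff {P : ℍ → Prop} :
    (∀ᵐ w : ℍ, P w) ↔ ∀ᵐ z : ℂ, ∀ h : 0 < z.im, P ⟨z, h⟩ := by
  have hm : Measurable fun z : ℍ =>
      (((1 / NNReal.mk z.im z.im_pos.le : NNReal) ^ 2 : NNReal) : ℝ≥0∞) := by
    refine measurable_coe_nnreal_ennreal.comp ((measurable_const.div ?_).pow_const 2)
    exact (UpperHalfPlane.continuous_im.subtype_mk _).measurable
  have h1 : (volume : Measure ℍ) {w | ¬ P w} = 0 ↔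
      (volume : Measure ℂ).comap UpperHalfPlane.coe {w | ¬ P w} = 0 := by
    rw [volume_def]
    refine ⟨fun h => withDensity_absolutelyContinuous' hm.aemeasurable ?_ h,
      fun h => withDensity_absolutelyContinuous _ _ h⟩
    refine ae_of_all _ fun z => ENNReal.coe_ne_zero.2 (pow_ne_zero 2 (div_ne_zero one_ne_zero ?_))
    exact fun h => z.im_ne_zero (congrArg NNReal.toReal h)
  rw [ae_iff, ae_iff, h1, measurableEmbedding_coe.comap_apply]
  have : UpperHalfPlane.coe '' {w | ¬ P w} = {z : ℂ | ¬ ∀ h : 0 < z.im, P ⟨z, h⟩} := by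
    ext z
    constructor
    · rintro ⟨w, hw, rfl⟩ h
      exact hw (h w.im_pos)
    · intro h
      obtain ⟨h1, h2⟩ := not_forall.1 h
      exact ⟨⟨z, h1⟩, h2, rfl⟩
  rw [this]

theorem ae_ne_upperHalfPlane (z : ℍ) : ∀ᵐ w : ℍ, w ≠ z := by
  refine ae_upperHalfPlane_iff.2 ?_
  filter_upwards [Measure.ae_ne volume (z : ℂ)] with w hw h hwz
  exact hw (congrArg UpperHalfPlane.coe hwz)

section Fundamental

variable (G : Subgroup SL(2, ℝ))

theorem ae_no_fixed_point [Countable G] :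
    ∀ᵐ z : ℍ, ∀ g : G, g • z = z → ∀ w : ℍ, g • w = w := by
  refine ae_all_iff.2 fun g => ?_
  by_cases hg : ∃ z : ℍ, g • z = z ∧ ¬ ∀ w : ℍ, g • w = w
  · obtain ⟨z, hz, hw⟩ := hg
    filter_upwards [ae_ne_upperHalfPlane z] with w hwz hgw
    exact absurd (smul_eq_self_of_two_fixed (h := (g : SL(2, ℝ))) hz hgw (Ne.symm hwz)) hw
  · push Not at hg
    exact ae_of_all _ fun z hz => hg z hz

instance countable_of_discrete [DiscreteTopology G] : Countable G := by
  have : SecondCountableTopology (Matrix (Fin 2) (Fin 2) ℝ) :=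
    inferInstanceAs (SecondCountableTopology (Fin 2 → Fin 2 → ℝ))
  have : SecondCountableTopology SL(2, ℝ) :=
    Matrix.SpecialLinearGroup.isClosedEmbedding_val.isInducing.secondCountableTopology
  exact countable_of_Lindelof_of_discrete

/-- A consequence of proper discontinuity. -/
theorem exists_nhd_of_no_fixed_point [DiscreteTopology G] {z : ℍ}
    (hz : ∀ g : G, g • z = z → ∀ w : ℍ, g • w = w) :
    ∃ U : Set ℍ, IsOpen U ∧ z ∈ U ∧ ∀ g : G, ∀ w ∈ U, g • w ∈ U → ∀ w : ℍ, g • w = w := by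
  obtain ⟨K, hK, hKz⟩ := exists_compact_mem_nhds z
  have hfin : Set.Finite {g : G | ((g • ·) '' K ∩ K).Nonempty} :=
    ProperlyDiscontinuousSMul.finite_disjoint_inter_image hK hK
  have h1 : ∀ g : G, ∃ V ∈ 𝓝 z, (∃ w ∈ V, g • w ∈ V) → ∀ w : ℍ, g • w = w := by
    intro g
    by_cases hg : g • z = z
    · exact ⟨univ, univ_mem, fun _ => hz g hg⟩
    · obtain ⟨A, B, hA, hB, hzA, hzB, hAB⟩ := t2_separation hg
      refine ⟨(g • ·) ⁻¹' A ∩ B, inter_mem ?_ (hB.mem_nhds hzB), ?_⟩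
      · exact (continuous_const_smul (g : SL(2, ℝ))).continuousAt.preimage_mem_nhds
          (hA.mem_nhds hzA)
      · rintro ⟨w, hw, hw2⟩
        exact absurd hw2.2 (Set.disjoint_left.1 hAB hw.1)
  choose V hV hV2 using h1
  obtain ⟨U, hU, hUo, hzU⟩ := mem_nhds_iff.1
    (inter_mem hKz ((biInter_mem hfin).2 fun g _ => hV g))
  refine ⟨U, hUo, hzU, fun g w hw hgw => ?_⟩
  have hg : g ∈ {g : G | ((g • ·) '' K ∩ K).Nonempty} :=
    ⟨g • w, ⟨w, (hU hw).1, rfl⟩, (hU hgw).1⟩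
  exact hV2 g ⟨w, mem_iInter₂.1 (hU hw).2 g hg, mem_iInter₂.1 (hU hgw).2 g hg⟩

/-- A discrete group has a measurable set which meets almost every orbit in `ℍ` and whose points
are inequivalent, except under elements acting trivially. -/
theorem exists_fundamental_set [DiscreteTopology G] :
    ∃ F : Set ℍ, MeasurableSet F ∧
      (∀ x ∈ F, ∀ g : G, g • x ∈ F → ∀ w : ℍ, g • w = w) ∧
      ∀ᵐ x : ℍ, ∃ g : G, g • x ∈ F := by
  set N : Set ℍ := {z | ∀ g : G, g • z = z → ∀ w : ℍ, g • w = w}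
  choose! U hUo hU hUinj using fun z (hz : z ∈ N) => exists_nhd_of_no_fixed_point G hz
  obtain ⟨t, htN, htc, htU⟩ := TopologicalSpace.countable_cover_nhdsWithin
    (s := N) (f := U) fun z hz => mem_nhdsWithin_of_mem_nhds ((hUo z hz).mem_nhds (hU z hz))
  rcases t.eq_empty_or_nonempty with rfl | htne
  · refine ⟨∅, MeasurableSet.empty, fun x hx => hx.elim, ?_⟩
    filter_upwards [ae_no_fixed_point G] with x hx
    simpa using htU hx
  obtain ⟨c, rfl⟩ := htc.exists_eq_range htne
  have hcN : ∀ n, c n ∈ N := fun n => htN (mem_range_self n)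
  -- the orbit of a point is represented in the first `U (c n)` which it meets
  set S : ℕ → Set ℍ := fun n => ⋃ g : G, (g • ·) ⁻¹' U (c n) with hS
  have hSo : ∀ n, IsOpen (S n) := fun n => isOpen_iUnion fun g =>
    (hUo _ (hcN n)).preimage (continuous_const_smul (g : SL(2, ℝ)))
  have hSinv : ∀ n (g : G) x, g • x ∈ S n ↔ x ∈ S n := by
    intro n g x
    simp only [hS, mem_iUnion, mem_preimage]
    constructor
    · rintro ⟨h, hh⟩
      exact ⟨h * g, by rwa [mul_smul]⟩
    · rintro ⟨h, hh⟩
      exact ⟨h * g⁻¹, by rwa [mul_smul, inv_smul_smul]⟩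
  refine ⟨⋃ n, U (c n) \ ⋃ k, ⋃ (_ : k < n), S k, ?_, ?_, ?_⟩
  · exact MeasurableSet.iUnion fun n => (hUo _ (hcN n)).measurableSet.diff
      (MeasurableSet.iUnion fun k => MeasurableSet.iUnion fun _ => (hSo k).measurableSet)
  · intro x hx g hgx
    obtain ⟨i, hi, hi2⟩ := mem_iUnion.1 hx
    obtain ⟨j, hj, hj2⟩ := mem_iUnion.1 hgx
    simp only [mem_iUnion, not_exists] at hi2 hj2
    have hxi : x ∈ S i := mem_iUnion.2 ⟨1, by simpa using hi⟩
    have hxj : g • x ∈ S j := mem_iUnion.2 ⟨1, by simpa using hj⟩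
    rcases lt_trichotomy i j with h | rfl | h
    · exact absurd ((hSinv i g x).2 hxi) (hj2 i h)
    · exact hUinj _ (hcN i) g x hi hj
    · exact absurd ((hSinv j g x).1 hxj) (hi2 j h)
  · filter_upwards [ae_no_fixed_point G] with x hx
    have hex : ∃ n, x ∈ S n := by
      obtain ⟨_, ⟨n, rfl⟩, hn⟩ := mem_iUnion₂.1 (htU hx)
      exact ⟨n, mem_iUnion.2 ⟨1, by simpa using hn⟩⟩
    classical
    obtain ⟨g, hg⟩ := mem_iUnion.1 (Nat.find_spec hex)
    refine ⟨g, mem_iUnion.2 ⟨Nat.find hex, hg, ?_⟩⟩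
    simp only [mem_iUnion, not_exists]
    intro k hk hgk
    exact Nat.find_min hex hk ((hSinv k g x).1 hgk)

end Fundamental

/-! ### The quotient of the unit tangent bundle has finite measure -/

/-- An affine transformation `z ↦ (a z + b) / d` preserves the directions of tangent vectors. -/
theorem dir_smul_of_upper_triangular {h : SL(2, ℝ)} (hc : h 1 0 = 0) (v : UnitTangent) :
    (h • v).dir = v.dir := by
  refine Circle.ext ?_
  have h0 := factor_ne_zero h v.base
  have hf : factor h v.base = (h 1 1 : ℂ) := by simp [factor, hc]
  rw [coe_dir_smul]
  rw [hf] at h0 ⊢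
  rw [Complex.conj_ofReal, div_self h0, one_mul]

theorem smul_unitTangent_eq_self {h : SL(2, ℝ)} (hh : ∀ w : ℍ, h • w = w) (v : UnitTangent) :
    h • v = v := by
  refine UnitTangent.ext (hh _) (dir_smul_of_upper_triangular ?_ v)
  have h1 := (smul_eq_self_iff.1 (hh UpperHalfPlane.I)).2
  have h2 := (smul_eq_self_iff.1 (hh ⟨2 * Complex.I, by simp⟩)).2
  have e1 : UpperHalfPlane.I.re ^ 2 + UpperHalfPlane.I.im ^ 2 = 1 := by simp
  have e2 : (⟨2 * Complex.I, by simp⟩ : ℍ).re ^ 2 + (⟨2 * Complex.I, by simp⟩ : ℍ).im ^ 2 = 4 := by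
    show (2 * Complex.I).re ^ 2 + (2 * Complex.I).im ^ 2 = 4
    simp; norm_num
  rw [e1] at h1
  rw [e2] at h2
  linarith

section Finite

variable (G : Subgroup SL(2, ℝ))

instance : MeasurableConstSMul G UnitTangent :=
  ⟨fun g => (continuous_smul_unitTangent g).measurable⟩

instance : MeasurableConstSMul G ℍ :=
  ⟨fun g => (continuous_const_smul (g : SL(2, ℝ))).measurable⟩

instance : SMulInvariantMeasure G ℍ volume :=
  ⟨fun g _ hs => SMulInvariantMeasure.measure_preimage_smul (g : SL(2, ℝ)) hs⟩

instance : SMulInvariantMeasure G UnitTangent liouvilleUpper :=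
  ⟨fun g _ hs => SMulInvariantMeasure.measure_preimage_smul (g : SL(2, ℝ)) hs⟩

theorem volume_le_surfaceArea {F : Set ℍ} (hF : MeasurableSet F)
    (hinj : ∀ x ∈ F, ∀ g : G, g • x ∈ F → ∀ w : ℍ, g • w = w) : volume F ≤ surfaceArea G := by
  have := measure_inter_le_quotientMeasure (G := G) (m := (volume : Measure ℍ)) hF
    (injOn_orbitMk_iff.2 fun x hx g hgx => hinj x hx g hgx x) univ
  rwa [preimage_univ, univ_inter] at this

variable [DiscreteTopology G]

theorem surfaceArea_ne_zero : surfaceArea G ≠ 0 := by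
  obtain ⟨F, hF, hinj, hcov⟩ := exists_fundamental_set G
  intro h0
  have h1 : volume F = 0 := by
    refine le_antisymm ?_ zero_le
    rw [← h0]
    exact volume_le_surfaceArea G hF hinj
  have h2 : ∀ᵐ x : ℍ, ∀ g : G, g • x ∉ F := by
    refine ae_all_iff.2 fun g => ?_
    exact (measurePreserving_smul g (volume : Measure ℍ)).quasiMeasurePreserving.ae
      (p := fun x => x ∉ F) (measure_eq_zero_iff_ae_notMem.1 h1)
  have h3 : ∀ᵐ _ : ℍ, False := by
    filter_upwards [h2, hcov] with x hx ⟨g, hg⟩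
    exact hx g hg
  rw [ae_upperHalfPlane_iff] at h3
  have h4 : volume {z : ℂ | 0 < z.im} = 0 := measure_eq_zero_iff_ae_notMem.2 h3
  have hopen : IsOpen {z : ℂ | 0 < z.im} := isOpen_lt continuous_const Complex.continuous_im
  exact (hopen.measure_pos volume ⟨Complex.I, by simp⟩).ne' h4

/-- If the orbifold has finite area, then `G` has a fundamental set of finite Liouville measure in
the unit tangent bundle: the one lying over a fundamental set in `ℍ`. -/
theorem exists_fundamental_set_unitTangent (harea : surfaceArea G ≠ ⊤) :
    ∃ D : Set UnitTangent, MeasurableSet D ∧ InjOn (orbitMk G) D ∧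
      (∀ᵐ v ∂liouvilleUpper, ∃ g : G, g • v ∈ D) ∧ liouvilleUpper D ≠ ⊤ := by
  obtain ⟨F, hF, hinj, hcov⟩ := exists_fundamental_set G
  refine ⟨UnitTangent.base ⁻¹' F, continuous_base.measurable hF, ?_, ?_, ?_⟩
  · refine injOn_orbitMk_iff.2 fun v hv g hgv => ?_
    exact smul_unitTangent_eq_self (h := (g : SL(2, ℝ))) (hinj _ hv g hgv) v
  · have hqm : Measure.QuasiMeasurePreserving UnitTangent.base liouvilleUpper volume := by
      refine ⟨continuous_base.measurable, Measure.AbsolutelyContinuous.mk fun s hs h => ?_⟩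
      rw [Measure.map_apply continuous_base.measurable hs, liouvilleUpper_preimage_base hs, h,
        zero_mul]
    exact hqm.ae hcov
  · rw [liouvilleUpper_preimage_base hF]
    exact ENNReal.mul_ne_top (ne_top_of_le_ne_top harea (volume_le_surfaceArea G hF hinj))
      ENNReal.ofReal_ne_top

theorem isFiniteMeasure_quotientMeasure (harea : surfaceArea G ≠ ⊤) :
    IsFiniteMeasure (quotientMeasure G UnitTangent liouvilleUpper) := by
  obtain ⟨D, hD, hinj, hcov, hfin⟩ := exists_fundamental_set_unitTangent G harea
  refine ⟨?_⟩
  rw [quotientMeasure_eq_map hD hinj hcov, Measure.map_apply measurable_orbitMk MeasurableSet.univ]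
  simpa using hfin.lt_top

omit [DiscreteTopology G] in
theorem surfaceFlow_orbitMk (t : ℝ) (v : UnitTangent) :
    surfaceFlow G t (orbitMk G v) = orbitMk G (flow t v) := rfl

omit [DiscreteTopology G] in
theorem measurable_surfaceFlow (t : ℝ) : Measurable (surfaceFlow G t) := by
  intro W hW
  show MeasurableSet (orbitMk G ⁻¹' (surfaceFlow G t ⁻¹' W))
  exact (continuous_flow_const t).measurable (measurable_orbitMk hW)

theorem measurePreserving_surfaceFlow (harea : surfaceArea G ≠ ⊤) (t : ℝ) :
    MeasurePreserving (surfaceFlow G t) (quotientMeasure G UnitTangent liouvilleUpper)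
      (quotientMeasure G UnitTangent liouvilleUpper) := by
  obtain ⟨D, hD, hinj, hcov, -⟩ := exists_fundamental_set_unitTangent G harea
  set μ := quotientMeasure G UnitTangent liouvilleUpper with hμ
  -- the flow moves a fundamental set to another one
  have hle : ∀ t, Measure.map (surfaceFlow G t) μ ≤ μ := by
    intro t
    have hmp := measurePreserving_flow t
    have e1 : Measure.map (surfaceFlow G t) μ =
        Measure.map (orbitMk G) (liouvilleUpper.restrict (flow (-t) ⁻¹' D)) := by
      rw [hμ, quotientMeasure_eq_map hD hinj hcov,
        Measure.map_map (measurable_surfaceFlow G t) measurable_orbitMk]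
      have e2 : liouvilleUpper.restrict (flow (-t) ⁻¹' D) =
          Measure.map (flow t) (liouvilleUpper.restrict D) := by
        have h := hmp.restrict_preimage (s := flow (-t) ⁻¹' D)
          ((continuous_flow_const (-t)).measurable hD)
        rw [← h.map_eq, ← preimage_comp]
        congr 2
        ext v
        simp [flow_neg_flow]
      rw [e2, Measure.map_map measurable_orbitMk (continuous_flow_const t).measurable]
      rfl
    rw [e1]
    refine map_restrict_le_quotientMeasure ((continuous_flow_const (-t)).measurable hD) ?_
    refine injOn_orbitMk_iff.2 fun v hv g hgv => ?_
    have h1 : g • flow (-t) v ∈ D := by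
      have : flow (-t) (g • v) = g • flow (-t) v := flow_smul (-t) g v
      rw [← this]; exact hgv
    have h2 := injOn_orbitMk_iff.1 hinj _ hv g h1
    have h3 : flow t (g • flow (-t) v) = g • flow t (flow (-t) v) := flow_smul t g _
    rw [h2, flow_flow_neg] at h3
    exact h3.symm
  refine ⟨measurable_surfaceFlow G t, le_antisymm (hle t) ?_⟩
  have h1 := Measure.map_mono (hle (-t)) (measurable_surfaceFlow G t)
  rwa [Measure.map_map (measurable_surfaceFlow G t) (measurable_surfaceFlow G (-t)),
    show surfaceFlow G t ∘ surfaceFlow G (-t) = id from by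
      funext q
      obtain ⟨v, rfl⟩ := Quotient.exists_rep q
      show orbitMk G (flow t (flow (-t) v)) = orbitMk G v
      rw [flow_flow_neg], Measure.map_id] at h1

/-! ### Recurrence -/

omit [DiscreteTopology G] in
theorem iterate_surfaceFlow (σ : ℝ) (k : ℕ) (v : UnitTangent) :
    (surfaceFlow G σ)^[k] (orbitMk G v) = orbitMk G (flow (k * σ) v) := by
  induction k with
  | zero => simp [flow_zero]
  | succ k ih =>
    rw [Function.iterate_succ_apply', ih, surfaceFlow_orbitMk, ← flow_add]
    congr 2
    push_cast; ring

/-- Poincaré recurrence for the geodesic flow, in both directions of time. -/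
theorem ae_recurrent (harea : surfaceArea G ≠ ⊤) {V : Set UnitTangent} (hV : IsOpen V)
    (hVG : ∀ g : G, ∀ v ∈ V, g • v ∈ V) :
    ∀ᵐ v ∂liouvilleUpper, (∃ t, flow t v ∈ V) →
      (∀ T, ∃ t > T, flow t v ∈ V) ∧ (∀ T, ∃ t < T, flow t v ∈ V) := by
  obtain ⟨D, hD, hinj, hcov, -⟩ := exists_fundamental_set_unitTangent G harea
  have hfinite := isFiniteMeasure_quotientMeasure G harea
  -- integer times suffice if the target is thickened along the flow
  set V' : Set UnitTangent := {v | ∃ s ∈ Icc (0 : ℝ) 1, flow s v ∈ V} with hV'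
  have hV'm : MeasurableSet V' := by
    have : V' = ⋃ s ∈ Icc (0 : ℝ) 1, flow s ⁻¹' V := by
      ext v; simp [hV']
    rw [this]
    exact (isOpen_biUnion fun s _ => hV.preimage (continuous_flow_const s)).measurableSet
  have hV'G : ∀ v, orbitMk G v ∈ orbitMk G '' V' ↔ v ∈ V' := by
    intro v
    constructor
    · rintro ⟨w, ⟨s, hs, hw⟩, hwv⟩
      obtain ⟨g, rfl⟩ := orbitMk_eq_iff.1 hwv
      refine ⟨s, hs, ?_⟩
      have h1 : flow s (g • v) = g • flow s v := flow_smul s g v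
      have := hVG g⁻¹ _ hw
      rwa [h1, inv_smul_smul] at this
    · intro hv
      exact ⟨v, hv, rfl⟩
  have key : ∀ σ : ℝ, ∀ᵐ v ∂liouvilleUpper, ∀ n : ℤ, flow n v ∈ V' →
      ∃ᶠ k : ℕ in atTop, flow (k * σ + n) v ∈ V' := by
    intro σ
    have h1 := (measurePreserving_surfaceFlow G harea σ).conservative.ae_mem_imp_frequently_image_mem
      (measurableSet_image_orbitMk (G := G) hV'm).nullMeasurableSet
    have h2 := ae_of_ae_quotientMeasure hD hinj hcov h1
    simp only [iterate_surfaceFlow, hV'G] at h2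
    refine ae_all_iff.2 fun n => ?_
    filter_upwards [(measurePreserving_flow n).quasiMeasurePreserving.ae h2] with v hv hn
    simpa only [flow_add] using hv hn
  filter_upwards [key 1, key (-1)] with v h1 h2
  rintro ⟨t, ht⟩
  have hn : flow (⌊t⌋ : ℤ) v ∈ V' := by
    refine ⟨Int.fract t, ⟨Int.fract_nonneg t, (Int.fract_lt_one t).le⟩, ?_⟩
    rwa [← flow_add, Int.fract_add_floor]
  refine ⟨fun T => ?_, fun T => ?_⟩
  · obtain ⟨N, hN⟩ := exists_nat_gt (T - (⌊t⌋ : ℤ))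
    obtain ⟨k, hk, s, hs, hs2⟩ := Filter.frequently_atTop.1 (h1 _ hn) N
    refine ⟨_, ?_, by rw [← flow_add] at hs2; exact hs2⟩
    have : (N : ℝ) ≤ k := by exact_mod_cast hk
    linarith [hs.1]
  · obtain ⟨N, hN⟩ := exists_nat_gt ((⌊t⌋ : ℤ) + 1 - T)
    obtain ⟨k, hk, s, hs, hs2⟩ := Filter.frequently_atTop.1 (h2 _ hn) N
    refine ⟨_, ?_, by rw [← flow_add] at hs2; exact hs2⟩
    have : (N : ℝ) ≤ k := by exact_mod_cast hk
    linarith [hs.2]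

end Finite

/-! ### An invariant distance on the unit tangent bundle -/

/-- A distance on `T₁ℍ` which is invariant under isometries: unit vectors are compared through
their foot points and the foot points one unit of time later. -/
def vecDist (v w : UnitTangent) : ℝ :=
  dist v.base w.base + dist (flow 1 v).base (flow 1 w).base

theorem vecDist_triangle (u v w : UnitTangent) : vecDist u w ≤ vecDist u v + vecDist v w := by
  have h1 := dist_triangle u.base v.base w.base
  have h2 := dist_triangle (flow 1 u).base (flow 1 v).base (flow 1 w).base
  unfold vecDist
  linarith

theorem vecDist_comm (v w : UnitTangent) : vecDist v w = vecDist w v := by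
  simp only [vecDist, dist_comm]

theorem vecDist_smul (g : SL(2, ℝ)) (v w : UnitTangent) :
    vecDist (g • v) (g • w) = vecDist v w := by
  simp only [vecDist, flow_smul, base_smul, dist_smul]

theorem continuous_vecDist (w : UnitTangent) : Continuous fun v => vecDist v w := by
  have h1 : Continuous fun v : UnitTangent => (flow 1 v).base :=
    continuous_base.comp (continuous_flow_const 1)
  exact (continuous_base.dist continuous_const).add (h1.dist continuous_const)

theorem vecDist_self (v : UnitTangent) : vecDist v v = 0 := by simp [vecDist]

theorem eq_of_vecDist_eq_zero {v w : UnitTangent} (h : vecDist v w = 0) : v = w := by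
  obtain ⟨h1, h2⟩ := (add_eq_zero_iff_of_nonneg dist_nonneg dist_nonneg).1 h
  rw [dist_eq_zero] at h1 h2
  refine UnitTangent.ext h1 (Circle.ext ?_)
  -- the direction solves a linear equation in terms of the two foot points
  set p := (flow 1 w).base
  have key : ∀ u : UnitTangent, u.base = w.base → (flow 1 u).base = p →
      Complex.I * u.dir * (Real.sinh (1 / 2) : ℂ) * ((p : ℂ) - (starRingEnd ℂ) (w.base : ℂ)) =
        (Real.cosh (1 / 2) : ℂ) * ((w.base : ℂ) - p) := by
    intro u hu hup
    have h3 := coe_base_flow 1 u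
    rw [eq_div_iff (flowDenom_ne_zero 1 u.dir), hup, hu, flowDenom] at h3
    linear_combination h3
  have h4 : ((p : ℂ) - (starRingEnd ℂ) (w.base : ℂ)) ≠ 0 := by
    intro h0
    have := congrArg Complex.im h0
    simp only [Complex.sub_im, Complex.conj_im, coe_im, Complex.zero_im] at this
    linarith [p.im_pos, w.base.im_pos]
  have h5 : (Real.sinh (1 / 2) : ℂ) ≠ 0 := by
    exact_mod_cast (Real.sinh_pos_iff.2 (by norm_num : (0 : ℝ) < 1 / 2)).ne'
  have h6 := (key v h1 h2).trans (key w rfl rfl).symm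
  exact mul_left_cancel₀ Complex.I_ne_zero (mul_right_cancel₀ h5 (mul_right_cancel₀ h4 h6))

theorem exists_vecDist_ball_subset {v : UnitTangent} {O : Set UnitTangent} (hO : IsOpen O)
    (hv : v ∈ O) : ∃ δ > 0, ∀ w, vecDist w v < δ → w ∈ O := by
  set C : Set UnitTangent := trivialization ⁻¹' (Metric.closedBall v.base 1 ×ˢ univ) \ O
  have hCc : IsCompact C :=
    (trivialization.isCompact_preimage.2
      ((isCompact_closedBall v.base 1).prod isCompact_univ)).diff hO
  obtain ⟨δ, hδ, h⟩ : ∃ δ > 0, ∀ w ∈ C, δ ≤ vecDist w v := by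
    rcases C.eq_empty_or_nonempty with h | h
    · exact ⟨1, one_pos, fun w hw => by simp [h] at hw⟩
    · obtain ⟨w, hw, hmin⟩ := hCc.exists_isMinOn h (continuous_vecDist v).continuousOn
      refine ⟨vecDist w v, lt_of_le_of_ne (add_nonneg dist_nonneg dist_nonneg) ?_,
        fun w' hw' => hmin hw'⟩
      intro h0
      have := eq_of_vecDist_eq_zero h0.symm
      exact hw.2 (this ▸ hv)
  refine ⟨min δ 1, lt_min hδ one_pos, fun w hw => ?_⟩
  by_contra hwO
  have h1 : dist w.base v.base ≤ 1 := by
    have := hw.trans_le (min_le_right _ _)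
    unfold vecDist at this
    linarith [dist_nonneg (x := (flow 1 w).base) (y := (flow 1 v).base)]
  exact absurd (h w ⟨⟨h1, mem_univ _⟩, hwO⟩) (not_le.2 (hw.trans_le (min_le_left _ _)))

/-! ### Geodesics with a common endpoint are asymptotic -/

theorem flow_coordVector (s x y : ℝ) (h : x ≠ y) (t : ℝ) :
    flow s (coordVector x y h t) = coordVector x y h (s + t) := (flow_add _ _ _).symm

theorem re_coordVector (x y : ℝ) (h : x ≠ y) (t : ℝ) :
    (coordVector x y h t).base.re = (x + y) / 2 + (y - x) / 2 * Real.tanh t := by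
  rcases h.lt_or_gt with hlt | hlt
  · refine (re_base_flow_horizontal (e := 1) (by norm_num) (by simp [hlt]) t _).trans ?_
    show (x + y) / 2 + 1 * (|x - y| / 2) * Real.tanh t = _
    rw [abs_of_neg (sub_neg.2 hlt)]; ring
  · refine (re_base_flow_horizontal (e := -1) (by norm_num)
      (by rw [if_neg hlt.not_gt]; exact coe_exp_pi) t _).trans ?_
    show (x + y) / 2 + -1 * (|x - y| / 2) * Real.tanh t = _
    rw [abs_of_pos (sub_pos.2 hlt)]; ring

theorem im_coordVector (x y : ℝ) (h : x ≠ y) (t : ℝ) :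
    (coordVector x y h t).base.im = |x - y| / 2 / Real.cosh t := by
  rcases h.lt_or_gt with hlt | hlt
  · exact im_base_flow_horizontal (e := 1) (by norm_num) (by simp [hlt]) t _
  · exact im_base_flow_horizontal (e := -1) (by norm_num)
      (by rw [if_neg hlt.not_gt]; exact coe_exp_pi) t _

theorem base_coordVector_swap (x y : ℝ) (h : x ≠ y) (t : ℝ) :
    (coordVector x y h t).base = (coordVector y x h.symm (-t)).base := by
  refine UpperHalfPlane.ext (Complex.ext ?_ ?_)
  · refine (re_coordVector x y h t).trans (Eq.trans ?_ (re_coordVector y x h.symm (-t)).symm)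
    rw [Real.tanh_neg]; ring
  · refine (im_coordVector x y h t).trans (Eq.trans ?_ (im_coordVector y x h.symm (-t)).symm)
    rw [Real.cosh_neg, abs_sub_comm]

theorem exp_mul_one_sub_tanh (t : ℝ) : Real.exp t * (1 - Real.tanh t) = 1 / Real.cosh t := by
  rw [Real.tanh_eq_sinh_div_cosh]
  field_simp
  rw [Real.cosh_sub_sinh, ← Real.exp_add, add_neg_cancel, Real.exp_zero]

theorem tendsto_cosh_atTop : Tendsto Real.cosh atTop atTop := by
  refine tendsto_atTop_mono (fun t => ?_) (Real.tendsto_exp_atTop.atTop_div_const two_pos)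
  rw [Real.cosh_eq]
  linarith [Real.exp_pos (-t)]

theorem tendsto_exp_div_cosh : Tendsto (fun t => Real.exp t / Real.cosh t) atTop (𝓝 2) := by
  have h1 : ∀ t, Real.exp t / Real.cosh t = 2 - Real.exp (-t) * (1 / Real.cosh t) := by
    intro t
    field_simp
    rw [Real.cosh_eq]; ring
  simp_rw [h1]
  have h2 := Real.tendsto_exp_neg_atTop_nhds_zero
  have h3 : Tendsto (fun t => 1 / Real.cosh t) atTop (𝓝 0) :=
    tendsto_const_nhds.div_atTop tendsto_cosh_atTop
  simpa using (tendsto_const_nhds (x := (2 : ℝ))).sub (h2.mul h3)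

/-- Two geodesics with the same forward endpoint approach each other, after a shift of time. -/
theorem tendsto_dist_base_coordVector {x x' y : ℝ} (h : x ≠ y) (h' : x' ≠ y) :
    Tendsto (fun t => dist (coordVector x y h t).base
      (coordVector x' y h' (t + Real.log (|x' - y| / |x - y|))).base) atTop (𝓝 0) := by
  set a := Real.log (|x' - y| / |x - y|)
  have hxy : 0 < |x - y| := abs_pos.2 (sub_ne_zero.2 h)
  have hxy' : 0 < |x' - y| := abs_pos.2 (sub_ne_zero.2 h')
  have hea : Real.exp a = |x' - y| / |x - y| := Real.exp_log (div_pos hxy' hxy)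
  have hshift : Tendsto (fun t : ℝ => t + a) atTop atTop :=
    tendsto_atTop_add_const_right _ _ tendsto_id
  set z : ℝ → ℍ := fun t => (coordVector x y h t).base with hz
  set z' : ℝ → ℍ := fun t => (coordVector x' y h' (t + a)).base with hz'
  have hA : Tendsto (fun t => 1 / Real.cosh t) atTop (𝓝 0) :=
    tendsto_const_nhds.div_atTop tendsto_cosh_atTop
  -- after scaling by `exp t`, both positions converge to the same point of the upper half plane
  have him : Tendsto (fun t => Real.exp t * (z t).im) atTop (𝓝 |x - y|) := by
    have e : ∀ t, Real.exp t * (z t).im = |x - y| / 2 * (Real.exp t / Real.cosh t) := by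
      intro t; rw [hz, im_coordVector]; ring
    simp_rw [e]
    convert tendsto_exp_div_cosh.const_mul (|x - y| / 2) using 2
    ring
  have him' : Tendsto (fun t => Real.exp t * (z' t).im) atTop (𝓝 |x - y|) := by
    have e : ∀ t, Real.exp t * (z' t).im =
        |x - y| / 2 * (Real.exp (t + a) / Real.cosh (t + a)) := by
      intro t
      rw [hz', im_coordVector, Real.exp_add, hea]
      field_simp
    simp_rw [e]
    have := (tendsto_exp_div_cosh.comp hshift).const_mul (|x - y| / 2)
    rwa [div_mul_cancel₀ _ two_ne_zero] at this
  have hre : Tendsto (fun t => Real.exp t * ((z t).re - y)) atTop (𝓝 0) := by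
    have e : ∀ t, Real.exp t * ((z t).re - y) = (x - y) / 2 * (1 / Real.cosh t) := by
      intro t
      rw [hz, re_coordVector, ← exp_mul_one_sub_tanh]; ring
    simp_rw [e]
    simpa using hA.const_mul ((x - y) / 2)
  have hre' : Tendsto (fun t => Real.exp t * ((z' t).re - y)) atTop (𝓝 0) := by
    have e : ∀ t, Real.exp t * ((z' t).re - y) =
        Real.exp (-a) * ((x' - y) / 2) * (1 / Real.cosh (t + a)) := by
      intro t
      rw [hz', re_coordVector, ← exp_mul_one_sub_tanh]
      have : Real.exp t = Real.exp (-a) * Real.exp (t + a) := by rw [← Real.exp_add]; ring_nf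
      rw [this]; ring
    simp_rw [e]
    simpa using (hA.comp hshift).const_mul (Real.exp (-a) * ((x' - y) / 2))
  have hbound : ∀ t, dist (z t) (z' t) ≤
      (|Real.exp t * ((z t).re - y) - Real.exp t * ((z' t).re - y)| +
        |Real.exp t * (z t).im - Real.exp t * (z' t).im|) /
      √((Real.exp t * (z t).im) * (Real.exp t * (z' t).im)) := by
    intro t
    have het := Real.exp_pos t
    refine (dist_le_dist_coe_div_sqrt _ _).trans ?_
    have e1 : √((Real.exp t * (z t).im) * (Real.exp t * (z' t).im)) =
        Real.exp t * √((z t).im * (z' t).im) := by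
      rw [show (Real.exp t * (z t).im) * (Real.exp t * (z' t).im) =
        Real.exp t ^ 2 * ((z t).im * (z' t).im) by ring, Real.sqrt_mul (sq_nonneg _),
        Real.sqrt_sq het.le]
    have e2 : |Real.exp t * ((z t).re - y) - Real.exp t * ((z' t).re - y)| +
        |Real.exp t * (z t).im - Real.exp t * (z' t).im| =
        Real.exp t * (|(z t).re - (z' t).re| + |(z t).im - (z' t).im|) := by
      rw [← mul_sub, ← mul_sub, abs_mul, abs_mul, abs_of_pos het, ← mul_add]
      congr 3
      ring
    rw [e1, e2, mul_div_mul_left _ _ het.ne']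
    refine div_le_div_of_nonneg_right ?_ (Real.sqrt_nonneg _)
    rw [Complex.dist_eq]
    exact Complex.norm_le_abs_re_add_abs_im _
  have hlim : Tendsto (fun t => (|Real.exp t * ((z t).re - y) - Real.exp t * ((z' t).re - y)| +
        |Real.exp t * (z t).im - Real.exp t * (z' t).im|) /
      √((Real.exp t * (z t).im) * (Real.exp t * (z' t).im))) atTop (𝓝 0) := by
    have h1 := (((hre.sub hre').abs).add ((him.sub him').abs)).div
      ((him.mul him').sqrt) (Real.sqrt_pos.2 (mul_pos hxy hxy)).ne'
    rw [show (0 : ℝ) = (|0 - 0| + |(|x - y| - |x - y|)|) / √(|x - y| * |x - y|) by simp]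
    exact h1
  exact squeeze_zero (fun _ => dist_nonneg) hbound hlim

theorem tendsto_vecDist_forward {x x' y : ℝ} (h : x ≠ y) (h' : x' ≠ y) :
    ∃ a, Tendsto (fun t => vecDist (coordVector x y h t) (coordVector x' y h' (t + a))) atTop
      (𝓝 0) := by
  refine ⟨Real.log (|x' - y| / |x - y|), ?_⟩
  have h1 := tendsto_dist_base_coordVector h h'
  have h2 := h1.comp (tendsto_atTop_add_const_left atTop (1 : ℝ) tendsto_id)
  simpa [vecDist, flow_coordVector, Function.comp_def, add_assoc] using h1.add h2

theorem tendsto_vecDist_backward {x y y' : ℝ} (h : x ≠ y) (h' : x ≠ y') :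
    ∃ a, Tendsto (fun t => vecDist (coordVector x y h t) (coordVector x y' h' (t + a))) atBot
      (𝓝 0) := by
  refine ⟨-Real.log (|y' - x| / |y - x|), ?_⟩
  have h1 := (tendsto_dist_base_coordVector h.symm h'.symm).comp tendsto_neg_atBot_atTop
  have h2 := h1.comp (tendsto_atBot_add_const_left atBot (1 : ℝ) tendsto_id)
  have h3 := h1.add h2
  rw [add_zero] at h3
  refine h3.congr fun t => ?_
  simp only [vecDist, flow_coordVector, Function.comp_def, id]
  rw [base_coordVector_swap x y h, base_coordVector_swap x y' h', base_coordVector_swap x y h,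
    base_coordVector_swap x y' h']
  congr 5 <;> ring

/-! ### Null sets in terms of pairs of endpoints -/

theorem ae_comp_linear {a b c d : ℝ} (hdet : a * d - b * c ≠ 0) {P : ℂ → Prop}
    (h : ∀ᵐ z, P z) : ∀ᵐ z : ℂ, P ⟨a * z.re + b * z.im, c * z.re + d * z.im⟩ := by
  let L : ℂ →ₗ[ℝ] ℂ := ((Complex.reCLM.smulRight (⟨a, c⟩ : ℂ) +
    Complex.imCLM.smulRight (⟨b, d⟩ : ℂ) : ℂ →L[ℝ] ℂ) : ℂ →ₗ[ℝ] ℂ)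
  have hL : ∀ z : ℂ, L z = ⟨a * z.re + b * z.im, c * z.re + d * z.im⟩ := by
    intro w
    apply Complex.ext <;> simp [L, mul_comm]
  have hd : LinearMap.det L ≠ 0 := by
    rw [← LinearMap.det_toMatrix Complex.basisOneI, Matrix.det_fin_two]
    simpa [LinearMap.toMatrix_apply, hL] using hdet
  have h1 := Measure.addHaar_preimage_linearMap (volume : Measure ℂ) hd {z | ¬ P z}
  rw [ae_iff.1 h, mul_zero] at h1
  rw [ae_iff, ← h1]
  congr 1
  ext z
  simp [hL]

theorem ae_prod_iff_ae_complex {P : ℝ → ℝ → Prop} :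
    (∀ᵐ p : ℝ × ℝ, P p.1 p.2) ↔ ∀ᵐ z : ℂ, P z.re z.im := by
  constructor
  · intro h
    exact Complex.volume_preserving_equiv_real_prod.quasiMeasurePreserving.ae h
  · intro h
    exact Complex.volume_preserving_equiv_real_prod.symm.quasiMeasurePreserving.ae h

theorem topVector_of_lt {x y : ℝ} (h : x ≠ y) (hlt : x < y) {w : ℍ}
    (hw : (w : ℂ) = ⟨(x + y) / 2, (y - x) / 2⟩) : topVector x y h = ⟨w, 1⟩ := by
  refine UnitTangent.ext (UpperHalfPlane.ext ?_) (if_pos hlt)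
  rw [hw]
  show (⟨(x + y) / 2, |x - y| / 2⟩ : ℂ) = _
  rw [abs_of_neg (sub_neg.2 hlt), neg_sub]

theorem topVector_of_gt {x y : ℝ} (h : x ≠ y) (hlt : y < x) {w : ℍ}
    (hw : (w : ℂ) = ⟨(x + y) / 2, (x - y) / 2⟩) :
    topVector x y h = ⟨w, Circle.exp Real.pi⟩ := by
  refine UnitTangent.ext (UpperHalfPlane.ext ?_) (if_neg hlt.not_gt)
  rw [hw]
  show (⟨(x + y) / 2, |x - y| / 2⟩ : ℂ) = _
  rw [abs_of_pos (sub_pos.2 hlt)]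

theorem measurable_volume_flow {s : Set UnitTangent} (hs : MeasurableSet s) (u : Circle) :
    Measurable fun t => volume {w : ℍ | flow t ⟨w, u⟩ ∈ s} := by
  have h1 : Continuous fun p : ℝ × ℍ => (p.1, (⟨p.2, u⟩ : UnitTangent)) :=
    continuous_fst.prodMk (continuous_mk_iff.2 ⟨continuous_snd, continuous_const⟩)
  exact measurable_measure_prodMk_left ((continuous_flow.comp h1).measurable hs)

section Invariant

variable {P : UnitTangent → Prop} (hP : ∀ t v, P (flow t v) ↔ P v)
include hP

theorem ae_horizontal_of_ae (h : ∀ᵐ v ∂liouvilleUpper, P v) :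
    ∀ᵐ w : ℍ, P ⟨w, 1⟩ ∧ P ⟨w, Circle.exp Real.pi⟩ := by
  obtain ⟨N, hN, hNm, hN0⟩ := exists_measurable_superset_of_null (ae_iff.1 h)
  rw [liouvilleUpper_eq_lintegral_flow hNm, add_eq_zero] at hN0
  have key : ∀ u : Circle, (∫⁻ t, volume {w : ℍ | flow t ⟨w, u⟩ ∈ N}) = 0 →
      ∀ᵐ w : ℍ, P ⟨w, u⟩ := by
    intro u hu
    rw [lintegral_eq_zero_iff (measurable_volume_flow hNm u)] at hu
    obtain ⟨t, ht⟩ := hu.exists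
    refine measure_mono_null (fun w hw => ?_) ht
    refine hN ?_
    show ¬ P (flow t ⟨w, u⟩)
    rwa [hP]
  exact (key _ hN0.1).and (key _ hN0.2)

theorem ae_of_ae_horizontal (hm : MeasurableSet {v | P v})
    (h : ∀ᵐ w : ℍ, P ⟨w, 1⟩ ∧ P ⟨w, Circle.exp Real.pi⟩) : ∀ᵐ v ∂liouvilleUpper, P v := by
  rw [ae_iff, show {v | ¬ P v} = {v | P v}ᶜ from rfl, liouvilleUpper_eq_lintegral_flow hm.compl]
  have key : ∀ u : Circle, (∀ᵐ w : ℍ, P ⟨w, u⟩) →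
      (∫⁻ t, volume {w : ℍ | flow t ⟨w, u⟩ ∈ {v | P v}ᶜ}) = 0 := by
    intro u hu
    refine (lintegral_congr fun t => ?_).trans lintegral_zero
    simp only [mem_compl_iff, mem_ofPred_eq, hP]
    exact hu
  rw [key 1 (h.mono fun _ => And.left), key _ (h.mono fun _ => And.right), add_zero]

/-- A property which is invariant under the geodesic flow is a property of pairs of endpoints; if it
holds almost everywhere, then it holds for almost all pairs. -/
theorem ae_endpoints_of_ae (h : ∀ᵐ v ∂liouvilleUpper, P v) :
    ∀ᵐ p : ℝ × ℝ, ∀ hne : p.1 ≠ p.2, P (topVector p.1 p.2 hne) := by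
  have h1 := ae_upperHalfPlane_iff.1 (ae_horizontal_of_ae hP h)
  refine (ae_prod_iff_ae_complex (P := fun x y => ∀ hne : x ≠ y, P (topVector x y hne))).2 ?_
  filter_upwards [ae_comp_linear (a := 1 / 2) (b := 1 / 2) (c := -1 / 2) (d := 1 / 2)
      (by norm_num) h1,
    ae_comp_linear (a := 1 / 2) (b := 1 / 2) (c := 1 / 2) (d := -1 / 2) (by norm_num) h1]
    with z h2 h3 hne
  rcases hne.lt_or_gt with hlt | hlt
  · have h4 := (h2 (show 0 < -1 / 2 * z.re + 1 / 2 * z.im by linarith)).1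
    rw [topVector_of_lt hne hlt (Complex.ext _ _)]
    · exact h4
    · show 1 / 2 * z.re + 1 / 2 * z.im = (z.re + z.im) / 2
      ring
    · show -1 / 2 * z.re + 1 / 2 * z.im = (z.im - z.re) / 2
      ring
  · have h4 := (h3 (show 0 < 1 / 2 * z.re + -1 / 2 * z.im by linarith)).2
    rw [topVector_of_gt hne hlt (Complex.ext _ _)]
    · exact h4
    · show 1 / 2 * z.re + 1 / 2 * z.im = (z.re + z.im) / 2
      ring
    · show 1 / 2 * z.re + -1 / 2 * z.im = (z.re - z.im) / 2
      ring

theorem ae_of_ae_endpoints (hm : MeasurableSet {v | P v})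
    (h : ∀ᵐ p : ℝ × ℝ, ∀ hne : p.1 ≠ p.2, P (topVector p.1 p.2 hne)) :
    ∀ᵐ v ∂liouvilleUpper, P v := by
  refine ae_of_ae_horizontal hP hm (ae_upperHalfPlane_iff.2 ?_)
  have h1 := (ae_prod_iff_ae_complex (P := fun x y => ∀ hne : x ≠ y, P (topVector x y hne))).1 h
  filter_upwards [ae_comp_linear (a := 1) (b := -1) (c := 1) (d := 1) (by norm_num) h1,
    ae_comp_linear (a := 1) (b := 1) (c := 1) (d := -1) (by norm_num) h1] with z h2 h3 hz
  have hlt : 1 * z.re + -1 * z.im < 1 * z.re + 1 * z.im := by linarith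
  constructor
  · have h4 := h2 hlt.ne
    rwa [topVector_of_lt (w := ⟨z, hz⟩) hlt.ne hlt] at h4
    refine Complex.ext ?_ ?_
    · show z.re = (1 * z.re + -1 * z.im + (1 * z.re + 1 * z.im)) / 2
      ring
    · show z.im = (1 * z.re + 1 * z.im - (1 * z.re + -1 * z.im)) / 2
      ring
  · have h4 := h3 hlt.ne'
    rwa [topVector_of_gt (w := ⟨z, hz⟩) hlt.ne' hlt] at h4
    refine Complex.ext ?_ ?_
    · show z.re = (1 * z.re + 1 * z.im + (1 * z.re + -1 * z.im)) / 2
      ring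
    · show z.im = (1 * z.re + 1 * z.im - (1 * z.re + -1 * z.im)) / 2
      ring

end Invariant

theorem arcLength_pos_of_isOpen {U : Set Circle} (hU : IsOpen U) {u : Circle} (hu : u ∈ U) :
    0 < arcLength U := by
  obtain ⟨θ, rfl⟩ : ∃ a, Circle.exp a = u := ⟨_, Circle.exp_arg u⟩
  have hpi := Real.pi_pos
  have hO : IsOpen (Circle.exp ⁻¹' U ∩ Ioo (θ - Real.pi) (θ + Real.pi)) :=
    (hU.preimage Circle.exp.continuous).inter isOpen_Ioo
  rw [arcLength_eq (θ - Real.pi), Measure.map_apply Circle.exp.continuous.measurable hU.measurableSet,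
    Measure.restrict_apply (Circle.exp.continuous.measurable hU.measurableSet)]
  refine (hO.measure_pos volume ⟨θ, hu, by linarith, by linarith⟩).trans_le (measure_mono ?_)
  refine inter_subset_inter_right _ fun x hx => ⟨hx.1, ?_⟩
  linarith [hx.2]

theorem liouvilleUpper_ne_zero_of_isOpen {V : Set UnitTangent} (hV : IsOpen V)
    {v : UnitTangent} (hv : v ∈ V) : liouvilleUpper V ≠ 0 := by
  intro h0
  rw [liouvilleUpper_eq, Measure.map_apply trivialization.symm.continuous.measurable
    hV.measurableSet] at h0
  have hO : IsOpen (trivialization.symm ⁻¹' V) := hV.preimage trivialization.symm.continuous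
  obtain ⟨A, B, hA, hB, hvA, hvB, hAB⟩ := isOpen_prod_iff.1 hO v.base v.dir hv
  have h1 := measure_mono_null hAB h0
  rw [Measure.prod_prod, mul_eq_zero] at h1
  rcases h1 with h1 | h1
  · have h2 := ae_upperHalfPlane_iff.1 (measure_eq_zero_iff_ae_notMem.1 h1)
    have h3 : IsOpen (((↑) : ℍ → ℂ) '' A) := isOpenEmbedding_coe.isOpenMap _ hA
    refine (h3.measure_pos volume ⟨_, v.base, hvA, rfl⟩).ne' ?_
    refine measure_eq_zero_iff_ae_notMem.2 ?_
    filter_upwards [h2] with z hz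
    rintro ⟨w, hw, rfl⟩
    exact hz w.im_pos hw
  · exact (arcLength_pos_of_isOpen hB hvB).ne' h1

/-! ### Almost every geodesic is dense -/

section Dense

variable (G : Subgroup SL(2, ℝ))

/-- The vectors at distance less than `δ` from the `G`-orbit of `v₀`. -/
def orbitNhd (v₀ : UnitTangent) (δ : ℝ) : Set UnitTangent :=
  {v | ∃ g : G, vecDist v (g • v₀) < δ}

theorem isOpen_orbitNhd (v₀ : UnitTangent) (δ : ℝ) : IsOpen (orbitNhd G v₀ δ) := by
  have : orbitNhd G v₀ δ = ⋃ g : G, {v | vecDist v (g • v₀) < δ} := by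
    ext v; simp [orbitNhd]
  rw [this]
  exact isOpen_iUnion fun g => isOpen_lt (continuous_vecDist _) continuous_const

variable {G}

theorem smul_mem_orbitNhd {v₀ : UnitTangent} {δ : ℝ} (g : G) {v : UnitTangent}
    (hv : v ∈ orbitNhd G v₀ δ) : g • v ∈ orbitNhd G v₀ δ := by
  obtain ⟨h, hh⟩ := hv
  refine ⟨g * h, ?_⟩
  rw [mul_smul]
  exact (vecDist_smul (g : SL(2, ℝ)) v (h • v₀)).trans_lt hh

theorem mem_orbitNhd_of_vecDist {v₀ v w : UnitTangent} {δ δ' : ℝ} (hv : v ∈ orbitNhd G v₀ δ)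
    (h : vecDist v w < δ' - δ) : w ∈ orbitNhd G v₀ δ' := by
  obtain ⟨g, hg⟩ := hv
  refine ⟨g, ?_⟩
  have := vecDist_triangle w v (g • v₀)
  rw [vecDist_comm w v] at this
  linarith

theorem self_mem_orbitNhd {v₀ : UnitTangent} {δ : ℝ} (hδ : 0 < δ) : v₀ ∈ orbitNhd G v₀ δ :=
  ⟨1, by rwa [one_smul, vecDist_self]⟩

variable (G)

/-- The forward orbit of `v` visits the set `V` at arbitrarily large times. -/
def VisitsForward (V : Set UnitTangent) (v : UnitTangent) : Prop := ∀ T : ℝ, ∃ t > T, flow t v ∈ V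

/-- The backward orbit of `v` visits the set `V` at arbitrarily large negative times. -/
def VisitsBackward (V : Set UnitTangent) (v : UnitTangent) : Prop :=
  ∀ T : ℝ, ∃ t < T, flow t v ∈ V

variable {G}

theorem visitsForward_flow {V : Set UnitTangent} (s : ℝ) (v : UnitTangent) :
    VisitsForward V (flow s v) ↔ VisitsForward V v := by
  constructor
  · intro h T
    obtain ⟨t, ht, htV⟩ := h (T - s)
    exact ⟨t + s, by linarith, by rwa [flow_add]⟩
  · intro h T
    obtain ⟨t, ht, htV⟩ := h (T + s)
    exact ⟨t - s, by linarith, by rwa [← flow_add, sub_add_cancel]⟩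

theorem visitsBackward_flow {V : Set UnitTangent} (s : ℝ) (v : UnitTangent) :
    VisitsBackward V (flow s v) ↔ VisitsBackward V v := by
  constructor
  · intro h T
    obtain ⟨t, ht, htV⟩ := h (T - s)
    exact ⟨t + s, by linarith, by rwa [flow_add]⟩
  · intro h T
    obtain ⟨t, ht, htV⟩ := h (T + s)
    exact ⟨t - s, by linarith, by rwa [← flow_add, sub_add_cancel]⟩

theorem visits_flow {V : Set UnitTangent} (s : ℝ) (v : UnitTangent) :
    (∃ t, flow t (flow s v) ∈ V) ↔ ∃ t, flow t v ∈ V := by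
  constructor
  · rintro ⟨t, ht⟩
    exact ⟨t + s, by rwa [flow_add]⟩
  · rintro ⟨t, ht⟩
    exact ⟨t - s, by rwa [← flow_add, sub_add_cancel]⟩

theorem measurableSet_visitsForward {V : Set UnitTangent} (hV : IsOpen V) :
    MeasurableSet {v | VisitsForward V v} := by
  have : {v | VisitsForward V v} = ⋂ n : ℕ, ⋃ t > (n : ℝ), flow t ⁻¹' V := by
    ext v
    simp only [mem_ofPred_eq, mem_iInter, mem_iUnion, mem_preimage, exists_prop]
    refine ⟨fun h n => h n, fun h T => ?_⟩
    obtain ⟨n, hn⟩ := exists_nat_gt T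
    obtain ⟨t, ht, htV⟩ := h n
    exact ⟨t, hn.trans ht, htV⟩
  rw [this]
  exact MeasurableSet.iInter fun n =>
    (isOpen_biUnion fun t _ => hV.preimage (continuous_flow_const t)).measurableSet

theorem visitsForward_of_common_endpoint {v₀ : UnitTangent} {δ δ' : ℝ} (hδ : δ < δ') {x x' y : ℝ}
    (h : x ≠ y) (h' : x' ≠ y) (hv : VisitsForward (orbitNhd G v₀ δ) (topVector x y h)) :
    VisitsForward (orbitNhd G v₀ δ') (topVector x' y h') := by
  obtain ⟨a, ha⟩ := tendsto_vecDist_forward h h'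
  intro T
  obtain ⟨N, hN⟩ := eventually_atTop.1 (ha.eventually (gt_mem_nhds (sub_pos.2 hδ)))
  obtain ⟨t, ht, htV⟩ := hv (max N (T - a))
  refine ⟨t + a, by linarith [le_max_right N (T - a)], ?_⟩
  exact mem_orbitNhd_of_vecDist htV (hN t ((le_max_left _ _).trans ht.le))

theorem visitsBackward_of_common_endpoint {v₀ : UnitTangent} {δ δ' : ℝ} (hδ : δ < δ')
    {x y y' : ℝ} (h : x ≠ y) (h' : x ≠ y')
    (hv : VisitsBackward (orbitNhd G v₀ δ) (topVector x y h)) :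
    VisitsBackward (orbitNhd G v₀ δ') (topVector x y' h') := by
  obtain ⟨a, ha⟩ := tendsto_vecDist_backward h h'
  intro T
  obtain ⟨N, hN⟩ := eventually_atBot.1 (ha.eventually (gt_mem_nhds (sub_pos.2 hδ)))
  obtain ⟨t, ht, htV⟩ := hv (min N (T - a))
  refine ⟨t + a, by linarith [min_le_right N (T - a)], ?_⟩
  exact mem_orbitNhd_of_vecDist htV (hN t (ht.le.trans (min_le_left _ _)))

variable [DiscreteTopology G]

/-- Hopf's argument. By recurrence, almost every geodesic which visits an open set does so
infinitely often in both directions of time. The forward visits only depend on the forward endpoint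
and the backward visits on the backward endpoint, up to an arbitrarily small change of the open set;
by Fubini's theorem, almost every geodesic then visits the open set. -/
theorem ae_visitsForward (harea : surfaceArea G ≠ ⊤) (v₀ : UnitTangent) {δ : ℝ} (hδ : 0 < δ) :
    ∀ᵐ v ∂liouvilleUpper, VisitsForward (orbitNhd G v₀ δ) v := by
  have hrec : ∀ δ, ∀ᵐ v ∂liouvilleUpper, (∃ t, flow t v ∈ orbitNhd G v₀ δ) →
      VisitsForward (orbitNhd G v₀ δ) v ∧ VisitsBackward (orbitNhd G v₀ δ) v := fun δ =>
    ae_recurrent G harea (isOpen_orbitNhd G v₀ δ) fun g _ hv => smul_mem_orbitNhd g hv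
  have hrec' : ∀ δ, ∀ᵐ p : ℝ × ℝ, ∀ hne : p.1 ≠ p.2,
      (∃ t, flow t (topVector p.1 p.2 hne) ∈ orbitNhd G v₀ δ) →
      VisitsForward (orbitNhd G v₀ δ) (topVector p.1 p.2 hne) ∧
        VisitsBackward (orbitNhd G v₀ δ) (topVector p.1 p.2 hne) := fun δ =>
    ae_endpoints_of_ae (P := fun v => (∃ t, flow t v ∈ orbitNhd G v₀ δ) →
      VisitsForward (orbitNhd G v₀ δ) v ∧ VisitsBackward (orbitNhd G v₀ δ) v)
      (fun t v => by rw [visits_flow, visitsForward_flow, visitsBackward_flow]) (hrec δ)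
  -- the radius grows from `δ / 3` to `2 * δ / 3` when the backward endpoint is changed, and then to
  -- `δ` when the forward endpoint is changed
  have h1 : ¬ ∀ᵐ p : ℝ × ℝ, ∀ hne : p.1 ≠ p.2,
      ¬ VisitsForward (orbitNhd G v₀ (δ / 3)) (topVector p.1 p.2 hne) := by
    intro h
    have h2 := ae_of_ae_endpoints (P := fun v => ¬ VisitsForward (orbitNhd G v₀ (δ / 3)) v)
      (fun t v => by rw [visitsForward_flow])
      (measurableSet_visitsForward (isOpen_orbitNhd G v₀ (δ / 3))).compl h
    refine liouvilleUpper_ne_zero_of_isOpen (isOpen_orbitNhd G v₀ (δ / 3))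
      (self_mem_orbitNhd (by positivity)) (measure_eq_zero_iff_ae_notMem.2 ?_)
    filter_upwards [h2, hrec (δ / 3)] with v hv hv2 hvV
    exact hv (hv2 ⟨0, by rwa [flow_zero]⟩).1
  -- almost every backward endpoint has backward visits along some geodesic
  have h2 : ∀ᵐ x : ℝ, ∃ y, ∃ hne : x ≠ y,
      VisitsBackward (orbitNhd G v₀ (2 * δ / 3)) (topVector x y hne) := by
    filter_upwards [Measure.ae_ae_of_ae_prod (hrec' (2 * δ / 3))] with x hx
    by_contra! hno
    refine h1 ?_
    have h3 : ∀ᵐ y : ℝ, ∀ x', ∀ hne : x' ≠ y,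
        ¬ VisitsForward (orbitNhd G v₀ (δ / 3)) (topVector x' y hne) := by
      filter_upwards [hx, Measure.ae_ne volume x] with y hy hyx x' hne hf
      have h4 := visitsForward_of_common_endpoint (δ' := 2 * δ / 3) (by linarith) hne hyx.symm hf
      obtain ⟨t, -, ht⟩ := h4 0
      exact hno y hyx.symm (hy hyx.symm ⟨t, ht⟩).2
    filter_upwards [Measure.quasiMeasurePreserving_snd.ae h3] with p hp hne
    exact hp p.1 hne
  refine ae_of_ae_endpoints (fun t v => visitsForward_flow t v)
    (measurableSet_visitsForward (isOpen_orbitNhd G v₀ δ)) ?_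
  filter_upwards [Measure.quasiMeasurePreserving_fst.ae h2, hrec' δ] with p ⟨y, hne, hy⟩ hp hne'
  have h4 := visitsBackward_of_common_endpoint (δ' := δ) (by linarith) hne hne' hy
  obtain ⟨t, -, ht⟩ := h4 0
  exact (hp hne' ⟨t, ht⟩).1

/-- The forward orbits of almost all vectors return to every neighborhood of every orbit of `G` at
arbitrarily large times, a property which is invariant under the flow and implies density. -/
theorem exists_flow_invariant_dense (harea : surfaceArea G ≠ ⊤) :
    ∃ P : UnitTangent → Prop, (∀ᵐ v ∂liouvilleUpper, P v) ∧ (∀ t v, P (flow t v) ↔ P v) ∧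
      ∀ v, P v → proj G v ∈ denseOrbitSet G := by
  have : Nonempty UnitTangent := ⟨⟨UpperHalfPlane.I, 1⟩⟩
  refine ⟨fun v => ∀ n k : ℕ, VisitsForward
    (orbitNhd G (TopologicalSpace.denseSeq UnitTangent n) (1 / ((k : ℝ) + 1))) v, ?_, ?_, ?_⟩
  · exact ae_all_iff.2 fun n => ae_all_iff.2 fun k => ae_visitsForward harea _ (by positivity)
  · intro t v
    simp only [visitsForward_flow]
  · intro v hv
    refine dense_iff_inter_open.2 fun O hO hne => ?_
    have hO' : IsOpen (proj G ⁻¹' O) := hO.preimage continuous_quotient_mk'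
    obtain ⟨q, hq⟩ := hne
    obtain ⟨w, rfl⟩ := Quotient.exists_rep q
    obtain ⟨_, hx, n, rfl⟩ := (TopologicalSpace.denseRange_denseSeq UnitTangent).inter_open_nonempty
      _ hO' ⟨w, hq⟩
    obtain ⟨δ, hδ, hball⟩ := exists_vecDist_ball_subset hO' hx
    obtain ⟨k, hk⟩ := exists_nat_one_div_lt hδ
    obtain ⟨t, ht, g, hg⟩ := hv n k 0
    refine ⟨proj G (flow t v), ?_, t, ht, rfl⟩
    have h1 : g⁻¹ • flow t v ∈ proj G ⁻¹' O := by
      refine hball _ (lt_trans ?_ hk)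
      have := vecDist_smul ((g⁻¹ : G) : SL(2, ℝ)) (flow t v)
        (g • TopologicalSpace.denseSeq UnitTangent n)
      refine lt_of_eq_of_lt ?_ hg
      rw [← this]
      congr 1
      exact (inv_smul_smul g _).symm
    have h2 : proj G (g⁻¹ • flow t v) = proj G (flow t v) := orbitMk_smul g⁻¹ (flow t v)
    rw [← h2]
    exact h1

end Dense

/-! ### The collar theorem for orbifolds without cone points -/

theorem det_eq (h : SL(2, ℝ)) : h 0 0 * h 1 1 - h 0 1 * h 1 0 = 1 := by
  have := h.det_coe
  rwa [Matrix.det_fin_two] at this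

/-- A matrix acting as `z ↦ k z` is diagonal, with ratio of eigenvalues `k`. -/
theorem entries_of_scaling {h : SL(2, ℝ)} {k : ℝ} (hk : ∀ z : ℍ, ((h • z : ℍ) : ℂ) = (k : ℂ) * z) :
    h 1 0 = 0 ∧ h 0 1 = 0 ∧ h 0 0 = k * h 1 1 := by
  have key : ∀ y : ℝ, 0 < y → h 0 0 * y = k * y * h 1 1 ∧ h 0 1 = - (k * y * (h 1 0 * y)) := by
    intro y hy
    have h1 := hk ⟨⟨0, y⟩, hy⟩
    rw [coe_smul_eq, div_eq_iff (factor_ne_zero _ _), factor] at h1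
    have h2 := congrArg Complex.re h1
    have h3 := congrArg Complex.im h1
    simp only [Complex.add_re, Complex.add_im, Complex.mul_re, Complex.mul_im, Complex.ofReal_re,
      Complex.ofReal_im] at h2 h3
    constructor
    · linear_combination h3
    · linear_combination h2
  have h1 := key 1 one_pos
  have h2 := key 2 two_pos
  have hdet := det_eq h
  have h3 : h 0 1 = 0 := by linarith [h1.2, h2.2]
  refine ⟨?_, h3, by linarith [h1.1]⟩
  have h4 : k * h 1 0 = 0 := by linarith [h1.2]
  rcases mul_eq_zero.1 h4 with h5 | h5
  · rw [h5] at h1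
    have : h 0 0 = 0 := by linarith [h1.1]
    rw [this, h3] at hdet
    norm_num at hdet
  · exact h5

theorem mem_imAxis_smul_iff {h : SL(2, ℝ)} {z : ℍ} (hz : z ∈ imAxis) :
    h • z ∈ imAxis ↔ h 0 0 * h 1 0 * z.im ^ 2 + h 0 1 * h 1 1 = 0 := by
  have hz' : z.re = 0 := hz
  have hN := Complex.normSq_pos.2 (factor_ne_zero h z)
  have h1 : (h • z : ℍ).re = (h 0 0 * h 1 0 * z.im ^ 2 + h 0 1 * h 1 1) /
      Complex.normSq (factor h z) := by
    rw [← coe_re, coe_smul_eq, Complex.div_re, ← add_div]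
    congr 1
    simp only [factor, Complex.add_re, Complex.add_im, Complex.mul_re, Complex.mul_im,
      Complex.ofReal_re, Complex.ofReal_im, coe_re, coe_im, hz']
    ring
  show (h • z : ℍ).re = 0 ↔ _
  rw [h1, div_eq_zero_iff]
  exact or_iff_left hN.ne'

/-- The endpoints `h 0 1 / h 1 1` and `h 0 0 / h 1 0` of the image of the imaginary axis lie on one
side of `0`, since otherwise the image would cross the axis. -/
theorem entries_prod_nonneg {h : SL(2, ℝ)} (hoff : ∀ z ∈ imAxis, h • z ∉ imAxis) :
    0 ≤ h 0 0 * h 1 0 * (h 0 1 * h 1 1) := by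
  by_contra! hneg
  have h1 : h 0 0 * h 1 0 ≠ 0 := by
    intro h0; rw [h0, zero_mul] at hneg; exact lt_irrefl _ hneg
  have h2 : 0 < -(h 0 1 * h 1 1) / (h 0 0 * h 1 0) := by
    have h3 : -(h 0 1 * h 1 1) / (h 0 0 * h 1 0) =
        -(h 0 0 * h 1 0 * (h 0 1 * h 1 1)) / (h 0 0 * h 1 0) ^ 2 := by
      field_simp
    rw [h3]
    exact div_pos (neg_pos.2 hneg) (by positivity)
  have hmem : (⟨⟨0, √(-(h 0 1 * h 1 1) / (h 0 0 * h 1 0))⟩, Real.sqrt_pos.2 h2⟩ : ℍ) ∈ imAxis := rfl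
  refine hoff _ hmem ((mem_imAxis_smul_iff hmem).2 ?_)
  show h 0 0 * h 1 0 * √(-(h 0 1 * h 1 1) / (h 0 0 * h 1 0)) ^ 2 + h 0 1 * h 1 1 = 0
  rw [Real.sq_sqrt h2.le, mul_div_cancel₀ _ h1, neg_add_cancel]

/-- Elements of a discrete group with a constant diagonal and geometrically decaying off-diagonal
entries converge to a diagonal matrix, so they are diagonal themselves. -/
theorem eq_zero_of_discrete {G : Subgroup SL(2, ℝ)} [DiscreteTopology G] {a b c d s : ℝ}
    (hs0 : 0 < s) (hs1 : s < 1) (hbc : b * c = 0) {u : ℕ → SL(2, ℝ)} (hu : ∀ n, u n ∈ G)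
    (hent : ∀ n, u n 0 0 = a ∧ u n 0 1 = b * s ^ n ∧ u n 1 0 = c * s ^ n ∧ u n 1 1 = d) :
    b = 0 ∧ c = 0 := by
  have had : a * d = 1 := by
    have h1 := det_eq (u 0)
    obtain ⟨h2, h3, h4, h5⟩ := hent 0
    rw [h2, h3, h4, h5] at h1
    linear_combination h1 + hbc
  set D : SL(2, ℝ) := ⟨!![a, 0; 0, d], by simpa [Matrix.det_fin_two] using had⟩
  have hpow := tendsto_pow_atTop_nhds_zero_of_lt_one hs0.le hs1
  have hlim : Tendsto u atTop (𝓝 D) := by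
    refine Matrix.SpecialLinearGroup.isClosedEmbedding_val.isInducing.tendsto_nhds_iff.2 ?_
    refine tendsto_pi_nhds.2 fun i => tendsto_pi_nhds.2 fun j => ?_
    have e00 : ∀ n, (u n : Matrix (Fin 2) (Fin 2) ℝ) 0 0 = a := fun n => (hent n).1
    have e01 : ∀ n, (u n : Matrix (Fin 2) (Fin 2) ℝ) 0 1 = b * s ^ n := fun n => (hent n).2.1
    have e10 : ∀ n, (u n : Matrix (Fin 2) (Fin 2) ℝ) 1 0 = c * s ^ n := fun n => (hent n).2.2.1
    have e11 : ∀ n, (u n : Matrix (Fin 2) (Fin 2) ℝ) 1 1 = d := fun n => (hent n).2.2.2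
    have hb := hpow.const_mul b
    have hc := hpow.const_mul c
    rw [mul_zero] at hb hc
    fin_cases i <;> fin_cases j
    · exact tendsto_const_nhds.congr fun n => (e00 n).symm
    · exact hb.congr fun n => (e01 n).symm
    · exact hc.congr fun n => (e10 n).symm
    · exact tendsto_const_nhds.congr fun n => (e11 n).symm
  have hclosed : IsClosed (G : Set SL(2, ℝ)) := Subgroup.isClosed_of_discrete
  have hDG : D ∈ G := hclosed.mem_of_tendsto hlim (Eventually.of_forall hu)
  have hlim' : Tendsto (fun n => (⟨u n, hu n⟩ : G)) atTop (𝓝 ⟨D, hDG⟩) :=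
    tendsto_subtype_rng.2 hlim
  rw [nhds_discrete, tendsto_pure] at hlim'
  obtain ⟨n, hn⟩ := hlim'.exists
  have hun : u n = D := congrArg Subtype.val hn
  obtain ⟨-, h3, h4, -⟩ := hent n
  have hsn : s ^ n ≠ 0 := (pow_pos hs0 n).ne'
  have e1 : D 0 1 = 0 := rfl
  have e2 : D 1 0 = 0 := rfl
  rw [hun, e1] at h3
  rw [hun, e2] at h4
  exact ⟨(mul_eq_zero.1 h3.symm).resolve_right hsn, (mul_eq_zero.1 h4.symm).resolve_right hsn⟩

theorem conj_diagonal_entries {A : SL(2, ℝ)} (h10 : A 1 0 = 0) (h01 : A 0 1 = 0) (k : SL(2, ℝ)) :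
    (A⁻¹ * k * A) 0 0 = k 0 0 ∧ (A⁻¹ * k * A) 0 1 = k 0 1 * A 1 1 ^ 2 ∧
      (A⁻¹ * k * A) 1 0 = k 1 0 * A 0 0 ^ 2 ∧ (A⁻¹ * k * A) 1 1 = k 1 1 := by
  have hdet := det_eq A
  rw [h10, h01] at hdet
  simp only [Matrix.SpecialLinearGroup.coe_mul, Matrix.SpecialLinearGroup.coe_inv,
    Matrix.adjugate_fin_two, Matrix.mul_apply, Fin.sum_univ_two, h10, h01, Matrix.of_apply,
    Matrix.cons_val', Matrix.cons_val_zero, Matrix.cons_val_one, Matrix.cons_val_fin_one]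
  refine ⟨?_, ?_, ?_, ?_⟩
  · linear_combination k 0 0 * hdet
  · ring
  · ring
  · linear_combination k 1 1 * hdet

/-- In a discrete group, no element shares exactly one fixed point on the boundary with a
hyperbolic element. -/
theorem offdiagonal_eq_zero_of_discrete {G : Subgroup SL(2, ℝ)} [DiscreteTopology G]
    {A : SL(2, ℝ)} (hA : A ∈ G) (h10 : A 1 0 = 0) (h01 : A 0 1 = 0) (hlt : A 1 1 ^ 2 < 1)
    {k : SL(2, ℝ)} (hk : k ∈ G) (hprod : k 0 1 * k 1 0 = 0) : k 0 1 = 0 ∧ k 1 0 = 0 := by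
  have hdet := det_eq A
  rw [h10, h01] at hdet
  have h11 : A 1 1 ≠ 0 := by rintro h0; rw [h0] at hdet; norm_num at hdet
  have hpos : 0 < A 1 1 ^ 2 := by positivity
  rcases mul_eq_zero.1 hprod with h0 | h0
  · -- conjugation by the inverse matrix contracts the lower left entry
    have hi : (A⁻¹) 1 0 = 0 ∧ (A⁻¹) 0 1 = 0 ∧ (A⁻¹) 0 0 = A 1 1 := by
      simp [Matrix.SpecialLinearGroup.coe_inv, Matrix.adjugate_fin_two, h10, h01]
    refine eq_zero_of_discrete (G := G) (a := k 0 0) (d := k 1 1) hpos hlt hprod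
      (u := fun n => (fun k => A * k * A⁻¹)^[n] k) ?_ ?_
    · intro n
      induction n with
      | zero => exact hk
      | succ n ih =>
        rw [Function.iterate_succ_apply']
        exact G.mul_mem (G.mul_mem hA ih) (G.inv_mem hA)
    · intro n
      induction n with
      | zero => simp
      | succ n ih =>
        simp only [Function.iterate_succ_apply']
        have h1 := conj_diagonal_entries hi.1 hi.2.1 ((fun k => A * k * A⁻¹)^[n] k)
        rw [inv_inv, hi.2.2] at h1
        obtain ⟨e1, e2, e3, e4⟩ := ih
        refine ⟨h1.1.trans e1, h1.2.1.trans ?_, h1.2.2.1.trans ?_, h1.2.2.2.trans e4⟩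
        · rw [e2, h0]; ring
        · rw [e3]; ring
  · refine eq_zero_of_discrete (G := G) (a := k 0 0) (d := k 1 1) hpos hlt hprod
      (u := fun n => (fun k => A⁻¹ * k * A)^[n] k) ?_ ?_
    · intro n
      induction n with
      | zero => exact hk
      | succ n ih =>
        rw [Function.iterate_succ_apply']
        exact G.mul_mem (G.mul_mem (G.inv_mem hA) ih) hA
    · intro n
      induction n with
      | zero => simp
      | succ n ih =>
        simp only [Function.iterate_succ_apply']
        have h1 := conj_diagonal_entries h10 h01 ((fun k => A⁻¹ * k * A)^[n] k)
        obtain ⟨e1, e2, e3, e4⟩ := ih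
        refine ⟨h1.1.trans e1, h1.2.1.trans ?_, h1.2.2.1.trans ?_, h1.2.2.2.trans e4⟩
        · rw [e2]; ring
        · rw [e3, h0]; ring

/-- Without cone points there are no elliptic elements. -/
theorem two_le_abs_trace {G : Subgroup SL(2, ℝ)} (hnc : NoConePoints G) {h : SL(2, ℝ)}
    (hh : h ∈ G) : 2 ≤ |h 0 0 + h 1 1| := by
  by_contra! hlt
  have hdet := det_eq h
  have hsq : (h 0 0 + h 1 1) ^ 2 < 4 := by
    have := sq_lt_sq' (by linarith [abs_nonneg (h 0 0 + h 1 1)]) hlt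
    rw [sq_abs] at this
    linarith
  have hc : h 1 0 ≠ 0 := by
    intro h0
    rw [h0] at hdet
    nlinarith [sq_nonneg (h 0 0 - h 1 1)]
  have hpos : 0 < √(4 - (h 0 0 + h 1 1) ^ 2) / (2 * |h 1 0|) :=
    div_pos (Real.sqrt_pos.2 (by linarith)) (by positivity)
  have hfix : h • (⟨⟨(h 0 0 - h 1 1) / (2 * h 1 0), _⟩, hpos⟩ : ℍ) =
      ⟨⟨(h 0 0 - h 1 1) / (2 * h 1 0), _⟩, hpos⟩ := by
    refine smul_eq_self_iff.2 ⟨?_, ?_⟩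
    · show 2 * h 1 0 * ((h 0 0 - h 1 1) / (2 * h 1 0)) = _
      field_simp
    · show h 1 0 * (((h 0 0 - h 1 1) / (2 * h 1 0)) ^ 2 +
        (√(4 - (h 0 0 + h 1 1) ^ 2) / (2 * |h 1 0|)) ^ 2) = _
      rw [div_pow _ (2 * |h 1 0|), Real.sq_sqrt (by linarith), mul_pow, sq_abs]
      field_simp
      linear_combination -4 * hdet
  have htriv := hnc h hh _ hfix
  have h1 := (smul_eq_self_iff.1 (htriv ⟨⟨0, 1⟩, one_pos⟩)).2
  have h2 := (smul_eq_self_iff.1 (htriv ⟨⟨0, 2⟩, two_pos⟩)).2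
  have h3 : h 1 0 * ((0 : ℝ) ^ 2 + 1 ^ 2) = - h 0 1 := h1
  have h4 : h 1 0 * ((0 : ℝ) ^ 2 + 2 ^ 2) = - h 0 1 := h2
  exact hc (by linarith)

/-- The distance from the imaginary axis to its image under a matrix is bounded below in terms of
the entries. -/
theorem le_cosh_dist_imAxis (h : SL(2, ℝ)) {z w : ℍ} (hz : z ∈ imAxis) (hw : w ∈ imAxis) :
    |h 0 0 * h 1 1| + |h 0 1 * h 1 0| ≤ Real.cosh (dist z (h • w)) := by
  have hz' : z.re = 0 := hz
  have hw' : w.re = 0 := hw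
  have hN := Complex.normSq_pos.2 (factor_ne_zero h w)
  have hNe : Complex.normSq (factor h w) = h 1 0 ^ 2 * w.im ^ 2 + h 1 1 ^ 2 := by
    simp only [Complex.normSq_apply, factor, Complex.add_re, Complex.add_im, Complex.mul_re,
      Complex.mul_im, Complex.ofReal_re, Complex.ofReal_im, coe_re, coe_im, hw']
    ring
  have hdet := det_eq h
  have him : (h • w : ℍ).im = w.im / Complex.normSq (factor h w) := by
    rw [← coe_im, coe_smul_eq, Complex.div_im, ← sub_div]
    congr 1
    simp only [factor, Complex.add_re, Complex.add_im, Complex.mul_re, Complex.mul_im,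
      Complex.ofReal_re, Complex.ofReal_im, coe_re, coe_im, hw']
    linear_combination w.im * hdet
  have hmod : (h • w : ℍ).re ^ 2 + (h • w : ℍ).im ^ 2 =
      (h 0 0 ^ 2 * w.im ^ 2 + h 0 1 ^ 2) / Complex.normSq (factor h w) := by
    have : (h • w : ℍ).re ^ 2 + (h • w : ℍ).im ^ 2 = Complex.normSq ((h • w : ℍ) : ℂ) := by
      rw [Complex.normSq_apply, coe_re, coe_im]; ring
    rw [this, coe_smul_eq, Complex.normSq_div]
    congr 1
    simp only [Complex.normSq_apply, Complex.add_re, Complex.add_im, Complex.mul_re,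
      Complex.mul_im, Complex.ofReal_re, Complex.ofReal_im, coe_re, coe_im, hw']
    ring
  have hcosh : Real.cosh (dist z (h • w)) = (h 0 0 ^ 2 * w.im ^ 2 + h 0 1 ^ 2 +
      z.im ^ 2 * (h 1 0 ^ 2 * w.im ^ 2 + h 1 1 ^ 2)) / (2 * z.im * w.im) := by
    rw [cosh_dist', hz', zero_sub, neg_sq,
      show (h • w : ℍ).re ^ 2 + z.im ^ 2 + (h • w : ℍ).im ^ 2 =
        ((h • w : ℍ).re ^ 2 + (h • w : ℍ).im ^ 2) + z.im ^ 2 by ring, hmod, him, ← hNe]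
    field_simp
  rw [hcosh, le_div_iff₀ (by positivity)]
  have h1 : 2 * |h 0 0 * h 1 1| * (z.im * w.im) ≤ h 0 0 ^ 2 * w.im ^ 2 + z.im ^ 2 * h 1 1 ^ 2 := by
    have := two_mul_le_add_sq (|h 0 0| * w.im) (z.im * |h 1 1|)
    rw [abs_mul]
    rw [mul_pow, mul_pow, sq_abs, sq_abs] at this
    linarith
  have h2 : 2 * |h 0 1 * h 1 0| * (z.im * w.im) ≤ h 0 1 ^ 2 + z.im ^ 2 * (h 1 0 ^ 2 * w.im ^ 2) := by
    have := two_mul_le_add_sq (|h 0 1|) (z.im * w.im * |h 1 0|)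
    rw [abs_mul]
    rw [mul_pow, sq_abs, sq_abs, mul_pow] at this
    linarith
  linarith

theorem cosh_two_mul_collar_width {l : ℝ} (hl : 0 < l) :
    Real.cosh (2 * Real.log (Real.cosh (l / 4) / Real.sinh (l / 4))) =
      1 + 2 / Real.sinh (l / 2) ^ 2 := by
  have hs : 0 < Real.sinh (l / 4) := Real.sinh_pos_iff.2 (by linarith)
  have hc := Real.cosh_pos (l / 4)
  have h1 : Real.sinh (l / 2) = 2 * Real.sinh (l / 4) * Real.cosh (l / 4) := by
    rw [← Real.sinh_two_mul]; congr 1; ring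
  have h2 := Real.cosh_sq (l / 4)
  rw [two_mul, Real.cosh_eq, neg_add, Real.exp_add, Real.exp_add, Real.exp_neg,
    Real.exp_log (div_pos hc hs), h1]
  field_simp
  rw [show Real.cosh (l / 4) ^ 4 = (Real.cosh (l / 4) ^ 2) ^ 2 by ring, h2]
  ring

/-- The collar theorem: without cone points, the collar around a simple closed geodesic of length `l`
is embedded up to the width `log coth (l / 4)`. For an element `h` of the group moving the axis to a
disjoint one, a generator `A` of the stabilizer of the axis, and `B = h A h⁻¹`, one of the products
`A B` and `A⁻¹ B` would be elliptic if the two axes were closer than twice this width. -/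
theorem collarEmbedded_of_noConePoints {G : Subgroup SL(2, ℝ)} [DiscreteTopology G] {l ρ : ℝ}
    (hγ : CoversSimpleClosedGeodesic G l) (hnc : NoConePoints G)
    (hρ : ρ < Real.log (Real.cosh (l / 4) / Real.sinh (l / 4))) : CollarEmbedded G l ρ := by
  intro h hh
  by_cases hpow : ActsAsPower l h
  · exact Or.inl hpow
  right
  have hl := hγ.length_pos
  have hoff : ∀ z ∈ imAxis, h • z ∉ imAxis :=
    (hγ.simple h hh).resolve_left fun h1 => hpow (hγ.stabilizer h hh h1)
  obtain ⟨A, hA, hAz⟩ := hγ.generator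
  obtain ⟨h10, h01, h00⟩ := entries_of_scaling hAz
  have hdetA := det_eq A
  rw [h10, h01, h00] at hdetA
  have hdet := det_eq h
  have hq : A 1 1 ^ 2 = Real.exp (-l) := by
    rw [Real.exp_neg]
    refine eq_inv_of_mul_eq_one_left ?_
    linear_combination hdetA
  have hK : (A 0 0 - A 1 1) ^ 2 = 4 * Real.sinh (l / 2) ^ 2 := by
    have e1 : Real.exp l = Real.exp (l / 2) ^ 2 := by
      rw [← Real.exp_nat_mul]; congr 1; push_cast; ring
    have e2 : Real.exp (-l) = Real.exp (-(l / 2)) ^ 2 := by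
      rw [← Real.exp_nat_mul]; congr 1; push_cast; ring
    have e3 : Real.exp (l / 2) * Real.exp (-(l / 2)) = 1 := by rw [← Real.exp_add]; simp
    rw [h00, Real.sinh_eq]
    have e4 : (Real.exp l * A 1 1 - A 1 1) ^ 2 = Real.exp l - 2 + Real.exp (-l) := by
      linear_combination (Real.exp l - 2) * hdetA + hq
    rw [e4, e1, e2]
    linear_combination 2 * e3
  have hKpos : 0 < (A 0 0 - A 1 1) ^ 2 := by rw [hK]; positivity
  -- the entries of the conjugate of the generator
  set B : SL(2, ℝ) := h * A * h⁻¹ with hB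
  have hBG : B ∈ G := G.mul_mem (G.mul_mem hh hA) (G.inv_mem hh)
  have hBent : B 0 0 = h 0 0 * h 1 1 * A 0 0 - h 0 1 * h 1 0 * A 1 1 ∧
      B 0 1 = h 0 0 * h 0 1 * (A 1 1 - A 0 0) ∧ B 1 0 = h 1 0 * h 1 1 * (A 0 0 - A 1 1) ∧
      B 1 1 = h 0 0 * h 1 1 * A 1 1 - h 0 1 * h 1 0 * A 0 0 := by
    simp only [hB, Matrix.SpecialLinearGroup.coe_mul, Matrix.SpecialLinearGroup.coe_inv,
      Matrix.adjugate_fin_two, Matrix.mul_apply, Fin.sum_univ_two, h10, h01, Matrix.of_apply,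
      Matrix.cons_val', Matrix.cons_val_zero, Matrix.cons_val_one, Matrix.cons_val_fin_one]
    refine ⟨?_, ?_, ?_, ?_⟩ <;> ring
  obtain ⟨hB00, hB01, hB10, hB11⟩ := hBent
  have hne : A 0 0 - A 1 1 ≠ 0 := fun h0 => by rw [h0] at hKpos; norm_num at hKpos
  -- by discreteness, the axis and its translate do not have exactly one endpoint in common
  have hprod : 0 < h 0 0 * h 1 0 * (h 0 1 * h 1 1) := by
    refine lt_of_le_of_ne (entries_prod_nonneg hoff) fun h0 => ?_
    have h1 := offdiagonal_eq_zero_of_discrete hA h10 h01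
      (by rw [hq, ← Real.exp_zero]; exact Real.exp_lt_exp.2 (by linarith)) hBG
      (by rw [hB01, hB10]; linear_combination (A 0 0 - A 1 1) ^ 2 * h0)
    rw [hB01, hB10] at h1
    have h2 : h 0 0 * h 0 1 = 0 :=
      (mul_eq_zero.1 h1.1).resolve_right (by rw [← neg_sub]; exact neg_ne_zero.2 hne)
    have h3 : h 1 0 * h 1 1 = 0 := (mul_eq_zero.1 h1.2).resolve_right hne
    have hmem : (⟨⟨0, 1⟩, one_pos⟩ : ℍ) ∈ imAxis := rfl
    refine hoff _ hmem ((mem_imAxis_smul_iff hmem).2 ?_)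
    have h4 : h 0 0 * h 1 0 = 0 := by
      linear_combination -(h 0 0 * h 1 0) * hdet + h 0 0 ^ 2 * h3 - h 1 0 ^ 2 * h2
    have h5 : h 0 1 * h 1 1 = 0 := by
      linear_combination -(h 0 1 * h 1 1) * hdet + h 1 1 ^ 2 * h2 - h 0 1 ^ 2 * h3
    rw [h4, h5]; ring
  have hAB : (A * B) 0 0 + (A * B) 1 1 = 2 + h 0 0 * h 1 1 * (A 0 0 - A 1 1) ^ 2 := by
    simp only [Matrix.SpecialLinearGroup.coe_mul, Matrix.mul_apply, Fin.sum_univ_two, h10, h01]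
    rw [hB00, hB11, h00]
    linear_combination 2 * (h 0 0 * h 1 1 - h 0 1 * h 1 0) * hdetA + 2 * hdet
  have hAB' : (A⁻¹ * B) 0 0 + (A⁻¹ * B) 1 1 = 2 - h 0 1 * h 1 0 * (A 0 0 - A 1 1) ^ 2 := by
    simp only [Matrix.SpecialLinearGroup.coe_mul, Matrix.SpecialLinearGroup.coe_inv,
      Matrix.adjugate_fin_two, Matrix.mul_apply, Fin.sum_univ_two, h10, h01, Matrix.of_apply,
      Matrix.cons_val', Matrix.cons_val_zero, Matrix.cons_val_one, Matrix.cons_val_fin_one]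
    rw [hB00, hB11, h00]
    linear_combination 2 * (h 0 0 * h 1 1 - h 0 1 * h 1 0) * hdetA + 2 * hdet
  have htr := two_le_abs_trace hnc (G.mul_mem hA hBG)
  have htr' := two_le_abs_trace hnc (G.mul_mem (G.inv_mem hA) hBG)
  rw [hAB] at htr
  rw [hAB'] at htr'
  -- since `h 0 0 * h 1 1` and `h 0 1 * h 1 0` have the same sign and differ by `1`, one of the traces
  -- is less than `2`, hence at most `-2`
  have hlow : 1 + 2 / Real.sinh (l / 2) ^ 2 ≤ |h 0 0 * h 1 1| + |h 0 1 * h 1 0| := by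
    have hdiv : ∀ X : ℝ, 4 ≤ X * (A 0 0 - A 1 1) ^ 2 → 1 / Real.sinh (l / 2) ^ 2 ≤ X := by
      intro X hX
      rw [hK] at hX
      rw [div_le_iff₀ (by positivity)]
      linarith
    have e : 2 / Real.sinh (l / 2) ^ 2 = 1 / Real.sinh (l / 2) ^ 2 + 1 / Real.sinh (l / 2) ^ 2 := by
      ring
    rcases lt_or_ge 0 (h 0 1 * h 1 0) with hpos | hneg
    · have h1 : 0 < h 0 1 * h 1 0 * (A 0 0 - A 1 1) ^ 2 := mul_pos hpos hKpos
      rcases le_abs.1 htr' with h2 | h2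
      · linarith
      · have h3 := hdiv (h 0 1 * h 1 0) (by linarith)
        rw [abs_of_pos hpos, abs_of_pos (by linarith)]
        linarith
    · have h0 : h 0 0 * h 1 1 < 0 := by
        by_contra! h1
        nlinarith [mul_nonneg h1 (neg_nonneg.2 hneg)]
      have h1 : 0 < -(h 0 0 * h 1 1) * (A 0 0 - A 1 1) ^ 2 := mul_pos (neg_pos.2 h0) hKpos
      rcases le_abs.1 htr with h2 | h2
      · linarith
      · have h3 := hdiv (-(h 0 0 * h 1 1)) (by linarith)
        rw [abs_of_neg h0, abs_of_nonpos hneg]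
        linarith
  intro z hz hhz
  have hnonempty : imAxis.Nonempty := ⟨⟨⟨0, 1⟩, one_pos⟩, rfl⟩
  obtain ⟨p, hp, hzp⟩ := (Metric.infDist_lt_iff hnonempty).1 hz
  obtain ⟨p', hp', hzp'⟩ := (Metric.infDist_lt_iff hnonempty).1 hhz
  have h1 : dist p' (h • p) < 2 * ρ := by
    have h2 := dist_triangle_left p' (h • p) (h • z)
    rw [dist_smul] at h2
    linarith
  have h2 := le_cosh_dist_imAxis h hp' hp
  have h3 : Real.cosh (dist p' (h • p)) <
      Real.cosh (2 * Real.log (Real.cosh (l / 4) / Real.sinh (l / 4))) := by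
    rw [Real.cosh_lt_cosh, abs_of_nonneg dist_nonneg]
    exact lt_of_lt_of_le (by linarith) (le_abs_self _)
  rw [cosh_two_mul_collar_width hl] at h3
  linarith

/-! ### Distance to the imaginary axis -/

theorem norm_sq_eq (z : ℍ) : ‖(z : ℂ)‖ ^ 2 = z.re ^ 2 + z.im ^ 2 := by
  rw [← Complex.normSq_eq_norm_sq, Complex.normSq_apply, coe_re, coe_im]; ring

/-- The distance to the imaginary axis only depends on the ratio of the coordinates. -/
theorem sinh_infDist_imAxis (z : ℍ) :
    Real.sinh (Metric.infDist z imAxis) = |z.re| / z.im := by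
  have hz := z.im_pos
  have hn : 0 < ‖(z : ℂ)‖ := norm_pos_iff.2 z.ne_zero
  -- the nearest point of the axis has the same modulus as `z`
  set p : ℍ := ⟨⟨0, ‖(z : ℂ)‖⟩, hn⟩
  have hpim : p.im = ‖(z : ℂ)‖ := rfl
  have hcosh : ∀ q ∈ imAxis, Real.cosh (dist z q) =
      (‖(z : ℂ)‖ ^ 2 + q.im ^ 2) / (2 * z.im * q.im) := by
    intro q hq
    have hq' : q.re = 0 := hq
    rw [cosh_dist', hq', sub_zero, norm_sq_eq]
  have hpmem : p ∈ imAxis := rfl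
  have hpc : Real.cosh (dist z p) = ‖(z : ℂ)‖ / z.im := by
    rw [hcosh p hpmem, hpim]
    field_simp
    ring
  have hinf : Metric.infDist z imAxis = dist z p := by
    refine le_antisymm (Metric.infDist_le_dist_of_mem hpmem)
      ((Metric.le_infDist ⟨p, hpmem⟩).2 fun q hq => ?_)
    rw [← abs_of_nonneg (dist_nonneg (x := z) (y := p)),
      ← abs_of_nonneg (dist_nonneg (x := z) (y := q)), ← Real.cosh_le_cosh, hpc, hcosh q hq]
    rw [div_le_div_iff₀ hz (by positivity)]
    nlinarith [mul_nonneg (sq_nonneg (‖(z : ℂ)‖ - q.im)) hz.le]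
  have hs : 0 ≤ Real.sinh (dist z p) := Real.sinh_nonneg_iff.2 dist_nonneg
  rw [hinf, ← sq_eq_sq₀ hs (by positivity), Real.sinh_sq, hpc, div_pow, div_pow, sq_abs, norm_sq_eq]
  field_simp
  ring

theorem mem_boundaryLine_iff {r : ℝ} (hr : 0 < r) {z : ℍ} :
    z ∈ boundaryLine r ↔ z.re = Real.sinh r * z.im := by
  have hz := z.im_pos
  show Metric.infDist z imAxis = r ∧ 0 < z.re ↔ _
  rw [← Real.sinh_inj, sinh_infDist_imAxis, div_eq_iff hz.ne']
  constructor
  · rintro ⟨h1, h2⟩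
    rwa [abs_of_pos h2] at h1
  · intro h
    have : 0 < z.re := by rw [h]; positivity
    exact ⟨by rwa [abs_of_pos this], this⟩

theorem mem_axisNhd_iff {ρ : ℝ} {z : ℍ} :
    z ∈ axisNhd ρ ↔ |z.re| / z.im < Real.sinh ρ := by
  rw [← sinh_infDist_imAxis, Real.sinh_lt_sinh]
  rfl

theorem norm_of_mem_boundaryLine {r : ℝ} {z : ℍ} (h : z.re = Real.sinh r * z.im) :
    ‖(z : ℂ)‖ = Real.cosh r * z.im := by
  rw [← sq_eq_sq₀ (norm_nonneg _) (by positivity), norm_sq_eq, h, mul_pow, mul_pow, Real.cosh_sq]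
  ring

/-! ### The time at which a geodesic enters the collar -/

/-- The time at which the geodesic from `k + 1` to `k - 1`, timed from its highest point, first
meets the boundary line of the `r`-collar. -/
def hitTime (r k : ℝ) : ℝ :=
  Real.log ((k + 1) / (Real.sinh r + √(Real.cosh r ^ 2 - k ^ 2)))

/-- The modulus of the point in which the geodesic from `k + 1` to `k - 1` first meets the boundary
line of the `r`-collar. -/
def hitModulus (r k : ℝ) : ℝ := Real.cosh r / Real.cosh (hitTime r k)

theorem hitModulus_pos (r k : ℝ) : 0 < hitModulus r k :=
  div_pos (Real.cosh_pos _) (Real.cosh_pos _)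

theorem measurable_hitTime (r : ℝ) : Measurable (hitTime r) := by
  unfold hitTime
  fun_prop

theorem measurable_hitModulus (r : ℝ) : Measurable (hitModulus r) := by
  have := measurable_hitTime r
  unfold hitModulus
  exact measurable_const.div (Real.continuous_cosh.measurable.comp this)

section Hit

variable {r k : ℝ}

/-- In terms of `exp t`, the equation for a point of intersection with the boundary line is
quadratic, and this is its factorization. -/
theorem hit_factorization (hk : |k| ≤ Real.cosh r) (t : ℝ) :
    (k + 1 - (Real.sinh r + √(Real.cosh r ^ 2 - k ^ 2)) * Real.exp t) *
      (k + 1 - (Real.sinh r - √(Real.cosh r ^ 2 - k ^ 2)) * Real.exp t) =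
    2 * (k + 1) * Real.exp t * (k * Real.cosh t - Real.sinh t - Real.sinh r) := by
  have hQ : √(Real.cosh r ^ 2 - k ^ 2) ^ 2 = Real.cosh r ^ 2 - k ^ 2 := by
    refine Real.sq_sqrt (sub_nonneg.2 ?_)
    rw [← sq_abs k]
    exact pow_le_pow_left₀ (abs_nonneg k) hk 2
  have he : Real.exp t * Real.exp (-t) = 1 := by rw [← Real.exp_add, add_neg_cancel, Real.exp_zero]
  have hc := Real.cosh_sq r
  rw [Real.cosh_eq t, Real.sinh_eq t]
  linear_combination (-Real.exp t ^ 2) * hQ - Real.exp t ^ 2 * hc - (k + 1) ^ 2 * he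

theorem abs_le_cosh_of_hit {t : ℝ} (h : k * Real.cosh t - Real.sinh t = Real.sinh r) :
    |k| ≤ Real.cosh r := by
  have hc := Real.cosh_pos t
  have h1 : (k * Real.cosh t) ^ 2 ≤ (Real.cosh r * Real.cosh t) ^ 2 := by
    rw [show k * Real.cosh t = Real.sinh r + Real.sinh t by linarith, mul_pow, Real.cosh_sq,
      Real.cosh_sq]
    nlinarith [sq_nonneg (Real.sinh r * Real.sinh t - 1)]
  have h2 := abs_le_of_sq_le_sq h1 (by positivity)
  rw [abs_mul, abs_of_pos hc] at h2
  exact le_of_mul_le_mul_right h2 hc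

variable (hr : 0 < r) (hk : -1 < k) (hkr : k ≤ Real.cosh r)
include hr hk hkr

omit hr in
theorem abs_le_cosh : |k| ≤ Real.cosh r :=
  abs_le.2 ⟨by linarith [Real.one_le_cosh r], hkr⟩

omit hkr in
theorem exp_hitTime :
    (Real.sinh r + √(Real.cosh r ^ 2 - k ^ 2)) * Real.exp (hitTime r k) = k + 1 := by
  have hs : 0 < Real.sinh r := Real.sinh_pos_iff.2 hr
  have hD : 0 < Real.sinh r + √(Real.cosh r ^ 2 - k ^ 2) :=
    add_pos_of_pos_of_nonneg hs (Real.sqrt_nonneg _)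
  rw [hitTime, Real.exp_log (div_pos (by linarith) hD), mul_div_cancel₀ _ hD.ne']

theorem hit_at_hitTime :
    k * Real.cosh (hitTime r k) - Real.sinh (hitTime r k) = Real.sinh r := by
  have h1 := hit_factorization (abs_le_cosh hk hkr) (hitTime r k)
  rw [exp_hitTime hr hk, sub_self, zero_mul] at h1
  have h2 : 2 * (k + 1) * Real.exp (hitTime r k) ≠ 0 :=
    mul_ne_zero (by linarith) (Real.exp_pos _).ne'
  linarith [(mul_eq_zero.1 h1.symm).resolve_left h2]

theorem no_hit_before {t : ℝ} (ht : t < hitTime r k) :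
    k * Real.cosh t - Real.sinh t ≠ Real.sinh r := by
  intro h0
  have hs : 0 < Real.sinh r := Real.sinh_pos_iff.2 hr
  have hQ := Real.sqrt_nonneg (Real.cosh r ^ 2 - k ^ 2)
  have h1 := hit_factorization (abs_le_cosh hk hkr) t
  rw [h0, sub_self, mul_zero] at h1
  have he := Real.exp_pos t
  have h2 := exp_hitTime hr hk
  have h3 : (Real.sinh r + √(Real.cosh r ^ 2 - k ^ 2)) * Real.exp t < k + 1 := by
    rw [← h2]
    exact mul_lt_mul_of_pos_left (Real.exp_lt_exp.2 ht) (by linarith)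
  have h4 : (Real.sinh r - √(Real.cosh r ^ 2 - k ^ 2)) * Real.exp t ≤
      (Real.sinh r + √(Real.cosh r ^ 2 - k ^ 2)) * Real.exp t :=
    mul_le_mul_of_nonneg_right (by linarith) he.le
  rcases mul_eq_zero.1 h1 with h5 | h5 <;> linarith

/-- For a time less than `ε` after entering the `r`-collar, a geodesic stays in the
`(r + ε)`-collar. -/
theorem abs_lt_sinh_of_near_hitTime {ε t : ℝ} (ht : hitTime r k ≤ t) (htε : t < hitTime r k + ε) :
    |k * Real.cosh t - Real.sinh t| < Real.sinh (r + ε) := by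
  set t₀ := hitTime r k
  obtain ⟨δ, rfl⟩ : ∃ δ, t = t₀ + δ := ⟨t - t₀, by ring⟩
  have hδ : 0 ≤ δ := by linarith
  have h1 : k * Real.cosh t₀ - Real.sinh t₀ = Real.sinh r := hit_at_hitTime hr hk hkr
  have hs : 0 < Real.sinh r := Real.sinh_pos_iff.2 hr
  -- the derivative of the ratio of the coordinates at the time of entrance
  set m := k * Real.sinh t₀ - Real.cosh t₀ with hm
  have hmsq : m ^ 2 ≤ Real.cosh r ^ 2 := by
    have h2 := Real.cosh_sq t₀
    have h3 := Real.cosh_sq r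
    have h4 : m ^ 2 = (k * Real.cosh t₀ - Real.sinh t₀) ^ 2 - (k ^ 2 - 1) := by
      rw [hm]; linear_combination (1 - k ^ 2) * h2
    rw [h4, h1, h3]
    nlinarith [sq_nonneg k]
  have hmabs := abs_le_of_sq_le_sq hmsq (Real.cosh_pos r).le
  have h5 : k * Real.cosh (t₀ + δ) - Real.sinh (t₀ + δ) =
      Real.sinh r * Real.cosh δ + m * Real.sinh δ := by
    rw [Real.cosh_add, Real.sinh_add, ← h1, hm]; ring
  have hsδ : 0 ≤ Real.sinh δ := Real.sinh_nonneg_iff.2 hδ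
  calc |k * Real.cosh (t₀ + δ) - Real.sinh (t₀ + δ)|
      ≤ |Real.sinh r * Real.cosh δ| + |m * Real.sinh δ| := by rw [h5]; exact abs_add_le _ _
    _ = Real.sinh r * Real.cosh δ + |m| * Real.sinh δ := by
        rw [abs_of_pos (mul_pos hs (Real.cosh_pos δ)), abs_mul, abs_of_nonneg hsδ]
    _ ≤ Real.sinh r * Real.cosh δ + Real.cosh r * Real.sinh δ := by
        gcongr
    _ = Real.sinh (r + δ) := (Real.sinh_add r δ).symm
    _ < Real.sinh (r + ε) := Real.sinh_lt_sinh.2 (by linarith)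

end Hit

/-! ### Leftward geodesics -/

/-- The horizontal unit vector at `w` which points to the left. -/
def leftward (w : ℍ) : UnitTangent := ⟨w, Circle.exp Real.pi⟩

theorem re_flow_leftward (t : ℝ) (w : ℍ) :
    (flow t (leftward w)).base.re = w.re - w.im * Real.tanh t := by
  refine (re_base_flow_horizontal (e := -1) (by norm_num) coe_exp_pi t w).trans ?_
  ring

theorem im_flow_leftward (t : ℝ) (w : ℍ) :
    (flow t (leftward w)).base.im = w.im / Real.cosh t :=
  im_base_flow_horizontal (e := -1) (by norm_num) coe_exp_pi t w

theorem dir_flow_leftward (t : ℝ) (w : ℍ) :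
    ((flow t (leftward w)).dir : ℂ) = ⟨-1 / Real.cosh t, -(Real.sinh t / Real.cosh t)⟩ :=
  dir_flow_horizontal (e := -1) (by norm_num) coe_exp_pi t w

/-- The ratio of the coordinates of the point at time `t` on a leftward geodesic. -/
theorem re_div_im_flow_leftward (t : ℝ) (w : ℍ) :
    (flow t (leftward w)).base.re / (flow t (leftward w)).base.im =
      w.re / w.im * Real.cosh t - Real.sinh t := by
  rw [re_flow_leftward, im_flow_leftward, Real.tanh_eq_sinh_div_cosh]
  field_simp

theorem flow_leftward_mem_boundaryLine_iff {r : ℝ} (hr : 0 < r) (t : ℝ) (w : ℍ) :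
    (flow t (leftward w)).base ∈ boundaryLine r ↔
      w.re / w.im * Real.cosh t - Real.sinh t = Real.sinh r := by
  rw [mem_boundaryLine_iff hr, ← re_div_im_flow_leftward, div_eq_iff (UpperHalfPlane.im_ne_zero _)]

/-- The time at which the geodesic of `v`, if it goes to the left, has the direction of `v`; the time
is counted from the highest point. If `v` does not point to the left, the value has no meaning. -/
def leftTime (v : UnitTangent) : ℝ := Real.arsinh ((v.dir : ℂ).im / (v.dir : ℂ).re)

/-- The highest point of the geodesic of `v`, if `v` points to the left. -/
def leftTop (v : UnitTangent) : ℍ := (flow (-leftTime v) v).base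

theorem leftTime_of_dir {t : ℝ} {v : UnitTangent}
    (hv : (v.dir : ℂ) = ⟨-1 / Real.cosh t, -(Real.sinh t / Real.cosh t)⟩) : leftTime v = t := by
  rw [leftTime, hv]
  show Real.arsinh (-(Real.sinh t / Real.cosh t) / (-1 / Real.cosh t)) = t
  rw [show -(Real.sinh t / Real.cosh t) / (-1 / Real.cosh t) = Real.sinh t by field_simp,
    Real.arsinh_sinh]

theorem leftTime_flow (t : ℝ) (w : ℍ) : leftTime (flow t (leftward w)) = t :=
  leftTime_of_dir (dir_flow_leftward t w)

theorem leftTop_flow (t : ℝ) (w : ℍ) : leftTop (flow t (leftward w)) = w := by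
  rw [leftTop, leftTime_flow, flow_neg_flow]
  rfl

theorem measurable_leftTime : Measurable leftTime := by
  have h : Measurable fun v : UnitTangent => (v.dir : ℂ) :=
    (continuous_induced_dom.comp continuous_dir).measurable
  exact Real.continuous_arsinh.measurable.comp
    ((Complex.measurable_im.comp h).div (Complex.measurable_re.comp h))

theorem measurable_leftTop : Measurable leftTop := by
  have h : Measurable fun v : UnitTangent => flow (-leftTime v) v :=
    Measurable.comp (g := fun p : ℝ × UnitTangent => flow p.1 p.2) (f := fun v => (-leftTime v, v))
      continuous_flow.measurable (measurable_leftTime.neg.prodMk measurable_id)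
  exact continuous_base.measurable.comp h

/-- The vectors with coordinates `(w, t)` in a given set: `w` is the highest point of the leftward
geodesic and `t` the time. -/
def leftSet (S : Set (ℍ × ℝ)) : Set UnitTangent := (fun p => flow p.2 (leftward p.1)) '' S

theorem flow_leftward_mem_leftSet {S : Set (ℍ × ℝ)} {t : ℝ} {w : ℍ} :
    flow t (leftward w) ∈ leftSet S ↔ (w, t) ∈ S := by
  constructor
  · rintro ⟨⟨w', t'⟩, h, heq⟩
    have h1 := congrArg leftTime heq
    have h2 := congrArg leftTop heq
    simp only [leftTime_flow, leftTop_flow] at h1 h2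
    rwa [← h1, ← h2]
  · exact fun h => ⟨_, h, rfl⟩

theorem continuous_leftward : Continuous leftward :=
  continuous_mk_iff.2 ⟨continuous_id, continuous_const⟩

theorem measurableSet_leftSet {S : Set (ℍ × ℝ)} (hS : MeasurableSet S) :
    MeasurableSet (leftSet S) := by
  have h1 : Measurable fun v => flow (leftTime v) (leftward (leftTop v)) :=
    Measurable.comp (g := fun p : ℝ × UnitTangent => flow p.1 p.2)
      (f := fun v => (leftTime v, leftward (leftTop v))) continuous_flow.measurable
      (measurable_leftTime.prodMk (continuous_leftward.measurable.comp measurable_leftTop))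
  have : leftSet S = {v | v = flow (leftTime v) (leftward (leftTop v))} ∩
      (fun v => (leftTop v, leftTime v)) ⁻¹' S := by
    ext v
    constructor
    · rintro ⟨⟨w, t⟩, h, rfl⟩
      refine ⟨?_, ?_⟩
      · simp only [mem_ofPred_eq, leftTime_flow, leftTop_flow]
      · simpa only [mem_preimage, leftTime_flow, leftTop_flow] using h
    · rintro ⟨h1, h2⟩
      exact ⟨_, h2, h1.symm⟩
  rw [this]
  exact (measurableSet_eq_fun measurable_id h1).inter
    ((measurable_leftTop.prodMk measurable_leftTime) hS)

theorem liouvilleUpper_leftSet {S : Set (ℍ × ℝ)} (hS : MeasurableSet S) :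
    liouvilleUpper (leftSet S) = ((volume : Measure ℍ).prod (volume : Measure ℝ)) S := by
  have h1 : ∀ t, {w : ℍ | flow t ⟨w, 1⟩ ∈ leftSet S} = ∅ := by
    intro t
    refine eq_empty_of_forall_notMem fun w hw => ?_
    obtain ⟨⟨w', t'⟩, -, heq⟩ := hw
    have h2 := congrArg (fun v : UnitTangent => (v.dir : ℂ).re) heq
    simp only [dir_flow_leftward, dir_flow_horizontal (e := 1) (by norm_num)
      (show ((1 : Circle) : ℂ) = ((1 : ℝ) : ℂ) by simp)] at h2
    have h3 : -1 / Real.cosh t' < 0 := div_neg_of_neg_of_pos (by norm_num) (Real.cosh_pos _)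
    have h4 : 0 < 1 / Real.cosh t := div_pos one_pos (Real.cosh_pos _)
    linarith
  have h2 : ∀ t, {w : ℍ | flow t ⟨w, Circle.exp Real.pi⟩ ∈ leftSet S} =
      (fun w => (w, t)) ⁻¹' S := by
    intro t
    ext w
    exact flow_leftward_mem_leftSet
  rw [liouvilleUpper_eq_lintegral_flow (measurableSet_leftSet hS), Measure.prod_apply_symm hS]
  simp only [h1, h2, measure_empty, lintegral_zero, zero_add]

/-! ### The area of a family of highest points -/

/-- Hyperbolic area in the coordinates `(k, σ)` of the point `exp σ * (k + i)`. -/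
theorem volume_eq_prod {S : Set ℍ} (hS : MeasurableSet S) :
    volume S = (volume : Measure (ℝ × ℝ))
      {p | (⟨⟨Real.exp p.2 * p.1, Real.exp p.2⟩, Real.exp_pos _⟩ : ℍ) ∈ S} := by
  set g : ℝ → ℝ≥0∞ := fun y => (((1 / ‖y‖₊) ^ 2 : NNReal) : ℝ≥0∞) with hg
  have hgm : Measurable g := by fun_prop
  set T : Set ℂ := ((↑) : ℍ → ℂ) '' S with hT
  have hTm : MeasurableSet T := measurableEmbedding_coe.measurableSet_image.2 hS
  have hTpos : ∀ z ∈ T, 0 < z.im := by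
    rintro _ ⟨w, -, rfl⟩; exact w.im_pos
  have hslice : ∀ y, Measurable fun x : ℝ => (⟨x, y⟩ : ℂ) := fun y =>
    Complex.measurableEquivRealProd.symm.measurable.comp measurable_prodMk_right
  have e1 : volume S = ∫⁻ y : ℝ, g y * volume {x : ℝ | (⟨x, y⟩ : ℂ) ∈ T} := by
    have hm : Measurable (T.indicator fun z => g z.im) :=
      (hgm.comp Complex.measurable_im).indicator hTm
    rw [volume_eq_lintegral, ← lintegral_indicator hTm]
    refine (Complex.volume_preserving_equiv_real_prod.symm.lintegral_comp hm).symm.trans ?_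
    rw [Measure.volume_eq_prod]
    refine (lintegral_prod_symm' _
      (hm.comp Complex.measurableEquivRealProd.symm.measurable)).trans ?_
    congr 1
    ext y
    have hm : MeasurableSet {x : ℝ | (⟨x, y⟩ : ℂ) ∈ T} := hslice y hTm
    rw [← setLIntegral_const, ← lintegral_indicator hm]
    rfl
  have e2 : (∫⁻ y : ℝ, g y * volume {x : ℝ | (⟨x, y⟩ : ℂ) ∈ T}) =
      ∫⁻ y in Ioi 0, g y * volume {x : ℝ | (⟨x, y⟩ : ℂ) ∈ T} := by
    rw [← lintegral_indicator measurableSet_Ioi]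
    congr 1
    ext y
    by_cases hy : y ∈ Ioi (0 : ℝ)
    · rw [indicator_of_mem hy]
    · rw [indicator_of_notMem hy]
      have : {x : ℝ | (⟨x, y⟩ : ℂ) ∈ T} = ∅ :=
        eq_empty_of_forall_notMem fun x hx => hy (hTpos _ hx)
      rw [this, measure_empty, mul_zero]
  have e3 := lintegral_image_eq_lintegral_abs_deriv_mul MeasurableSet.univ
    (fun σ _ => (Real.hasDerivAt_exp σ).hasDerivWithinAt) Real.exp_injective.injOn
    (fun y => g y * volume {x : ℝ | (⟨x, y⟩ : ℂ) ∈ T})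
  rw [image_univ, Real.range_exp, setLIntegral_univ] at e3
  rw [e1, e2, e3, Measure.volume_eq_prod, Measure.prod_apply_symm]
  · congr 1
    ext σ
    have hσ := Real.exp_pos σ
    have h1 : (fun k => (k, σ)) ⁻¹' {p : ℝ × ℝ |
        (⟨⟨Real.exp p.2 * p.1, Real.exp p.2⟩, Real.exp_pos _⟩ : ℍ) ∈ S} =
        (fun k => Real.exp σ * k) ⁻¹' {x : ℝ | (⟨x, Real.exp σ⟩ : ℂ) ∈ T} := by
      ext k
      simp only [mem_preimage, mem_ofPred_eq, hT]
      constructor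
      · exact fun h => ⟨_, h, rfl⟩
      · rintro ⟨w, hw, heq⟩
        have hw' : (⟨⟨Real.exp σ * k, Real.exp σ⟩, hσ⟩ : ℍ) = w := UpperHalfPlane.ext heq.symm
        exact hw' ▸ hw
    rw [h1, Real.volume_preimage_mul_left hσ.ne', ← mul_assoc]
    congr 1
    rw [hg, abs_of_pos hσ, abs_of_pos (inv_pos.2 hσ)]
    simp only [ENNReal.ofReal]
    rw [← ENNReal.coe_mul]
    congr 1
    apply NNReal.eq
    simp only [NNReal.coe_mul, NNReal.coe_pow, NNReal.coe_div, NNReal.coe_one, coe_nnnorm,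
      Real.norm_eq_abs, Real.coe_toNNReal', abs_of_pos hσ, max_eq_left hσ.le,
      max_eq_left (inv_pos.2 hσ).le]
    field_simp
  · have hc : Continuous fun p : ℝ × ℝ =>
        (⟨⟨Real.exp p.2 * p.1, Real.exp p.2⟩, Real.exp_pos _⟩ : ℍ) := by
      refine Continuous.upperHalfPlaneMk
        (f := fun p : ℝ × ℝ => (⟨Real.exp p.2 * p.1, Real.exp p.2⟩ : ℂ)) ?_ _
      have h1 : (fun p : ℝ × ℝ => (⟨Real.exp p.2 * p.1, Real.exp p.2⟩ : ℂ)) = fun p =>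
          ((Real.exp p.2 * p.1 : ℝ) : ℂ) + ((Real.exp p.2 : ℝ) : ℂ) * Complex.I := by
        ext p; exact Complex.mk_eq_add_mul_I _ _
      rw [h1]
      fun_prop
    exact hc.measurable hS

/-- In the coordinates `(k, σ)` of `volume_eq_prod`, the second condition requires that
`exp σ * f k ∈ J`, and the measure of the set of these `σ` is independent of `k`. -/
theorem volume_shape_and_scale {I J : Set ℝ} (hI : MeasurableSet I) (hJ : MeasurableSet J)
    {f : ℝ → ℝ} (hf : Measurable f) (hf0 : ∀ k, 0 < f k) {c : ℝ≥0∞}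
    (hc : ∀ a, 0 < a → volume {σ | Real.exp σ * a ∈ J} = c) :
    volume {w : ℍ | w.re / w.im ∈ I ∧ w.im * f (w.re / w.im) ∈ J} = volume I * c := by
  have hre : Measurable fun w : ℍ => w.re := UpperHalfPlane.continuous_re.measurable
  have him : Measurable fun w : ℍ => w.im := UpperHalfPlane.continuous_im.measurable
  have hS : MeasurableSet {w : ℍ | w.re / w.im ∈ I ∧ w.im * f (w.re / w.im) ∈ J} :=
    ((hre.div him) hI).inter ((him.mul (hf.comp (hre.div him))) hJ)
  have hp : {p : ℝ × ℝ | (⟨⟨Real.exp p.2 * p.1, Real.exp p.2⟩, Real.exp_pos _⟩ : ℍ) ∈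
      {w : ℍ | w.re / w.im ∈ I ∧ w.im * f (w.re / w.im) ∈ J}} =
      {p : ℝ × ℝ | p.1 ∈ I ∧ Real.exp p.2 * f p.1 ∈ J} := by
    ext p
    show Real.exp p.2 * p.1 / Real.exp p.2 ∈ I ∧
      Real.exp p.2 * f (Real.exp p.2 * p.1 / Real.exp p.2) ∈ J ↔ _
    rw [mul_div_cancel_left₀ _ (Real.exp_pos _).ne']
    rfl
  have hm : MeasurableSet {p : ℝ × ℝ | p.1 ∈ I ∧ Real.exp p.2 * f p.1 ∈ J} :=
    (measurable_fst hI).inter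
      (((Real.measurable_exp.comp measurable_snd).mul (hf.comp measurable_fst)) hJ)
  rw [volume_eq_prod hS, hp, Measure.volume_eq_prod, Measure.prod_apply hm, mul_comm,
    ← setLIntegral_const, ← lintegral_indicator hI]
  congr 1
  ext k
  by_cases hk : k ∈ I
  · rw [indicator_of_mem hk, ← hc (f k) (hf0 k)]
    congr 1
    ext σ
    exact and_iff_right hk
  · rw [indicator_of_notMem hk]
    have : Prod.mk k ⁻¹' {p : ℝ × ℝ | p.1 ∈ I ∧ Real.exp p.2 * f p.1 ∈ J} = ∅ :=
      eq_empty_of_forall_notMem fun σ hσ => hk hσ.1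
    rw [this, measure_empty]

theorem volume_exp_mul_mem_Icc (l : ℝ) {a : ℝ} (ha : 0 < a) :
    volume {σ | Real.exp σ * a ∈ Icc 1 (Real.exp l)} = ENNReal.ofReal l := by
  have : {σ | Real.exp σ * a ∈ Icc 1 (Real.exp l)} = Icc (-Real.log a) (l - Real.log a) := by
    ext σ
    have h : Real.exp σ * a = Real.exp (σ + Real.log a) := by rw [Real.exp_add, Real.exp_log ha]
    rw [mem_ofPred_eq, h, mem_Icc, Real.one_le_exp_iff, Real.exp_le_exp, mem_Icc,
      neg_le_iff_add_nonneg, le_sub_iff_add_le]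
  rw [this, Real.volume_Icc]
  congr 1
  ring

theorem volume_exp_mul_mem_Ico (l : ℝ) {a : ℝ} (ha : 0 < a) :
    volume {σ | Real.exp σ * a ∈ Ico 1 (Real.exp l)} = ENNReal.ofReal l := by
  have : {σ | Real.exp σ * a ∈ Ico 1 (Real.exp l)} = Ico (-Real.log a) (l - Real.log a) := by
    ext σ
    have h : Real.exp σ * a = Real.exp (σ + Real.log a) := by rw [Real.exp_add, Real.exp_log ha]
    rw [mem_ofPred_eq, h, mem_Ico, Real.one_le_exp_iff, Real.exp_lt_exp, mem_Ico,
      neg_le_iff_add_nonneg, lt_sub_iff_add_lt]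
  rw [this, Real.volume_Ico]
  congr 1
  ring

/-! ### The vectors that enter the collar -/

/-- Coordinates `(w, t)` of vectors on leftward geodesics, subject to a condition `I` on the ratio of
the coordinates of the highest point `w`, a condition `J` on the modulus of the point of entrance to
the `r`-collar, and a condition `T` on the time elapsed since the entrance. -/
def entranceSet (r : ℝ) (I J T : Set ℝ) : Set (ℍ × ℝ) :=
  {p | (p.1.re / p.1.im ∈ I ∧ p.1.im * hitModulus r (p.1.re / p.1.im) ∈ J) ∧
    p.2 - hitTime r (p.1.re / p.1.im) ∈ T}

theorem measurableSet_entranceSet (r : ℝ) {I J T : Set ℝ} (hI : MeasurableSet I)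
    (hJ : MeasurableSet J) (hT : MeasurableSet T) : MeasurableSet (entranceSet r I J T) := by
  have hre : Measurable fun p : ℍ × ℝ => p.1.re :=
    (UpperHalfPlane.continuous_re.comp continuous_fst).measurable
  have him : Measurable fun p : ℍ × ℝ => p.1.im :=
    (UpperHalfPlane.continuous_im.comp continuous_fst).measurable
  have hk := hre.div him
  exact ((hk hI).inter ((him.mul ((measurable_hitModulus r).comp hk)) hJ)).inter
    ((measurable_snd.sub ((measurable_hitTime r).comp hk)) hT)

theorem liouvilleUpper_leftSet_entranceSet (r : ℝ) {I J T : Set ℝ} (hI : MeasurableSet I)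
    (hJ : MeasurableSet J) (hT : MeasurableSet T) {c : ℝ≥0∞}
    (hc : ∀ a, 0 < a → volume {σ | Real.exp σ * a ∈ J} = c) :
    liouvilleUpper (leftSet (entranceSet r I J T)) = volume I * c * volume T := by
  have hS := measurableSet_entranceSet r hI hJ hT
  have hre : Measurable fun w : ℍ => w.re := UpperHalfPlane.continuous_re.measurable
  have him : Measurable fun w : ℍ => w.im := UpperHalfPlane.continuous_im.measurable
  set W := {w : ℍ | w.re / w.im ∈ I ∧ w.im * hitModulus r (w.re / w.im) ∈ J} with hWdef
  have hW : MeasurableSet W :=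
    ((hre.div him) hI).inter ((him.mul ((measurable_hitModulus r).comp (hre.div him))) hJ)
  rw [liouvilleUpper_leftSet hS, Measure.prod_apply hS,
    ← volume_shape_and_scale hI hJ (measurable_hitModulus r) (hitModulus_pos r) hc, ← hWdef, mul_comm,
    ← setLIntegral_const, ← lintegral_indicator hW]
  congr 1
  ext w
  by_cases hw : w ∈ W
  · rw [indicator_of_mem hw]
    have : Prod.mk w ⁻¹' entranceSet r I J T = (fun t => t - hitTime r (w.re / w.im)) ⁻¹' T := by
      ext t
      exact and_iff_right hw
    rw [this, (measurePreserving_sub_right volume _).measure_preimage hT.nullMeasurableSet]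
  · rw [indicator_of_notMem hw]
    have : Prod.mk w ⁻¹' entranceSet r I J T = ∅ :=
      eq_empty_of_forall_notMem fun t ht => hw ht.1
    rw [this, measure_empty]

theorem coordVector_eq_flow_leftward {x y : ℝ} (h : x ≠ y) (hlt : y < x) {w : ℍ}
    (hre : w.re = (x + y) / 2) (him : w.im = (x - y) / 2) (t : ℝ) :
    coordVector x y h t = flow t (leftward w) := by
  rw [coordVector, topVector_of_gt h hlt (w := w) (Complex.ext hre him)]
  rfl

/-- A geodesic from `x` to `y < x` with `x > 0`, and with highest point `w`, meets the boundary line if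
and only if the ratio of the coordinates of `w` is at most `cosh r`. -/
theorem firstHit_iff {l r x y : ℝ} (hr : 0 < r) {h : x ≠ y} {w : ℍ}
    (hv : ∀ t, coordVector x y h t = flow t (leftward w)) (hw : -1 < w.re / w.im) (t : ℝ) :
    FirstHit l r x y h t ↔ (w.re / w.im ≤ Real.cosh r ∧
      w.im * hitModulus r (w.re / w.im) ∈ Icc 1 (Real.exp l)) ∧ t = hitTime r (w.re / w.im) := by
  have hnorm : (flow (hitTime r (w.re / w.im)) (leftward w)).base ∈ boundaryLine r →
      ‖((flow (hitTime r (w.re / w.im)) (leftward w)).base : ℂ)‖ =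
        w.im * hitModulus r (w.re / w.im) := by
    intro hb
    rw [norm_of_mem_boundaryLine ((mem_boundaryLine_iff hr).1 hb), im_flow_leftward, hitModulus]
    ring
  simp only [FirstHit, boundarySegment, hv, mem_ofPred_eq]
  constructor
  · rintro ⟨⟨hb, h1, h2⟩, hfirst⟩
    have hb' := (flow_leftward_mem_boundaryLine_iff hr t w).1 hb
    have hk := (le_abs_self _).trans (abs_le_cosh_of_hit hb')
    have ht : t = hitTime r (w.re / w.im) := by
      refine le_antisymm (not_lt.1 fun hlt => hfirst _ hlt ?_)
        (not_lt.1 fun hlt => no_hit_before hr hw hk hlt hb')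
      exact (flow_leftward_mem_boundaryLine_iff hr _ w).2 (hit_at_hitTime hr hw hk)
    subst ht
    rw [hnorm hb] at h1 h2
    exact ⟨⟨hk, h1, h2⟩, rfl⟩
  · rintro ⟨⟨hk, h12⟩, rfl⟩
    have hb := (flow_leftward_mem_boundaryLine_iff hr _ w).2 (hit_at_hitTime hr hw hk)
    rw [hnorm hb]
    exact ⟨⟨hb, h12⟩, fun t' ht' hb' =>
      no_hit_before hr hw hk ht' ((flow_leftward_mem_boundaryLine_iff hr _ w).1 hb')⟩

theorem neg_one_lt_re_div_im_iff {x y : ℝ} {w : ℍ}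
    (hre : w.re = (x + y) / 2) (him : w.im = (x - y) / 2) : -1 < w.re / w.im ↔ 0 < x := by
  rw [lt_div_iff₀ w.im_pos, hre, him]
  constructor <;> intro h <;> linarith

theorem re_div_im_eq_one_iff {x y : ℝ} {w : ℍ}
    (hre : w.re = (x + y) / 2) (him : w.im = (x - y) / 2) : w.re / w.im = 1 ↔ y = 0 := by
  rw [div_eq_one_iff_eq w.im_ne_zero, hre, him]
  constructor <;> intro h <;> linarith

variable {G : Subgroup SL(2, ℝ)} {l r ε : ℝ}

theorem thickenedSection_subset (hr : 0 < r) {R : ℝ → ℝ → Prop}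
    (hR : ∀ x y, R x y → y < x ∧ 0 < x) :
    thickenedSection G l r ε R ⊆ orbitMk G '' leftSet
      (entranceSet r (Ioc (-1) (Real.cosh r)) (Icc 1 (Real.exp l)) (Icc 0 ε)) := by
  rintro _ ⟨x, y, h, t₀, t, hxy, hhit, -, h1, h2, rfl⟩
  obtain ⟨hlt, hx⟩ := hR x y hxy
  set w : ℍ := ⟨⟨(x + y) / 2, (x - y) / 2⟩, half_pos (sub_pos.2 hlt)⟩
  have hv := coordVector_eq_flow_leftward h hlt (w := w) rfl rfl
  have hk := (neg_one_lt_re_div_im_iff (w := w) (x := x) (y := y) rfl rfl).2 hx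
  obtain ⟨⟨hkr, hm⟩, rfl⟩ := (firstHit_iff hr hv hk t₀).1 hhit
  exact ⟨_, ⟨(w, t), ⟨⟨⟨hk, hkr⟩, hm⟩, sub_nonneg.2 h1, by linarith⟩, rfl⟩, by
    rw [hv]; rfl⟩

/-- The ratio `1` belongs to the geodesics that end at `0`, which neither of the two conditions on
the endpoints allows. -/
theorem proj_mem_thickenedSection (hr : 0 < r) {w : ℍ} {t : ℝ}
    (hwt : (w, t) ∈ entranceSet r (Ioc (-1) (Real.cosh r) \ {1}) (Ico 1 (Real.exp l)) (Ico 0 ε))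
    (hd : proj G (flow (hitTime r (w.re / w.im)) (leftward w)) ∈ denseOrbitSet G) :
    proj G (flow t (leftward w)) ∈
      thickenedSection G l r ε SideCondition ∪ thickenedSection G l r ε CrossCondition := by
  obtain ⟨⟨⟨⟨hk, hkr⟩, hk1⟩, hm⟩, ht1, ht2⟩ := hwt
  have hlt : w.re - w.im < w.re + w.im := by linarith [w.im_pos]
  have hre : w.re = ((w.re + w.im) + (w.re - w.im)) / 2 := by ring
  have him : w.im = ((w.re + w.im) - (w.re - w.im)) / 2 := by ring
  have hv := coordVector_eq_flow_leftward hlt.ne' hlt hre him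
  have hx := (neg_one_lt_re_div_im_iff hre him).1 hk
  have hy : w.re - w.im ≠ 0 := fun h => hk1 ((re_div_im_eq_one_iff hre him).2 h)
  have hhit := (firstHit_iff (l := l) hr hv hk _).2 ⟨⟨hkr, Ico_subset_Icc_self hm⟩, rfl⟩
  have key : ∀ R : ℝ → ℝ → Prop, R (w.re + w.im) (w.re - w.im) →
      proj G (flow t (leftward w)) ∈ thickenedSection G l r ε R := fun R hR =>
    ⟨_, _, hlt.ne', _, t, hR, hhit, by rw [hv]; exact hd, sub_nonneg.1 ht1,
      by linarith, by rw [hv]⟩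
  rcases hy.lt_or_gt with h | h
  · exact Or.inr (key _ ⟨h, hx⟩)
  · exact Or.inl (key _ ⟨h, hlt⟩)

/-- The coordinates `(w, t)`, with `w` in a fundamental domain for the cyclic group of the closed
geodesic, parametrize vectors in the embedded collar, so they do so injectively modulo `G`. -/
theorem injOn_leftSet_entranceSet (hr : 0 < r) (hl : 0 < l) (hcollar : CollarEmbedded G l (r + ε))
    {I : Set ℝ} (hI : I ⊆ Ioc (-1) (Real.cosh r)) :
    InjOn (orbitMk G) (leftSet (entranceSet r I (Ico 1 (Real.exp l)) (Ico 0 ε))) := by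
  have hnhd : ∀ w t, (w, t) ∈ entranceSet r I (Ico 1 (Real.exp l)) (Ico 0 ε) →
      (flow t (leftward w)).base ∈ axisNhd (r + ε) := by
    rintro w t ⟨⟨hk, -⟩, h1, h2⟩
    rw [mem_axisNhd_iff, ← abs_of_pos (UpperHalfPlane.im_pos _), ← abs_div,
      re_div_im_flow_leftward]
    exact abs_lt_sinh_of_near_hitTime hr (hI hk).1 (hI hk).2 (sub_nonneg.1 h1) (by linarith)
  refine injOn_orbitMk_iff.2 ?_
  rintro _ ⟨⟨w, t⟩, hwt, rfl⟩ g hg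
  have hbase : (g • flow t (leftward w)).base ∈ axisNhd (r + ε) := by
    obtain ⟨⟨w', t'⟩, h', heq⟩ := hg
    rw [← heq]
    exact hnhd w' t' h'
  obtain ⟨n, hn⟩ := (hcollar g g.2).resolve_right fun h => h _ (hnhd w t hwt) hbase
  have hn' : ∀ z : ℍ, (((g : SL(2, ℝ)) • z : ℍ) : ℂ) = ((Real.exp l ^ n : ℝ) : ℂ) * z := by
    intro z
    rw [hn z]
    push_cast
    rfl
  -- a power of `z ↦ e^l z` preserves leftward vectors, hence acts on the coordinate `w` alone
  have hleft : (g : SL(2, ℝ)) • leftward w = leftward ((g : SL(2, ℝ)) • w) :=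
    UnitTangent.ext rfl (dir_smul_of_upper_triangular (entries_of_scaling hn').1 _)
  have hgv : g • flow t (leftward w) = flow t (leftward ((g : SL(2, ℝ)) • w)) := by
    rw [← hleft, flow_smul]
    rfl
  have hs : 0 < Real.exp l ^ n := zpow_pos (Real.exp_pos l) n
  have hre : ((g : SL(2, ℝ)) • w).re = Real.exp l ^ n * w.re := by
    have := congrArg Complex.re (hn' w)
    rwa [Complex.re_ofReal_mul] at this
  have him : ((g : SL(2, ℝ)) • w).im = Real.exp l ^ n * w.im := by
    have := congrArg Complex.im (hn' w)
    rwa [Complex.im_ofReal_mul] at this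
  rw [hgv, flow_leftward_mem_leftSet] at hg
  obtain ⟨⟨-, h1, h2⟩, -⟩ := hg
  obtain ⟨⟨-, h3, h4⟩, -⟩ := hwt
  simp only [hre, him, mul_div_mul_left _ _ hs.ne', mul_assoc] at h1 h2
  set a := w.im * hitModulus r (w.re / w.im)
  have h5 : Real.exp l ^ n < Real.exp l ^ (1 : ℤ) := by
    rw [zpow_one]
    exact (le_mul_of_one_le_right hs.le h3).trans_lt h2
  have h6 : Real.exp l ^ (0 : ℤ) < Real.exp l ^ (n + 1) := by
    rw [zpow_zero, zpow_add_one₀ (Real.exp_pos l).ne']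
    exact h1.trans_lt (mul_lt_mul_of_pos_left h4 hs)
  have hexp := Real.one_lt_exp_iff.2 hl
  have h7 := (zpow_lt_zpow_iff_right₀ hexp).1 h5
  have h8 := (zpow_lt_zpow_iff_right₀ hexp).1 h6
  obtain rfl : n = 0 := by omega
  have hgw : (g : SL(2, ℝ)) • w = w := UpperHalfPlane.ext (by rw [hn' w]; simp)
  rw [hgv, hgw]

/-- The union of the two thickened sections is covered by the projection of a set of the expected
measure, and it contains the projection of almost all of another such set, on which the projection is
injective. The two sets differ in boundary points and in the geodesics that end at `0`. -/
theorem quotientMeasure_thickenedSection [DiscreteTopology G] (harea : surfaceArea G ≠ ⊤)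
    (hr : 0 < r) (hl : 0 < l) (hcollar : CollarEmbedded G l (r + ε)) :
    quotientMeasure G UnitTangent liouvilleUpper
        (thickenedSection G l r ε SideCondition ∪ thickenedSection G l r ε CrossCondition) =
      ENNReal.ofReal (1 + Real.cosh r) * ENNReal.ofReal l * ENNReal.ofReal ε := by
  refine le_antisymm ?_ ?_
  · obtain ⟨D, hD, hinj, hcov, -⟩ := exists_fundamental_set_unitTangent G harea
    have hsub := union_subset
      (thickenedSection_subset (G := G) (l := l) (ε := ε) (R := SideCondition) hr
        fun x y h => ⟨h.2, h.1.trans h.2⟩)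
      (thickenedSection_subset (G := G) (l := l) (ε := ε) (R := CrossCondition) hr
        fun x y h => ⟨h.1.trans h.2, h.2⟩)
    refine (measure_mono hsub).trans ((quotientMeasure_image_le hD hinj hcov
      (measurableSet_leftSet (measurableSet_entranceSet r measurableSet_Ioc measurableSet_Icc
        measurableSet_Icc))).trans_eq ?_)
    rw [liouvilleUpper_leftSet_entranceSet r measurableSet_Ioc measurableSet_Icc measurableSet_Icc
      (fun a => volume_exp_mul_mem_Icc l), Real.volume_Ioc, Real.volume_Icc, sub_zero, sub_neg_eq_add,
      add_comm]
  · obtain ⟨P, hP, hflow, hdense⟩ := exists_flow_invariant_dense (G := G) harea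
    set F := leftSet (entranceSet r (Ioc (-1) (Real.cosh r) \ {1}) (Ico 1 (Real.exp l)) (Ico 0 ε))
      with hF
    have hIm : MeasurableSet (Ioc (-1) (Real.cosh r) \ {1}) :=
      measurableSet_Ioc.diff (measurableSet_singleton 1)
    have hmeas : MeasurableSet F := measurableSet_leftSet
      (measurableSet_entranceSet r hIm measurableSet_Ico measurableSet_Ico)
    have hle := measure_inter_le_quotientMeasure (m := liouvilleUpper) hmeas
      (injOn_leftSet_entranceSet hr hl hcollar sdiff_subset)
      (thickenedSection G l r ε SideCondition ∪ thickenedSection G l r ε CrossCondition)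
    have hFm : liouvilleUpper F =
        ENNReal.ofReal (1 + Real.cosh r) * ENNReal.ofReal l * ENNReal.ofReal ε := by
      rw [hF, liouvilleUpper_leftSet_entranceSet r hIm measurableSet_Ico measurableSet_Ico
        (fun a => volume_exp_mul_mem_Ico l), measure_sdiff_null Real.volume_singleton,
        Real.volume_Ioc, Real.volume_Ico, sub_zero, sub_neg_eq_add, add_comm]
    rw [← hFm]
    refine le_trans (measure_mono_ae ?_) hle
    filter_upwards [hP] with v hv hvF
    refine ⟨?_, hvF⟩
    obtain ⟨⟨w, t⟩, hwt, rfl⟩ := hvF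
    exact proj_mem_thickenedSection hr hwt
      (hdense _ ((hflow _ _).2 ((hflow t _).1 hv)))

end HypCollar

end

theorem mainTheorem7 (G : Subgroup SL(2, ℝ)) [DiscreteTopology G] (l r ε : ℝ)
    (harea : HypCollar.surfaceArea G ≠ ⊤)
    (hγ : HypCollar.CoversSimpleClosedGeodesic G l)
    (hr : 0 < r) (hε : 0 < ε)
    (hcollar :
      (HypCollar.NoConePoints G ∧ r + ε < Real.log (Real.cosh (l / 4) / Real.sinh (l / 4))) ∨
        HypCollar.CollarEmbedded G l (r + ε)) :
    HypCollar.liouville G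
        (HypCollar.thickenedSection G l r ε HypCollar.SideCondition ∪
          HypCollar.thickenedSection G l r ε HypCollar.CrossCondition) =
      ENNReal.ofReal
        (ε * (1 + Real.cosh r) * l / (2 * Real.pi * (HypCollar.surfaceArea G).toReal)) := by
  have hcol : HypCollar.CollarEmbedded G l (r + ε) :=
    hcollar.elim (fun h => HypCollar.collarEmbedded_of_noConePoints hγ h.1 h.2) id
  have hl := hγ.length_pos
  have hA : 0 < (HypCollar.surfaceArea G).toReal :=
    ENNReal.toReal_pos (HypCollar.surfaceArea_ne_zero G) harea
  have hc : 0 < 1 + Real.cosh r := by positivity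
  rw [HypCollar.liouville, Measure.smul_apply, smul_eq_mul,
    HypCollar.quotientMeasure_thickenedSection harea hr hl hcol,
    ← ENNReal.ofReal_mul hc.le, ← ENNReal.ofReal_mul (by positivity),
    ← ENNReal.ofReal_toReal harea, ← ENNReal.ofReal_mul (by positivity),
    ← ENNReal.ofReal_inv_of_pos (by positivity), ← ENNReal.ofReal_mul (by positivity),
    ENNReal.toReal_ofReal hA.le]
  congr 1
  field_simp
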